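/- **Setting.** Let $(M,h)$ be an oriented Riemannian manifold of dimension $n\ge 3$ which is Einstein, $Ric(h)=\tfrac{2J}{n}(n-1)h$ with a constant $J\in\mathbb R$. Let $0\le p\le n$, $\beta:=n-2p$, $\lambda\in\mathbb C$ with $\lambda\ne\beta$. Forms are complex-valued and smooth, $\Omega^{-1}(M):=0$, $d$ is the exterior derivative, $\delta=\delta^h$ the codifferential, $\Delta^h=d\delta+\delta d$. On $X=M\times(0,\varepsilon)$ consider the Poincaré–Einstein metric $g_+=r^{-2}\big(dr^2+(1-\tfrac{J}{2n}r^2)^2h\big)$ with form Laplacian $\Delta^{g_+}$. For $\omega_j^{(+)}\in\Omega^p(M)$, $\omega^{(-)}_j\in\Omega^{p-1}(M)$ consider $$\omega=\sum_{j\ge0}r^{\lambda+j}\omega_j^{(+)}+\tfrac{dr}{r}\wedge\sum_{j\ge0}r^{\lambda+j}\omega_j^{(-)}\qquad(1)$$ and the eigenequation $\Delta^{g_+}\omega=\lambda(\beta-\lambda)\omega$. It is said to hold up to order $K$ if, for the partial sum over $j\le K$, the components of $\Delta^{g_+}\omega-\lambda(\beta-\lambda)\omega$ in the directions of $TM$ and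 of $r\partial_r$ are $o(r^{\lambda+K})$ as $r\to0^+$, pointwise on $M$. The associated recurrence relations are, with $c=\tfrac{J}{2n}$ and $\omega_i^{(\pm)}=0$ for $i<0$, $$A_j\omega_j^{(-)}=B_jc\,\omega^{(-)}_{j-2}+C_jc^2\omega^{(-)}_{j-4}+D_jc^3\omega^{(-)}_{j-6}+\Delta^h\omega^{(-)}_{j-2}-c\,\Delta^h\omega^{(-)}_{j-4}+2\delta\omega^{(+)}_{j-2}+2c\,\delta\omega^{(+)}_{j-4},$$ $$a_j\omega_j^{(+)}=b_jc\,\omega^{(+)}_{j-2}+c_jc^2\omega^{(+)}_{j-4}+\Delta^h\omega^{(+)}_{j-2}+2d\omega^{(-)}_j-2c^2d\omega^{(-)}_{j-4}\qquad(2)$$ for $j\ge 1$, where $A_j=-[(j-2)(\beta-2\lambda-j+2)+2(\beta-\lambda-j+2)]$, $B_j=-3[(j-4)(\beta-2\lambda-j+4)+2(\beta-\lambda-j+4)]+2(\beta+2)(\lambda+j)$, $C_j=3[(j-6)(\beta-2\lambda-j+6)+2(\beta-\lambda-j+6)]-4(\beta+2)(\lambda+j-3)$, $D_j=-[(j-8)(\beta-2\lambda-j+8)+2(\beta-\lambda-j+8)]+2(\beta+2)(\lambda+j-6)$,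 $a_j=-j(\beta-2\lambda-j)$, $b_j=2[(j-2)(\lambda+j-2)+\lambda(\beta+j-2)]$, $c_j=-(2\lambda+j-4)(\beta+j-4)$. **Polynomials.** With $(a)_k=a(a+1)\cdots(a+k-1)$ let $R_k(y;\alpha)=\prod_{l=1}^k[y-(\alpha-l)(\alpha-l+1)]$, $$s^{(\mp)}_m(y)=\sum_{k=0}^m\tbinom mk(\tfrac\beta2-\lambda-m)_{m-k}(-\tfrac\beta2-m\mp1)_{m-k}R_k(y;0),$$ $$R^{(1)}_k(y)=\sum_{j=1}^k(\tfrac\beta2-k+j+1)_{2(k-j)}\big[y-\tfrac\beta2(\tfrac\beta2+1)\big]R_{j-1}(y;k),\qquad s^{(1)}_m(y)=\sum_{k=0}^mD^{(1)}_k(m)R^{(1)}_k(y),$$ where $D^{(1)}_k(m)=\binom mk(\lambda-\tfrac\beta2+k+1)_{m-k}(\tfrac\beta2+k+1)_{m-k-1}[k(\lambda+\beta+2m)+\tfrac\beta2(\lambda-\beta-2m)]$ for $k<m$ and $D^{(1)}_m(m)=\lambda-\beta+2m$. **Solution operators.** For $m\ge1$ let $$\mathcal T^{(-)}_m(\lambda)=\Big[(\lambda-\beta)\prod_{k=1}^{m-1}a_{2k}\Big]^{-1}(\tfrac{2J}n)^{m-1}s^{(-)}_{m-1}(y^{(-)})\circ\delta,$$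 $$\mathcal T^{(+)}_m(\lambda)=\Big[(\lambda-\beta)\prod_{k=1}^{m}a_{2k}\Big]^{-1}(\tfrac{2J}n)^{m}\Big[(\lambda-\beta)s^{(+)}_m(y^{(+)})+s^{(1)}_m(y^{(1)})\Big]$$ with $y^{(-)}=\tfrac n{2J}\delta d+\tfrac\beta2(\tfrac\beta2+1)$, $y^{(+)}=\tfrac n{2J}\delta d+\tfrac\beta2(\tfrac\beta2-1)$, $y^{(1)}=\tfrac n{2J}d\delta+\tfrac\beta2(\tfrac\beta2+1)$; moreover $\mathcal T^{(-)}_0=0$, $\mathcal T_0^{(+)}=\mathrm{Id}$. Here $(\tfrac{2J}n)^Ns(\tfrac n{2J}D+\gamma)$ is expanded in powers of $D$, so that it is polynomial in $J$ and also makes sense for $J=0$. **Theorem.** Let $\varphi\in\Omega^p(M)$, $m\in\mathbb N_0$, and suppose that $\lambda\ne\tfrac\beta2-N$ for all $N\in\{1,\dots,m\}$, or that $\lambda=\tfrac\beta2-N$ for some $N\in\mathbb N$ with $m<N$. Then 1. $\omega^{(\pm)}_{2k}=\mathcal T^{(\pm)}_k(\lambda)\varphi$ for $k\le m$, with $\omega_j^{(\pm)}=0$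 for odd $j$, are smooth forms with $\omega^{(+)}_0=\varphi$, $\omega^{(-)}_0=0$ which solve the recurrence relations (2) for $1\le j\le 2m$, and the form (1) solves the eigenequation up to order $2m$. 2. Conversely, let $(\omega_j^{(\pm)})_{j\ge0}$ be smooth forms with $\omega_0^{(+)}=\varphi$, $\omega_0^{(-)}=0$ which solve (2) for $1\le j\le 2m$, or for which (1) solves the eigenequation up to order $2m$. Then $\omega^{(\pm)}_{2k}=\mathcal T^{(\pm)}_k(\lambda)\varphi$ for every $k\le m$ such that $p=0$ or $A_{2i}\neq0$ for all $1\le i\le k$. -/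

import Mathlib

open Set Filter Topology Polynomial
open scoped Manifold ContDiff Asymptotics

noncomputable section

namespace PoincareEinstein

/-! ### Exterior algebra of a tangent space -/

section Pointwise

lemma append_update_cast {V : Type*} {p q N : ℕ} (h : p + q = N) (w : Fin p → V) [DecidableEq (Fin q)]
    (v : Fin q → V) (i : Fin q) (x : V) :
    (fun k : Fin N => Fin.append w (Function.update v i x) (Fin.cast h.symm k)) =
      Function.update (fun k : Fin N => Fin.append w v (Fin.cast h.symm k))
        (Fin.cast h (Fin.natAdd p i)) x := by
  subst h
  ext k
  refine Fin.addCases (fun l => ?_) (fun l => ?_) k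
  · have : Fin.castAdd q l ≠ Fin.natAdd p i := by
      intro hh
      have := congrArg Fin.val hh
      simp at this
      omega
    simp [Function.update_of_ne this]
  · by_cases hl : l = i
    · subst hl; simp
    · have : Fin.natAdd p l ≠ Fin.natAdd p i := fun hh => hl (by simpa using hh)
      simp [Function.update_of_ne this, Function.update_of_ne hl]

variable {V : Type*} [AddCommGroup V] [Module ℝ V] [TopologicalSpace V]
variable {F : Type*} [NormedAddCommGroup F] [NormedSpace ℝ F]

/-- The `q`-form `v ↦ μ (w₁, …, w_p, v₁, …, v_q)`. -/
def insertFirst {p q N : ℕ} (h : p + q = N) (μ : V [⋀^Fin N]→L[ℝ] ℝ) (w : Fin p → V) :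
    V [⋀^Fin q]→L[ℝ] ℝ where
  toFun v := μ (fun k => Fin.append w v (Fin.cast h.symm k))
  map_update_add' v i x y := by
    simp only [append_update_cast h]
    exact μ.map_update_add _ _ _ _
  map_update_smul' v i c x := by
    simp only [append_update_cast h]
    exact μ.map_update_smul _ _ _ _
  cont := by
    refine μ.cont.comp (continuous_pi fun k => ?_)
    subst h
    refine Fin.addCases (fun l => ?_) (fun l => ?_) k
    · simpa using continuous_const
    · simpa using continuous_apply l
  map_eq_zero_of_eq' v i j hv hij := by
    refine μ.map_eq_zero_of_eq (i := Fin.cast h (Fin.natAdd p i))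
      (j := Fin.cast h (Fin.natAdd p j)) _ (by simpa using hv) ?_
    intro hh
    exact hij (by simpa using hh)

/-- The wedge product `θ ∧ η` of a `1`-form and a `p`-form,
`(θ ∧ η)(v₀, …, v_p) = ∑ (-1)^i θ(v_i) η(v₀, …, v̂_i, …, v_p)`. -/
def wedge {p : ℕ} (θ : V →L[ℝ] ℝ) (η : V [⋀^Fin p]→L[ℝ] F) : V [⋀^Fin (p + 1)]→L[ℝ] F :=
  { AlternatingMap.alternatizeUncurryFin
      ((θ : V →ₗ[ℝ] ℝ).smulRight η.toAlternatingMap) with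
    cont := by
      show Continuous fun v : Fin (p + 1) → V => AlternatingMap.alternatizeUncurryFin
        ((θ : V →ₗ[ℝ] ℝ).smulRight η.toAlternatingMap) v
      simp only [AlternatingMap.alternatizeUncurryFin_apply]
      refine continuous_finsetSum _ fun i _ => ?_
      have h1 : Continuous fun v : Fin (p + 1) → V => θ (v i) :=
        θ.continuous.comp (continuous_apply i)
      have h2 : Continuous fun v : Fin (p + 1) → V => η (i.removeNth v) :=
        η.cont.comp (continuous_pi fun j => continuous_apply _)
      exact (h1.smul h2).const_smul ((-1 : ℤ) ^ (i : ℕ)) }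

lemma wedge_apply {p : ℕ} (θ : V →L[ℝ] ℝ) (η : V [⋀^Fin p]→L[ℝ] F) (v : Fin (p + 1) → V) :
    wedge θ η v = ∑ i : Fin (p + 1), (-1 : ℤ) ^ (i : ℕ) • θ (v i) • η (i.removeNth v) :=
  AlternatingMap.alternatizeUncurryFin_apply _ _

/-- `e₁, …, e_N` is orthonormal for the scalar product `g`. -/
def IsOrthonormalFrame {N : ℕ} (g : V → V → ℝ) (e : Fin N → V) : Prop :=
  ∀ i j, g (e i) (e j) = if i = j then 1 else 0

open Classical in
/-- The Hodge star of an `N`-dimensional space `V` with scalar product `g` and volume form `μ`: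
`⋆β = (1/p!) ∑ β(e_{i₁}, …, e_{i_p}) μ(e_{i₁}, …, e_{i_p}, ·)` for an orthonormal basis `e`
(the result does not depend on the basis). -/
def hodgeStar {p q N : ℕ} (h : p + q = N) (g : V → V → ℝ) (μ : V [⋀^Fin N]→L[ℝ] ℝ)
    (β : V [⋀^Fin p]→L[ℝ] ℂ) : V [⋀^Fin q]→L[ℝ] ℂ :=
  if he : ∃ e : Fin N → V, IsOrthonormalFrame g e then
    ((p.factorial : ℝ)⁻¹) • ∑ i : Fin p → Fin N,
      ((ContinuousLinearMap.id ℝ ℝ).smulRight (β fun k => he.choose (i k))).compContinuousAlternatingMap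
        (insertFirst h μ fun k => he.choose (i k))
  else 0

end Pointwise

/-! ### Differential forms on a manifold without boundary -/

section Forms

universe uE uM

variable {E : Type uE} [NormedAddCommGroup E] [NormedSpace ℝ E]
variable {H : Type*} [TopologicalSpace H] (I : ModelWithCorners ℝ E H)
variable (M : Type uM) [TopologicalSpace M] [ChartedSpace H M]
variable (F : Type*) [NormedAddCommGroup F] [NormedSpace ℝ F]

/-- (Not necessarily smooth) `F`-valued `p`-forms on `M`. -/
abbrev DForm (p : ℕ) : Type _ := (x : M) → (TangentSpace I x) [⋀^Fin p]→L[ℝ] F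

/-- Complex `(p-1)`-forms on `M`, understood as the zero space for `p = 0`. -/
def LowForm : ℕ → Type (max uM uE)
  | 0 => PUnit.{max uM uE + 1}
  | k + 1 => DForm I M ℂ k

instance : ∀ p, AddCommGroup (LowForm I M p)
  | 0 => (inferInstance : AddCommGroup PUnit.{max uM uE + 1})
  | k + 1 => (inferInstance : AddCommGroup (DForm I M ℂ k))

instance : ∀ p, Module ℂ (LowForm I M p)
  | 0 => (inferInstance : Module ℂ PUnit.{max uM uE + 1})
  | k + 1 => (inferInstance : Module ℂ (DForm I M ℂ k))

variable {I M F}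

/-- The expression of a form in the preferred chart at `x₀`, a form on the model space. -/
def inChart {p : ℕ} (x₀ : M) (α : DForm I M F p) (y : E) : E [⋀^Fin p]→L[ℝ] F :=
  (α ((extChartAt I x₀).symm y)).compContinuousLinearMap
    (mfderiv 𝓘(ℝ, E) I (extChartAt I x₀).symm y)

/-- Smooth forms: all chart expressions are smooth. -/
def IsSmoothForm {p : ℕ} (α : DForm I M F p) : Prop :=
  ∀ x₀ : M, ContDiffOn ℝ ∞ (inChart x₀ α) (extChartAt I x₀).target

/-- Smoothness of a `(p-1)`-form. -/
def IsSmoothLow : ∀ {p : ℕ}, LowForm I M p → Prop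
  | 0, _ => True
  | k + 1, α => IsSmoothForm (p := k) (I := I) (M := M) (F := ℂ) α

/-- The exterior derivative, computed at `x` in the preferred chart at `x`. -/
def extD {p : ℕ} (α : DForm I M F p) : DForm I M F (p + 1) := fun x =>
  (extDeriv (inChart x α) (extChartAt I x x)).compContinuousLinearMap
    (mfderiv I 𝓘(ℝ, E) (extChartAt I x) x)

/-- The exterior derivative `Ω^{p-1} → Ω^p`. -/
def extDLow : ∀ {p : ℕ}, LowForm I M p → DForm I M ℂ p
  | 0, _ => 0
  | k + 1, α => extD (p := k) (I := I) (M := M) (F := ℂ) α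

variable {N : ℕ} (g : ∀ x : M, TangentSpace I x → TangentSpace I x → ℝ) (vol : DForm I M ℝ N)

/-- The codifferential `δ = (-1)^{p+1} ⋆⁻¹ d ⋆ : Ω^{p+1} → Ω^p` of an `N`-dimensional
Riemannian manifold with metric `g` and volume form `vol`, where
`⋆⁻¹ = (-1)^{p(N-p)} ⋆` on `Ω^{N-p}`. It vanishes if `p + 1 > N`. -/
def codiffSucc {p : ℕ} (α : DForm I M ℂ (p + 1)) : DForm I M ℂ p :=
  if h : p + 1 ≤ N then
    fun x => ((-1 : ℂ) ^ (p + 1 + p * (N - p))) •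
      hodgeStar (p := N - (p + 1) + 1) (q := p) (by omega) (g x) (vol x)
        (extD (fun z => hodgeStar (p := p + 1) (q := N - (p + 1)) (by omega) (g z) (vol z) (α z)) x)
  else 0

/-- The codifferential `Ω^p → Ω^{p-1}`. -/
def codiff : ∀ {p : ℕ}, DForm I M ℂ p → LowForm I M p
  | 0, _ => PUnit.unit
  | _ + 1, α => codiffSucc g vol α

/-- The form Laplacian `Δ = dδ + δd` on `Ω^p`. -/
def formLaplacian {p : ℕ} (α : DForm I M ℂ p) : DForm I M ℂ p :=
  extDLow (codiff g vol α) + codiffSucc g vol (extD α)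

/-- The form Laplacian on `Ω^{p-1}`. -/
def formLaplacianLow : ∀ {p : ℕ}, LowForm I M p → LowForm I M p
  | 0, _ => PUnit.unit
  | k + 1, α => formLaplacian (p := k) g vol α

/-- `vol` is the Riemannian volume form of `g` for some orientation: a smooth top-degree form
with values `±1` on orthonormal frames. -/
def IsVolumeForm : Prop :=
  IsSmoothForm vol ∧
    ∀ (x : M) (e : Fin N → TangentSpace I x), IsOrthonormalFrame (g x) e → |vol x e| = 1

end Forms

/-! ### Einstein metrics -/

section Einstein

variable {n : ℕ} {M : Type*} [TopologicalSpace M] [ChartedSpace (EuclideanSpace ℝ (Fin n)) M]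
  [IsManifold (𝓡 n) ∞ M]

/-- Smooth Riemannian metrics on an `n`-manifold. -/
abbrev RMetric (n : ℕ) (M : Type*) [TopologicalSpace M]
    [ChartedSpace (EuclideanSpace ℝ (Fin n)) M] [IsManifold (𝓡 n) ∞ M] : Type _ :=
  Bundle.ContMDiffRiemannianMetric (𝓡 n) ∞ (EuclideanSpace ℝ (Fin n))
    (fun x : M => TangentSpace (𝓡 n) x)

/-- The metric as a family of scalar products. -/
def RMetric.toFun (h : RMetric n M) (x : M) (u v : TangentSpace (𝓡 n) x) : ℝ := h.inner x u v

/-- Partial derivatives in `ℝⁿ`. -/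
def pd (i : Fin n) (f : EuclideanSpace ℝ (Fin n) → ℝ) (y : EuclideanSpace ℝ (Fin n)) : ℝ :=
  fderiv ℝ f y (EuclideanSpace.single i 1)

/-- The components `h_ij` of the metric in the preferred chart at `x₀`. -/
def metricCoord (h : RMetric n M) (x₀ : M) (i j : Fin n) (y : EuclideanSpace ℝ (Fin n)) : ℝ :=
  h.inner ((extChartAt (𝓡 n) x₀).symm y)
    (mfderiv 𝓘(ℝ, EuclideanSpace ℝ (Fin n)) (𝓡 n) (extChartAt (𝓡 n) x₀).symm y
      (EuclideanSpace.single i (1 : ℝ) : EuclideanSpace ℝ (Fin n)))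
    (mfderiv 𝓘(ℝ, EuclideanSpace ℝ (Fin n)) (𝓡 n) (extChartAt (𝓡 n) x₀).symm y
      (EuclideanSpace.single j (1 : ℝ) : EuclideanSpace ℝ (Fin n)))

/-- The Christoffel symbols `Γ^k_ij`. -/
def christoffel (h : RMetric n M) (x₀ : M) (k i j : Fin n) (y : EuclideanSpace ℝ (Fin n)) : ℝ :=
  (1 / 2) * ∑ l, (Matrix.of fun a b => metricCoord h x₀ a b y)⁻¹ k l *
    (pd i (metricCoord h x₀ j l) y + pd j (metricCoord h x₀ i l) y - pd l (metricCoord h x₀ i j) y)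

/-- The Ricci tensor
`R_ij = ∂_k Γ^k_ij - ∂_j Γ^k_ik + Γ^k_kl Γ^l_ij - Γ^k_jl Γ^l_ik`. -/
def ricciCoord (h : RMetric n M) (x₀ : M) (i j : Fin n) (y : EuclideanSpace ℝ (Fin n)) : ℝ :=
  ∑ k, (pd k (christoffel h x₀ k i j) y - pd j (christoffel h x₀ k i k) y +
    ∑ l, (christoffel h x₀ k k l y * christoffel h x₀ l i j y -
      christoffel h x₀ k j l y * christoffel h x₀ l i k y))

/-- `Ric(h) = (2J/n)(n-1) h`. -/
def IsEinstein (h : RMetric n M) (J : ℝ) : Prop :=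
  ∀ (x₀ : M), ∀ y ∈ (extChartAt (𝓡 n) x₀).target, ∀ i j,
    ricciCoord h x₀ i j y = 2 * J / n * (n - 1) * metricCoord h x₀ i j y

end Einstein

/-! ### The Poincaré–Einstein metric of an Einstein manifold -/

section PE

variable {n : ℕ} {M : Type*} [TopologicalSpace M] [ChartedSpace (EuclideanSpace ℝ (Fin n)) M]
  [IsManifold (𝓡 n) ∞ M]

/-- The model of `M × ℝ`, which contains `X = M × (0, ε)` as an open subset. The metric `g₊` and
the forms below matter only for small `r > 0`, and all operators are local. -/
abbrev modelX (n : ℕ) := (𝓡 n).prod 𝓘(ℝ, ℝ)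

/-- The function `J(r) = 1 - (J/2n) r²`. -/
def Jfun (n : ℕ) (J r : ℝ) : ℝ := 1 - J / (2 * n) * r ^ 2

/-- The differential of the projection `π : M × ℝ → M`. -/
def dπ (z : M × ℝ) : TangentSpace (modelX n) z →L[ℝ] TangentSpace (𝓡 n) z.1 :=
  mfderiv (modelX n) (𝓡 n) Prod.fst z

/-- The `1`-form `dr`. -/
def dr (z : M × ℝ) : TangentSpace (modelX n) z →L[ℝ] ℝ :=
  mfderiv (modelX n) 𝓘(ℝ, ℝ) (Prod.snd : M × ℝ → ℝ) z

/-- The pull-back `π^* η`. -/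
def pull {F : Type*} [NormedAddCommGroup F] [NormedSpace ℝ F] {p : ℕ}
    (η : DForm (𝓡 n) M F p) : DForm (modelX n) (M × ℝ) F p :=
  fun z => (η z.1).compContinuousLinearMap (dπ z)

/-- The form `dr ∧ π^* η` for a `(p-1)`-form `η`. -/
def drWedge : ∀ {p : ℕ}, LowForm (𝓡 n) M p → DForm (modelX n) (M × ℝ) ℂ p
  | 0, _ => 0
  | k + 1, η => fun z => wedge (dr z) (pull (p := k) (F := ℂ) (n := n) (M := M) η z)

/-- `g₊ = r⁻² (dr² + J(r)² h)`. -/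
def gPlus (h : RMetric n M) (J : ℝ) (z : M × ℝ) (u v : TangentSpace (modelX n) z) : ℝ :=
  (z.2 ^ 2)⁻¹ * (dr z u * dr z v + Jfun n J z.2 ^ 2 * h.toFun z.1 (dπ z u) (dπ z v))

/-- The volume form `r^{-n-1} J(r)^n dr ∧ vol` of `g₊`. -/
def volPlus (vol : DForm (𝓡 n) M ℝ n) (J : ℝ) : DForm (modelX n) (M × ℝ) ℝ (n + 1) :=
  fun z => ((z.2 ^ (n + 1))⁻¹ * Jfun n J z.2 ^ n) • wedge (dr z) (pull vol z)

/-- The form Laplacian of `g₊`. -/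
def laplacianPlus (h : RMetric n M) (vol : DForm (𝓡 n) M ℝ n) (J : ℝ) {p : ℕ}
    (α : DForm (modelX n) (M × ℝ) ℂ p) : DForm (modelX n) (M × ℝ) ℂ p :=
  formLaplacian (gPlus h J) (volPlus vol J) α

/-- The partial sum `∑_{j ≤ K} r^{λ+j} (ω_j^(+) + (dr/r) ∧ ω_j^(-))`. -/
def partialSum {p : ℕ} (lam : ℂ) (wp : ℕ → DForm (𝓡 n) M ℂ p) (wm : ℕ → LowForm (𝓡 n) M p)
    (K : ℕ) : DForm (modelX n) (M × ℝ) ℂ p := fun z =>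
  ∑ j ∈ Finset.range (K + 1),
    ((z.2 : ℂ) ^ (lam + j)) • (pull (wp j) z + ((z.2 : ℂ)⁻¹) • drWedge (wm j) z)

/-- The tangent vector `v + c · r∂_r` at `(x, r)`. -/
def bVector (x : M) (r : ℝ) (u : TangentSpace (𝓡 n) x × ℝ) : TangentSpace (modelX n) (x, r) :=
  ((u.1, r * u.2) : EuclideanSpace ℝ (Fin n) × ℝ)

/-- `∑ r^{λ+j} (ω_j^(+) + (dr/r) ∧ ω_j^(-))` solves `Δ^{g₊} ω = λ(n-2p-λ) ω` asymptotically up to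
the order `r^{λ+K}`: the components, in directions of `T_xM` and of `r∂_r`, of
`Δ^{g₊} ω - λ(n-2p-λ) ω` for the partial sum up to `j = K` are `o(r^{λ+K})` as `r → 0+`. -/
def IsAsymptoticSolution {p : ℕ} (h : RMetric n M) (vol : DForm (𝓡 n) M ℝ n) (J : ℝ) (lam : ℂ)
    (wp : ℕ → DForm (𝓡 n) M ℂ p) (wm : ℕ → LowForm (𝓡 n) M p) (K : ℕ) : Prop :=
  ∀ (x : M) (u : Fin p → TangentSpace (𝓡 n) x × ℝ),
    (fun r : ℝ =>
      (laplacianPlus h vol J (partialSum lam wp wm K) (x, r) -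
        (lam * (n - 2 * p - lam)) • partialSum lam wp wm K (x, r)) fun i => bVector x r (u i))
      =o[𝓝[>] 0] fun r : ℝ => r ^ (lam.re + K)

end PE

/-! ### The recurrence relations -/

section Recurrence

def coeffA (β lam j : ℂ) : ℂ := -((j - 2) * (β - 2 * lam - j + 2) + 2 * (β - lam - j + 2))

def coeffB (β lam j : ℂ) : ℂ :=
  -3 * ((j - 4) * (β - 2 * lam - j + 4) + 2 * (β - lam - j + 4)) + 2 * (β + 2) * (lam + j)

def coeffC (β lam j : ℂ) : ℂ :=
  3 * ((j - 6) * (β - 2 * lam - j + 6) + 2 * (β - lam - j + 6)) - 4 * (β + 2) * (lam + j - 3)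

def coeffD (β lam j : ℂ) : ℂ :=
  -((j - 8) * (β - 2 * lam - j + 8) + 2 * (β - lam - j + 8)) + 2 * (β + 2) * (lam + j - 6)

def coeffa (β lam j : ℂ) : ℂ := -j * (β - 2 * lam - j)

def coeffb (β lam j : ℂ) : ℂ := 2 * ((j - 2) * (lam + j - 2) + lam * (β + j - 2))

def coeffc (β lam j : ℂ) : ℂ := -(2 * lam + j - 4) * (β + j - 4)

/-- `w_{j-k}`, which is zero for `k > j`. -/
def prev {V : Type*} [Zero V] (w : ℕ → V) (j k : ℕ) : V := if k ≤ j then w (j - k) else 0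

variable {n : ℕ} {M : Type*} [TopologicalSpace M] [ChartedSpace (EuclideanSpace ℝ (Fin n)) M]
  [IsManifold (𝓡 n) ∞ M]

/-- The recurrence relations of index `1 ≤ j ≤ K` for the coefficients of an asymptotic
eigenform, with `c = J/(2n)` and `β = n - 2p`. -/
def SolvesRecurrence {p : ℕ} (h : RMetric n M) (vol : DForm (𝓡 n) M ℝ n) (J : ℝ) (lam : ℂ)
    (wp : ℕ → DForm (𝓡 n) M ℂ p) (wm : ℕ → LowForm (𝓡 n) M p) (K : ℕ) : Prop :=
  let β : ℂ := n - 2 * p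
  let c : ℂ := J / (2 * n)
  ∀ j : ℕ, 1 ≤ j → j ≤ K →
    (coeffA β lam j • wm j =
      (coeffB β lam j * c) • prev wm j 2 + (coeffC β lam j * c ^ 2) • prev wm j 4 +
        (coeffD β lam j * c ^ 3) • prev wm j 6 +
        formLaplacianLow h.toFun vol (prev wm j 2) -
        c • formLaplacianLow h.toFun vol (prev wm j 4) +
        (2 : ℂ) • codiff h.toFun vol (prev wp j 2) +
        (2 * c) • codiff h.toFun vol (prev wp j 4)) ∧
    (coeffa β lam j • wp j =
      (coeffb β lam j * c) • prev wp j 2 + (coeffc β lam j * c ^ 2) • prev wp j 4 +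
        formLaplacian h.toFun vol (prev wp j 2) +
        (2 : ℂ) • extDLow (wm j) - (2 * c ^ 2) • extDLow (prev wm j 4))

end Recurrence

/-! ### The polynomials and the solution operators -/

section Polynomials

/-- The Pochhammer symbol `(a)_k = a (a+1) ⋯ (a+k-1)`. -/
def poch (a : ℂ) (k : ℕ) : ℂ := (ascPochhammer ℂ k).eval a

/-- `R_k(y; α) = ∏_{l=1}^k (y - (α-l)(α-l+1))`. -/
def polyR (k : ℕ) (α : ℂ) : ℂ[X] := ∏ l ∈ Finset.Icc 1 k, (X - C ((α - l) * (α - l + 1)))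

/-- `s^(-)_m`. -/
def sMinus (β lam : ℂ) (m : ℕ) : ℂ[X] :=
  ∑ k ∈ Finset.range (m + 1),
    C (m.choose k * poch (β / 2 - lam - m) (m - k) * poch (-β / 2 - m - 1) (m - k)) * polyR k 0

/-- `s^(+)_m`. -/
def sPlus (β lam : ℂ) (m : ℕ) : ℂ[X] :=
  ∑ k ∈ Finset.range (m + 1),
    C (m.choose k * poch (β / 2 - lam - m) (m - k) * poch (-β / 2 - m + 1) (m - k)) * polyR k 0

/-- `R^(1)_k(y) = ∑_{j=1}^k (β/2-k+j+1)_{2(k-j)} (y - β/2(β/2+1)) R_{j-1}(y; k)`. -/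
def polyR1 (β : ℂ) (k : ℕ) : ℂ[X] :=
  ∑ j ∈ Finset.Icc 1 k,
    C (poch (β / 2 - k + j + 1) (2 * (k - j))) * (X - C (β / 2 * (β / 2 + 1))) * polyR (j - 1) k

/-- The coefficient `D^(1)_k(m)` of `s^(1)_m`. For `k = m` the formula reads
`(β/2+m+1)_{-1} (m(λ+β+2m) + β/2(λ-β-2m))` with `(a)_{-1} = 1/(a-1)`; as the second factor is
`(β/2+m)(λ-β+2m)`, this is `λ-β+2m`, which is taken as the value also for `β/2 + m = 0`. -/
def coeffD1 (β lam : ℂ) (m k : ℕ) : ℂ :=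
  if k = m then lam - β + 2 * m
  else m.choose k * poch (lam - β / 2 + k + 1) (m - k) * poch (β / 2 + k + 1) (m - k - 1) *
    (k * (lam + β + 2 * m) + β / 2 * (lam - β - 2 * m))

/-- `s^(1)_m`. -/
def s1 (β lam : ℂ) (m : ℕ) : ℂ[X] :=
  ∑ k ∈ Finset.range (m + 1), C (coeffD1 β lam m k) * polyR1 β k

lemma natDegree_polyR_le (k : ℕ) (α : ℂ) : (polyR k α).natDegree ≤ k := by
  refine (natDegree_prod_le _ _).trans ((Finset.sum_le_sum fun l _ => natDegree_X_sub_C_le _).trans ?_)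
  simp

lemma natDegree_sMinus_le (β lam : ℂ) (m : ℕ) : (sMinus β lam m).natDegree ≤ m :=
  natDegree_sum_le_of_forall_le _ _ fun k hk => (natDegree_C_mul_le _ _).trans
    ((natDegree_polyR_le k 0).trans (Nat.lt_succ_iff.1 (Finset.mem_range.1 hk)))

lemma natDegree_sPlus_le (β lam : ℂ) (m : ℕ) : (sPlus β lam m).natDegree ≤ m :=
  natDegree_sum_le_of_forall_le _ _ fun k hk => (natDegree_C_mul_le _ _).trans
    ((natDegree_polyR_le k 0).trans (Nat.lt_succ_iff.1 (Finset.mem_range.1 hk)))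

lemma natDegree_s1_le (β lam : ℂ) (m : ℕ) : (s1 β lam m).natDegree ≤ m := by
  refine natDegree_sum_le_of_forall_le _ _ fun k hk => (natDegree_C_mul_le _ _).trans ?_
  refine le_trans ?_ (Nat.lt_succ_iff.1 (Finset.mem_range.1 hk))
  refine natDegree_sum_le_of_forall_le _ _ fun j hj => ?_
  have hj' := Finset.mem_Icc.1 hj
  have h1 := natDegree_polyR_le (j - 1) (k : ℂ)
  have h2 : (C (poch (β / 2 - k + j + 1) (2 * (k - j))) *
      (X - C (β / 2 * (β / 2 + 1)))).natDegree ≤ 1 :=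
    (natDegree_C_mul_le _ _).trans (natDegree_X_sub_C_le _)
  have h3 := natDegree_mul_le (p := C (poch (β / 2 - k + j + 1) (2 * (k - j))) *
      (X - C (β / 2 * (β / 2 + 1)))) (q := polyR (j - 1) (k : ℂ))
  omega

/-- The operator `κ^N s(κ⁻¹ D + c)` for a polynomial `s` of degree at most `N`, expanded in powers
of `D`, so that it makes sense for `κ = 0` as well. -/
def scaledEval {V : Type*} [AddCommGroup V] [Module ℂ V] (N : ℕ) (κ c : ℂ) (s : ℂ[X])
    (D : V → V) (v : V) : V :=
  ∑ i ∈ Finset.range (N + 1), ((s.comp (X + C c)).coeff i * κ ^ (N - i)) • D^[i] v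

theorem scaledEval_eq {V : Type*} [AddCommGroup V] [Module ℂ V] (N : ℕ) (κ c : ℂ) (s : ℂ[X])
    (hs : s.natDegree ≤ N) (hκ : κ ≠ 0) (D : Module.End ℂ V) (v : V) :
    scaledEval N κ c s D v =
      (κ ^ N • aeval (κ⁻¹ • D + c • (1 : Module.End ℂ V)) s) v := by
  have h1 : aeval (κ⁻¹ • D + c • (1 : Module.End ℂ V)) s =
      aeval (κ⁻¹ • D) (s.comp (X + C c)) := by
    rw [aeval_comp]
    simp [Algebra.algebraMap_eq_smul_one]
  have h2 : (s.comp (X + C c)).natDegree < N + 1 := by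
    rw [natDegree_comp, natDegree_X_add_C]
    omega
  rw [h1, aeval_eq_sum_range' h2, scaledEval, LinearMap.smul_apply, LinearMap.sum_apply,
    Finset.smul_sum]
  refine Finset.sum_congr rfl fun i hi => ?_
  have hi' : i ≤ N := by simpa [Nat.lt_succ_iff] using hi
  rw [_root_.smul_pow, LinearMap.smul_apply, LinearMap.smul_apply, Module.End.pow_apply, smul_smul,
    smul_smul]
  congr 1
  rw [pow_sub₀ _ hκ hi', inv_pow]
  ring

end Polynomials

section SolutionOperators

variable {n : ℕ} {M : Type*} [TopologicalSpace M] [ChartedSpace (EuclideanSpace ℝ (Fin n)) M]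
  [IsManifold (𝓡 n) ∞ M]

/-- `T^(-)_m(λ) = [(λ-β) ∏_{k=1}^{m-1} a_{2k}]⁻¹ (2J/n)^{m-1} s^(-)_{m-1}(y^(-)) ∘ δ` with
`y^(-) = (n/2J) δd + β/2(β/2+1)`, and `T^(-)_0 = 0`. -/
def TMinus {p : ℕ} (h : RMetric n M) (vol : DForm (𝓡 n) M ℝ n) (J : ℝ) (lam : ℂ) :
    ℕ → DForm (𝓡 n) M ℂ p → LowForm (𝓡 n) M p
  | 0, _ => 0
  | m + 1, φ =>
    let β : ℂ := n - 2 * p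
    ((lam - β) * ∏ k ∈ Finset.Icc 1 m, coeffa β lam (2 * k))⁻¹ •
      scaledEval m (2 * J / n) (β / 2 * (β / 2 + 1)) (sMinus β lam m)
        (fun η => codiff h.toFun vol (extDLow η)) (codiff h.toFun vol φ)

/-- `T^(+)_m(λ) = [(λ-β) ∏_{k=1}^m a_{2k}]⁻¹ (2J/n)^m [(λ-β) s^(+)_m(y^(+)) + s^(1)_m(y^(1))]` with
`y^(+) = (n/2J) δd + β/2(β/2-1)` and `y^(1) = (n/2J) dδ + β/2(β/2+1)`. -/
def TPlus {p : ℕ} (h : RMetric n M) (vol : DForm (𝓡 n) M ℝ n) (J : ℝ) (lam : ℂ) (m : ℕ)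
    (φ : DForm (𝓡 n) M ℂ p) : DForm (𝓡 n) M ℂ p :=
  let β : ℂ := n - 2 * p
  ((lam - β) * ∏ k ∈ Finset.Icc 1 m, coeffa β lam (2 * k))⁻¹ •
    ((lam - β) • scaledEval m (2 * J / n) (β / 2 * (β / 2 - 1)) (sPlus β lam m)
        (fun η => codiffSucc h.toFun vol (extD η)) φ +
      scaledEval m (2 * J / n) (β / 2 * (β / 2 + 1)) (s1 β lam m)
        (fun η => extDLow (codiff h.toFun vol η)) φ)

/-- The sequence with `w_{2k} = v_k` and vanishing odd members. -/
def evenSeq {V : Type*} [Zero V] (v : ℕ → V) (j : ℕ) : V := if Even j then v (j / 2) else 0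

end SolutionOperators

end PoincareEinstein

end

noncomputable section

namespace PoincareEinstein

/-! ### The polynomials -/

/-! The proof has an analytic half, which turns the eigenequation into the recurrence (2), and an
algebraic half, which solves (2) using nothing about `d` and `δ` beyond linearity, `dd = 0` and `δδ
= 0`.

Analytic half. The Hodge star of the warped product `g₊` is computed on `π^*α` and `dr ∧ π^*γ` in
terms of the star of `h` (`starPlus_pull`, `starPlus_drPull`). With the product rule for `d` this
gives explicit Laplacians of `f(r) π^*α` and `f(r) dr ∧ π^*γ` (`hasLaplacian_pull`,
`hasLaplacian_drWedge`). For powers of `r`, the error of a partial sum, evaluated on vectors `v + s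
r∂_r`, is `r^λ (1 - cr²)⁻³ ((1 - cr²) Q₊(r) + Q₋(r))`, where the coefficients of degree at most `K`
of the polynomials `Q₊`, `Q₋` are the residues of the two relations in (2). Such a function is
`o(r^(λ+K))` exactly if the polynomial factor has no coefficient of degree at most `K`
(`expansionFun_isLittleO_iff`), which gives `isAsymptoticSolution_iff`.

Algebraic half. The coefficients have the form `ω^(-)_{2k} = P_k(δd) δφ` and `ω^(+)_{2k} = S_k(δd) φ
+ (Q_k(dδ) - Q_k(0)) φ`, where `Q_k = (λ+2k-β) P_{k+1} - 2c(λ+2k) P_k + c²(λ+2k+β) P_{k-1}`; these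
are `pMinus`, `pPlus` and `pMixed`. The choice of `Q_k` expresses, order by order in `r`, that `ω`
is coclosed for `g₊`. Because mixed products of `δd` and `dδ` vanish, (2) reduces to the polynomial
identities `pMinus_full_rec`, `pPlus_rec`, `pMixed_rec` and to `Q_k(0) = S_k(0)`
(`eval_zero_pMixed`). The first and the third identity are linear combinations of shifts of one
three-term recurrence for `P_k` (`pMinus_rec`). The three-term recurrences for `P_k` and `S_k` are
instances of `sHyp_rec`, proved by comparing coefficients in the basis `R_k(y; 0)`. Finally `Q_k -
Q_k(0)` is the normalised `s^(1)_k` (`homog_s1_eq`): `R^(1)_k` is `R_k(y; 0)` minus its value at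
`β/2(β/2+1)`, and the numbers `D^(1)_k(m)` are the coefficients of the combination defining `Q_m`.

Resonances. The assumption on `λ` means `a_{2k} = 4k(λ - β/2 + k) ≠ 0` for `1 ≤ k ≤ m`. By contrast
`A_{2k} = a_{2k-2} + 2(λ+2k-2-β)` can still vanish. Hence existence is proved by verifying the
closed formulas rather than by solving for `ω^(-)_{2k}`, and uniqueness, an induction on `k`, needs
the `A_{2i}` to be nonzero unless `p = 0`. -/

lemma poch_zero (a : ℂ) : poch a 0 = 1 := by simp [poch]

lemma poch_succ_left (a : ℂ) (k : ℕ) : poch a (k + 1) = a * poch (a + 1) k := by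
  simp [poch, ascPochhammer_succ_left]

lemma poch_succ_right (a : ℂ) (k : ℕ) : poch a (k + 1) = poch a k * (a + k) := by
  simp [poch, ascPochhammer_succ_right]

/-- Reversing the order of the factors changes every sign. It converts the Pochhammer symbols of
`s^(-)` into those of `D^(1)`. -/
lemma poch_neg (a : ℂ) (k : ℕ) : poch (-a - k) k = (-1) ^ k * poch (a + 1) k := by
  induction k generalizing a with
  | zero => simp [poch_zero]
  | succ k ih =>
    rw [poch_succ_left, poch_succ_left, pow_succ]
    have h1 : -a - ((k + 1 : ℕ) : ℂ) + 1 = -a - k := by push_cast; ring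
    have h2 := poch_succ_left (a + 1) k
    have h3 := poch_succ_right (a + 1) k
    rw [h1, ih]
    rw [h2] at h3
    push_cast
    linear_combination (-1) ^ k * h3

lemma polyR_zero (α : ℂ) : polyR 0 α = 1 := by simp [polyR]

lemma polyR_succ (k : ℕ) (α : ℂ) :
    polyR (k + 1) α = polyR k α * (X - C ((α - (k + 1)) * (α - k))) := by
  rw [polyR, Finset.prod_Icc_succ_top (by omega), ← polyR]
  push_cast
  congr 4
  ring

/-- Multiplication by `X` is bidiagonal in the basis `R_k(y; 0)`, so that a three-term recurrence
for `s^(±)` becomes a recurrence for coefficients. -/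
lemma X_mul_polyR (k : ℕ) : X * polyR k 0 = polyR (k + 1) 0 + C ((k : ℂ) * (k + 1)) * polyR k 0 := by
  rw [polyR_succ]
  have : ((0 : ℂ) - (k + 1)) * (0 - k) = k * (k + 1) := by ring
  rw [this]
  ring

/-- The coefficients of `s^(±)_m` in the basis `R_k(y; 0)`. -/
def hypCoeff (u v : ℂ) (m k : ℕ) : ℂ := m.choose k * poch (u - m) (m - k) * poch (v - m) (m - k)

/-- The common form of the polynomials `s^(±)_m`. -/
def sHyp (u v : ℂ) (m : ℕ) : ℂ[X] :=
  ∑ k ∈ Finset.range (m + 1), C (hypCoeff u v m k) * polyR k 0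

lemma sMinus_eq (β lam : ℂ) (m : ℕ) : sMinus β lam m = sHyp (β / 2 - lam) (-β / 2 - 1) m := by
  unfold sMinus sHyp hypCoeff
  refine Finset.sum_congr rfl fun k _ => ?_
  rw [show -β / 2 - 1 - m = -β / 2 - m - 1 by ring]

lemma sPlus_eq (β lam : ℂ) (m : ℕ) : sPlus β lam m = sHyp (β / 2 - lam) (-β / 2 + 1) m := by
  unfold sPlus sHyp hypCoeff
  refine Finset.sum_congr rfl fun k _ => ?_
  rw [show -β / 2 + 1 - m = -β / 2 - m + 1 by ring]

lemma hypCoeff_of_lt (u v : ℂ) {m k : ℕ} (h : m < k) : hypCoeff u v m k = 0 := by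
  simp [hypCoeff, Nat.choose_eq_zero_of_lt h]

lemma hypCoeff_self (u v : ℂ) (m : ℕ) : hypCoeff u v m m = 1 := by
  simp [hypCoeff, poch_zero]

lemma hypCoeff_pred (u v : ℂ) (m : ℕ) :
    hypCoeff u v (m + 1) m = (m + 1) * (u - m - 1) * (v - m - 1) := by
  simp only [hypCoeff, Nat.choose_succ_self_right, Nat.add_sub_cancel_left]
  rw [poch_succ_left, poch_succ_left, poch_zero, poch_zero]
  push_cast
  ring

lemma sHyp_eq_sum (u v : ℂ) {m N : ℕ} (h : m < N) :
    sHyp u v m = ∑ k ∈ Finset.range N, C (hypCoeff u v m k) * polyR k 0 := by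
  refine Finset.sum_subset (by simpa using h) fun k _ hk => ?_
  rw [hypCoeff_of_lt u v (by simpa using hk)]
  simp

/-- The diagonal coefficient of the three-term recurrence for `s^(±)_m`. -/
def hypRho (u v m : ℂ) : ℂ :=
  m * (u - m) * (v - m) - (m - 1) * (u - m + 1) * (v - m + 1) - m * (m - 1)

/-- The subdiagonal coefficient of the three-term recurrence for `s^(±)_m`. -/
def hypSigma (u v m : ℂ) : ℂ := (m - 1) * (m - 1 - u) * (m - 1 - v) * (m - 1 - u - v)

lemma choose_cast_rec (K d : ℕ) :
    ((K + d + 1).choose K : ℂ) * (d + 1) = (K + d + 1) * (K + d).choose K := by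
  have h := Nat.choose_mul_succ_eq (K + d) K
  rw [show K + d + 1 - K = d + 1 by omega] at h
  have h' : (((K + d).choose K * (K + d + 1) : ℕ) : ℂ) = ((K + d + 1).choose K * (d + 1) : ℕ) := by
    rw [h]
  push_cast at h'
  linear_combination -h'

/-- After splitting off Pochhammer symbols of common length `d` and reducing the binomials to one,
this is a rational identity in `u`, `v`, `K`, `d`. The difference of binomials stands for
`(K+d+1).choose (K-1)` and vanishes for `K = 0`, so one identity serves the constant coefficient and
the others. -/
lemma hypCoeff_rec_generic (u v : ℂ) (K d : ℕ) :
    hypCoeff u v (K + d + 2) K =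
      (((K + d + 2).choose K : ℂ) - (K + d + 1).choose K) * poch (u - (K + d + 1 : ℕ)) (d + 2) *
          poch (v - (K + d + 1 : ℕ)) (d + 2) +
        (K * (K + 1) + hypRho u v (K + d + 2)) * hypCoeff u v (K + d + 1) K -
        hypSigma u v (K + d + 2) * hypCoeff u v (K + d) K := by
  have e1 : K + d + 2 - K = d + 2 := by omega
  have e2 : K + d + 1 - K = d + 1 := by omega
  have e3 : K + d - K = d := by omega
  simp only [hypCoeff, e1, e2, e3]
  have hp : ∀ w : ℂ, poch (w - (K + d + 2 : ℕ)) (d + 2) =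
      (w - K - d - 2) * (w - K - d - 1) * poch (w - (K + d : ℕ)) d := by
    intro w
    rw [poch_succ_left, poch_succ_left]
    push_cast
    rw [show w - (K + d + 2 : ℂ) + 1 + 1 = w - (K + d) by ring]
    ring
  have hp1 : ∀ w : ℂ, poch (w - (K + d + 1 : ℕ)) (d + 1) =
      (w - K - d - 1) * poch (w - (K + d : ℕ)) d := by
    intro w
    rw [poch_succ_left]
    push_cast
    rw [show w - (K + d + 1 : ℂ) + 1 = w - (K + d) by ring]
    ring
  have hp2 : ∀ w : ℂ, poch (w - (K + d + 1 : ℕ)) (d + 2) =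
      (w - K - d - 1) * poch (w - (K + d : ℕ)) d * (w - K) := by
    intro w
    rw [poch_succ_right, hp1]
    push_cast
    ring
  rw [hp, hp, hp1, hp1, hp2, hp2]
  generalize poch (u - (K + d : ℕ)) d = P
  generalize poch (v - (K + d : ℕ)) d = Q
  have c1 := choose_cast_rec K d
  have c2 := choose_cast_rec K (d + 1)
  rw [show K + (d + 1) + 1 = K + d + 2 by ring, show K + (d + 1) = K + d + 1 by ring] at c2
  push_cast at c2
  have d1 : (d : ℂ) + 1 ≠ 0 := by exact_mod_cast Nat.succ_ne_zero d
  have d2 : (d : ℂ) + 1 + 1 ≠ 0 := by exact_mod_cast Nat.succ_ne_zero (d + 1)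
  rw [← eq_div_iff d1] at c1
  rw [← eq_div_iff d2, c1] at c2
  rw [c2, c1]
  unfold hypRho hypSigma
  field_simp
  ring

lemma hypCoeff_zero_rec (u v : ℂ) (m : ℕ) :
    hypCoeff u v (m + 2) 0 = hypRho u v (m + 2) * hypCoeff u v (m + 1) 0 -
      hypSigma u v (m + 2) * hypCoeff u v m 0 := by
  have := hypCoeff_rec_generic u v 0 m
  simpa using this

lemma hypCoeff_succ_rec (u v : ℂ) (m k : ℕ) (hk : k ≤ m + 1) :
    hypCoeff u v (m + 2) (k + 1) = hypCoeff u v (m + 1) k +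
      ((k + 1) * (k + 2) + hypRho u v (m + 2)) * hypCoeff u v (m + 1) (k + 1) -
      hypSigma u v (m + 2) * hypCoeff u v m (k + 1) := by
  rcases Nat.lt_or_ge k m with h | h
  · obtain ⟨d, rfl⟩ := Nat.exists_eq_add_of_lt h
    have := hypCoeff_rec_generic u v (k + 1) d
    rw [show k + 1 + d = k + d + 1 by ring] at this
    rw [this]
    have hc : ((k + d + 1 + 2).choose (k + 1) : ℂ) =
        (k + d + 1 + 1).choose k + (k + d + 1 + 1).choose (k + 1) := by
      rw [show k + d + 1 + 2 = (k + d + 1 + 1) + 1 by ring, Nat.choose_succ_succ]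
      push_cast; ring
    rw [hc]
    conv_rhs => enter [1, 1]; unfold hypCoeff
    rw [show k + d + 1 + 1 - k = d + 2 by omega]
    push_cast
    ring_nf
  -- The two highest coefficients lie outside the range of the generic identity; there the last term
  -- vanishes.
  · rcases Nat.eq_or_lt_of_le h with rfl | h
    · rw [show m + 2 = (m + 1) + 1 by ring, hypCoeff_pred, hypCoeff_pred, hypCoeff_self,
        hypCoeff_of_lt _ _ (Nat.lt_succ_self m)]
      unfold hypRho
      push_cast
      ring
    · obtain rfl : k = m + 1 := by omega
      rw [hypCoeff_self, hypCoeff_self, hypCoeff_of_lt _ _ (Nat.lt_succ_self _),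
        hypCoeff_of_lt _ _ (by omega)]
      ring

/-- The three-term recurrence for `s^(±)_m`. -/
lemma sHyp_rec (u v : ℂ) (m : ℕ) :
    sHyp u v (m + 2) = (X + C (hypRho u v (m + 2))) * sHyp u v (m + 1) -
      C (hypSigma u v (m + 2)) * sHyp u v m := by
  have h1 : X * sHyp u v (m + 1) = ∑ k ∈ Finset.range (m + 2),
      C (hypCoeff u v (m + 1) k) * polyR (k + 1) 0 + ∑ k ∈ Finset.range (m + 3),
      C (hypCoeff u v (m + 1) k * (k * (k + 1))) * polyR k 0 := by
    -- The term `k = m + 2` of the second sum is zero; it is included to give all sums of the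
    -- recurrence a common range.
    rw [Finset.sum_range_succ _ (m + 2), hypCoeff_of_lt _ _ (Nat.lt_succ_self _), zero_mul, C_0,
      zero_mul, add_zero, ← Finset.sum_add_distrib, sHyp, Finset.mul_sum]
    refine Finset.sum_congr rfl fun k _ => ?_
    rw [mul_left_comm, X_mul_polyR]
    simp only [C_mul]
    ring
  rw [add_mul, h1, sHyp_eq_sum u v (show m + 2 < m + 3 by omega),
    sHyp_eq_sum u v (show m + 1 < m + 3 by omega), sHyp_eq_sum u v (show m < m + 3 by omega)]
  rw [Finset.mul_sum, Finset.mul_sum]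
  simp only [Finset.sum_range_succ' _ (m + 2)]
  rw [hypCoeff_zero_rec]
  have h2 : ∑ k ∈ Finset.range (m + 2), C (hypCoeff u v (m + 2) (k + 1)) * polyR (k + 1) 0 =
      ∑ k ∈ Finset.range (m + 2), C (hypCoeff u v (m + 1) k) * polyR (k + 1) 0 +
      ∑ k ∈ Finset.range (m + 2), C (hypCoeff u v (m + 1) (k + 1) * (((k + 1 : ℕ) : ℂ) *
        ((k + 1 : ℕ) + 1))) * polyR (k + 1) 0 +
      ∑ k ∈ Finset.range (m + 2), C (hypRho u v (m + 2)) *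
        (C (hypCoeff u v (m + 1) (k + 1)) * polyR (k + 1) 0) -
      ∑ k ∈ Finset.range (m + 2), C (hypSigma u v (m + 2)) *
        (C (hypCoeff u v m (k + 1)) * polyR (k + 1) 0) := by
    rw [← Finset.sum_add_distrib, ← Finset.sum_add_distrib, ← Finset.sum_sub_distrib]
    refine Finset.sum_congr rfl fun k hk => ?_
    rw [hypCoeff_succ_rec u v m k (by have := Finset.mem_range.1 hk; omega)]
    simp only [C_mul, C_add, C_sub]
    push_cast
    simp only [C_add, C_1, C_ofNat]
    ring
  rw [h2]
  simp only [C_mul, C_sub, Nat.cast_zero, C_0]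
  ring

lemma sHyp_zero (u v : ℂ) : sHyp u v 0 = 1 := by
  simp [sHyp, hypCoeff, poch_zero, polyR_zero]

lemma sHyp_one (u v : ℂ) : sHyp u v 1 = X + C (hypRho u v 1) := by
  rw [sHyp, Finset.sum_range_succ, Finset.sum_range_one, hypCoeff_self, hypCoeff_pred, polyR_zero,
    polyR_succ, polyR_zero, hypRho]
  simp
  ring

/-! ### The polynomials `R^(1)_k` and `s^(1)_m` in terms of `R_k(y; 0)` and `s^(-)_m`. -/

lemma polyR_succ_left (j : ℕ) (α : ℂ) :
    polyR (j + 1) (α + 1) = (X - C (α * (α + 1))) * polyR j α := by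
  induction j with
  | zero =>
    rw [polyR_succ, polyR_zero, polyR_zero]
    simp
  | succ j ih =>
    rw [polyR_succ, ih, polyR_succ]
    push_cast
    rw [mul_assoc]
    congr 4
    ring

/-- At `y = B(B+1)` the factor of index `l` is `(B+l)(B-l+1)`, so that the Pochhammer symbol grows
by one factor at each end. -/
lemma eval_polyR_zero (B : ℂ) (k : ℕ) :
    (polyR k 0).eval (B * (B + 1)) = poch (B - k + 1) (2 * k) := by
  induction k with
  | zero => simp [polyR_zero, poch_zero]
  | succ k ih =>
    rw [polyR_succ, eval_mul, ih, show 2 * (k + 1) = (2 * k + 1) + 1 by ring, poch_succ_left,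
      poch_succ_right]
    push_cast
    rw [show B - (k + 1 : ℂ) + 1 + 1 = B - k + 1 by ring]
    simp
    ring

/-- The polynomials `R^(1)_k` are differences of values of `R_k`. -/
lemma polyR1_eq (β : ℂ) (k : ℕ) :
    polyR1 β k = polyR k 0 - C ((polyR k 0).eval (β / 2 * (β / 2 + 1))) := by
  induction k with
  | zero => simp [polyR1, polyR_zero]
  | succ k ih =>
    -- The summand `j = 1` is split off. In each remaining one `R_{j-1}(y; k+1)` contains the factor
    -- `y - k(k+1)`, and dividing it out leaves the sum for `k`. The claimed closed form obeys the
    -- same recursion because `R_{k+1}(y; 0) = (y - k(k+1)) R_k(y; 0)`.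
    have h : polyR1 β (k + 1) = C (poch (β / 2 - k + 1) (2 * k)) * (X - C (β / 2 * (β / 2 + 1))) +
        (X - C ((k : ℂ) * (k + 1))) * polyR1 β k := by
      have hI : Finset.Icc 1 (k + 1) = Finset.cons 1 (Finset.Icc 2 (k + 1)) (by simp) := by
        ext; simp; omega
      rw [polyR1, hI, Finset.sum_cons]
      congr 1
      · rw [show 1 - 1 = 0 from rfl, polyR_zero, mul_one, Nat.add_sub_cancel]
        congr 4
        push_cast; ring
      · rw [polyR1, Finset.mul_sum, show Finset.Icc 2 (k + 1) =
          (Finset.Icc 1 k).map (addRightEmbedding 1) by simp, Finset.sum_map]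
        refine Finset.sum_congr rfl fun j hj => ?_
        obtain ⟨i, rfl⟩ := Nat.exists_eq_add_of_le' (Finset.mem_Icc.1 hj).1
        simp only [addRightEmbedding_apply, Nat.add_sub_cancel, Nat.add_sub_add_right]
        rw [Nat.cast_succ k, polyR_succ_left]
        push_cast
        rw [show β / 2 - (k + 1 : ℂ) + (i + 1 + 1) + 1 = β / 2 - k + (i + 1) + 1 by ring]
        ring
    rw [h, ih, polyR_succ, eval_mul, eval_polyR_zero]
    simp only [eval_sub, eval_X, eval_C]
    simp only [C_mul, C_sub, C_0, C_add, C_1]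
    ring

/-- The combination of the polynomials `s^(-)` which is equal to
`(λ-β) s^(+)_m(β/2(β/2-1)) + s^(1)_m`. -/
def sComb (β lam : ℂ) : ℕ → ℂ[X]
  | 0 => C (lam - β)
  | 1 => C (lam + 2 - β) * sMinus β lam 1 - C (2 * (lam + 2) * (lam - β / 2 + 1))
  | m + 2 => C (lam + 2 * (m + 2) - β) * sMinus β lam (m + 2) -
      C (2 * (lam + 2 * (m + 2)) * (m + 2) * (lam - β / 2 + (m + 2))) * sMinus β lam (m + 1) +
      C ((lam + 2 * (m + 2) + β) * (m + 2) * (m + 1) * (lam - β / 2 + (m + 2)) *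
        (lam - β / 2 + (m + 1))) * sMinus β lam m

lemma hypCoeff_minus (β lam : ℂ) (K d : ℕ) :
    hypCoeff (β / 2 - lam) (-β / 2 - 1) (K + d) K =
      (K + d).choose K * poch (lam - β / 2 + K + 1) d * poch (β / 2 + K + 2) d := by
  rw [hypCoeff, Nat.add_sub_cancel_left]
  have h1 := poch_neg (lam - β / 2 + K) d
  have h2 := poch_neg (β / 2 + 1 + K) d
  push_cast
  rw [show β / 2 - lam - (K + d : ℂ) = -(lam - β / 2 + K) - d by ring, h1,
    show -β / 2 - 1 - (K + d : ℂ) = -(β / 2 + 1 + K) - d by ring, h2,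
    show β / 2 + 1 + K + 1 = β / 2 + K + 2 by ring]
  have : ((-1 : ℂ) ^ d) * (-1) ^ d = 1 := by rw [← mul_pow]; simp
  linear_combination (((K + d).choose K : ℂ) * poch (lam - β / 2 + K + 1) d *
    poch (β / 2 + K + 2) d) * this

/-- This identifies `D^(1)_k` with the coefficients of `sComb` in the basis `R_k(y; 0)`. For `k ≤ m`
all terms are multiples of one product of Pochhammer symbols; the two top coefficients are checked
directly. -/
lemma coeffD1_eq (β lam : ℂ) (m k : ℕ) (hk : k ≤ m + 2) :
    coeffD1 β lam (m + 2) k =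
      (lam + 2 * (m + 2) - β) * hypCoeff (β / 2 - lam) (-β / 2 - 1) (m + 2) k -
      2 * (lam + 2 * (m + 2)) * (m + 2) * (lam - β / 2 + (m + 2)) *
        hypCoeff (β / 2 - lam) (-β / 2 - 1) (m + 1) k +
      (lam + 2 * (m + 2) + β) * (m + 2) * (m + 1) * (lam - β / 2 + (m + 2)) *
        (lam - β / 2 + (m + 1)) * hypCoeff (β / 2 - lam) (-β / 2 - 1) m k := by
  rcases Nat.lt_or_ge m k with h | h
  · rcases Nat.eq_or_lt_of_le h with rfl | h
    · rw [hypCoeff_pred, hypCoeff_self, hypCoeff_of_lt _ _ h, coeffD1, if_neg (by omega),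
        show m + 2 - m.succ = 1 by omega, poch_succ_left, poch_zero, poch_zero,
        show m + 2 = m.succ + 1 from rfl, Nat.choose_succ_self_right]
      push_cast
      ring
    · obtain rfl : k = m + 2 := by omega
      rw [hypCoeff_self, hypCoeff_of_lt _ _ (by omega), hypCoeff_of_lt _ _ (by omega), coeffD1,
        if_pos rfl]
      push_cast
      ring
  · obtain ⟨d, rfl⟩ := Nat.exists_eq_add_of_le h
    rw [coeffD1, if_neg (by omega), hypCoeff_minus, show k + d + 1 = k + (d + 1) by ring,
      show k + d + 2 = k + (d + 2) by ring, hypCoeff_minus, hypCoeff_minus, Nat.add_sub_cancel_left,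
      show d + 2 - 1 = d + 1 by omega]
    have c1 := choose_cast_rec k d
    have c2 := choose_cast_rec k (d + 1)
    rw [show k + (d + 1) + 1 = k + (d + 2) by ring] at c2
    rw [show k + d + 1 = k + (d + 1) by ring] at c1
    push_cast at c2
    rw [poch_succ_left (β / 2 + k + 1), poch_succ_right (lam - β / 2 + k + 1) (d + 1),
      poch_succ_right (lam - β / 2 + k + 1) d, poch_succ_right (β / 2 + k + 2) (d + 1),
      poch_succ_right (β / 2 + k + 2) d, show β / 2 + k + 1 + 1 = β / 2 + k + 2 by ring]
    generalize poch (lam - β / 2 + k + 1) d = P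
    generalize poch (β / 2 + k + 2) d = Q
    have d1 : (d : ℂ) + 1 ≠ 0 := by exact_mod_cast Nat.succ_ne_zero d
    have d2 : (d : ℂ) + 1 + 1 ≠ 0 := by exact_mod_cast Nat.succ_ne_zero (d + 1)
    rw [← eq_div_iff d1] at c1
    rw [← eq_div_iff d2, c1] at c2
    rw [c2, c1]
    push_cast
    field_simp
    ring

/-- Subtracting from each `R_k(y; 0)` its value at `β/2(β/2+1)` subtracts from a combination of them
its own value there. In the variable `dδ` this point corresponds to `0`. -/
lemma s1_eq_sComb (β lam : ℂ) (m : ℕ) :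
    s1 β lam m = sComb β lam m - C ((sComb β lam m).eval (β / 2 * (β / 2 + 1))) := by
  match m with
  | 0 => simp [s1, sComb, polyR1]
  | 1 =>
    rw [s1, Finset.sum_range_succ, Finset.sum_range_one, polyR1_eq, polyR1_eq, sComb, sMinus_eq,
      sHyp_one, polyR_succ, polyR_zero, coeffD1, if_neg (by omega), coeffD1, if_pos rfl]
    simp only [eval_sub, eval_mul, eval_add, eval_X, eval_C, C_mul, C_sub, C_add, C_1, eval_one,
      Nat.cast_one, Nat.cast_zero, mul_one, C_0]
    ring
  | m + 2 =>
    have h : sComb β lam (m + 2) = ∑ k ∈ Finset.range (m + 2 + 1),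
        C (coeffD1 β lam (m + 2) k) * polyR k 0 := by
      rw [sComb, sMinus_eq, sMinus_eq, sMinus_eq,
        sHyp_eq_sum _ _ (show m + 2 < m + 2 + 1 by omega),
        sHyp_eq_sum _ _ (show m + 1 < m + 2 + 1 by omega),
        sHyp_eq_sum _ _ (show m < m + 2 + 1 by omega), Finset.mul_sum, Finset.mul_sum,
        Finset.mul_sum, ← Finset.sum_sub_distrib, ← Finset.sum_add_distrib]
      refine Finset.sum_congr rfl fun k hk => ?_
      rw [coeffD1_eq β lam m k (by have := Finset.mem_range.1 hk; omega)]
      simp only [C_add, C_sub, C_mul]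
      ring
    rw [h, s1, eval_finsetSum]
    simp only [polyR1_eq, mul_sub, Finset.sum_sub_distrib, eval_mul, eval_C, map_sum, C_mul]

/-! ### Homogenisation and the solution polynomials -/

/-- The homogenisation `κ^N s(X/κ)` of a polynomial of degree at most `N`. -/
def homog (N : ℕ) (κ : ℂ) (s : ℂ[X]) : ℂ[X] :=
  ∑ i ∈ Finset.range (N + 1), C (s.coeff i * κ ^ (N - i)) * X ^ i

/-- The scaled expansion is an ordinary polynomial evaluated at `D`, also when `κ = 0`; all later
identities can therefore be proved between polynomials without separating the case `J = 0`. -/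
lemma scaledEval_eq_aeval {V : Type*} [AddCommGroup V] [Module ℂ V] (N : ℕ) (κ c : ℂ) (s : ℂ[X])
    (D : Module.End ℂ V) (v : V) :
    scaledEval N κ c s D v = aeval D (homog N κ (s.comp (X + C c))) v := by
  simp only [scaledEval, homog, map_sum, LinearMap.sum_apply]
  refine Finset.sum_congr rfl fun i _ => ?_
  rw [map_mul, aeval_C, map_pow, aeval_X, Module.End.mul_apply, Module.algebraMap_end_apply,
    Module.End.pow_apply]

lemma homog_add (N : ℕ) (κ : ℂ) (s t : ℂ[X]) : homog N κ (s + t) = homog N κ s + homog N κ t := by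
  simp only [homog, coeff_add, ← Finset.sum_add_distrib]
  exact Finset.sum_congr rfl fun i _ => by rw [add_mul, C_add, add_mul]

lemma homog_C_mul (N : ℕ) (κ a : ℂ) (s : ℂ[X]) : homog N κ (C a * s) = C a * homog N κ s := by
  simp only [homog, coeff_C_mul, Finset.mul_sum]
  exact Finset.sum_congr rfl fun i _ => by rw [mul_assoc, C_mul, mul_assoc]

lemma homog_sub (N : ℕ) (κ : ℂ) (s t : ℂ[X]) : homog N κ (s - t) = homog N κ s - homog N κ t := by
  rw [sub_eq_add_neg, homog_add, ← neg_one_mul t, ← C_1, ← C_neg, homog_C_mul, C_neg, C_1]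
  ring

lemma homog_X_mul (N : ℕ) (κ : ℂ) (s : ℂ[X]) : homog (N + 1) κ (X * s) = X * homog N κ s := by
  rw [homog, Finset.sum_range_succ', homog, Finset.mul_sum]
  simp only [coeff_X_mul, coeff_X_mul_zero, zero_mul, C_0, add_zero, Nat.add_sub_add_right]
  exact Finset.sum_congr rfl fun i _ => by rw [pow_succ]; ring

/-- Homogenising to a degree one higher than needed costs a factor `κ`; this is the source of the
powers of `c` in the recurrences. -/
lemma homog_succ (N : ℕ) (κ : ℂ) (s : ℂ[X]) (hs : s.natDegree ≤ N) :
    homog (N + 1) κ s = C κ * homog N κ s := by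
  rw [homog, Finset.sum_range_succ, coeff_eq_zero_of_natDegree_lt (by omega), zero_mul, C_0,
    zero_mul, add_zero, homog, Finset.mul_sum]
  refine Finset.sum_congr rfl fun i hi => ?_
  rw [Nat.succ_sub (by have := Finset.mem_range.1 hi; omega), pow_succ, C_mul, C_mul, C_mul]
  ring

lemma homog_C (N : ℕ) (κ a : ℂ) : homog N κ (C a) = C (a * κ ^ N) := by
  rw [homog, Finset.sum_range_succ']
  simp [coeff_C]

lemma eval_zero_homog (N : ℕ) (κ : ℂ) (s : ℂ[X]) : (homog N κ s).eval 0 = s.eval 0 * κ ^ N := by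
  rw [homog, Finset.sum_range_succ', eval_add, eval_finsetSum]
  simp [coeff_zero_eq_eval_zero]

lemma natDegree_sHyp_le (u v : ℂ) (m : ℕ) : (sHyp u v m).natDegree ≤ m :=
  natDegree_sum_le_of_forall_le _ _ fun k hk => (natDegree_C_mul_le _ _).trans
    ((natDegree_polyR_le k 0).trans (Nat.lt_succ_iff.1 (Finset.mem_range.1 hk)))

lemma natDegree_comp_X_add_C_le {s : ℂ[X]} {m : ℕ} (hs : s.natDegree ≤ m) (e : ℂ) :
    (s.comp (X + C e)).natDegree ≤ m := by
  rw [natDegree_comp, natDegree_X_add_C]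
  omega

/-- The homogenised and shifted polynomials `s^(±)_m`. -/
def hHyp (u v e κ : ℂ) (m : ℕ) : ℂ[X] := homog m κ ((sHyp u v m).comp (X + C e))

lemma hHyp_zero (u v e κ : ℂ) : hHyp u v e κ 0 = 1 := by
  rw [hHyp, sHyp_zero, one_comp, ← C_1, homog_C]
  simp

lemma homog_linear_mul (N : ℕ) (κ a : ℂ) (s : ℂ[X]) (hs : s.natDegree ≤ N) :
    homog (N + 1) κ ((X + C a) * s) = (X + C (κ * a)) * homog N κ s := by
  rw [add_mul, homog_add, homog_X_mul, homog_C_mul, homog_succ _ _ _ hs, C_mul]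
  ring

lemma hHyp_one (u v e κ : ℂ) : hHyp u v e κ 1 = X + C (κ * (e + hypRho u v 1)) := by
  have : (sHyp u v 1).comp (X + C e) = (X + C (e + hypRho u v 1)) * C 1 := by
    rw [sHyp_one]; simp; ring
  rw [hHyp, this, homog_linear_mul _ _ _ _ (by simp), homog_C]
  simp

lemma hHyp_rec (u v e κ : ℂ) (m : ℕ) :
    hHyp u v e κ (m + 2) = (X + C (κ * (e + hypRho u v (m + 2)))) * hHyp u v e κ (m + 1) -
      C (κ ^ 2 * hypSigma u v (m + 2)) * hHyp u v e κ m := by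
  have : (sHyp u v (m + 2)).comp (X + C e) =
      (X + C (e + hypRho u v (m + 2))) * (sHyp u v (m + 1)).comp (X + C e) -
        C (hypSigma u v (m + 2)) * (sHyp u v m).comp (X + C e) := by
    rw [sHyp_rec, sub_comp, mul_comp, mul_comp, add_comp, X_comp, C_comp, C_comp, C_add]
    ring
  have hd := natDegree_comp_X_add_C_le (natDegree_sHyp_le u v m) e
  rw [hHyp, this, homog_sub, homog_linear_mul _ _ _ _
    (natDegree_comp_X_add_C_le (natDegree_sHyp_le u v (m + 1)) e), homog_C_mul,
    homog_succ (m + 1) _ _ (hd.trans (Nat.le_succ m)), homog_succ m _ _ hd, hHyp, hHyp,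
    C_mul (a := κ ^ 2), C_pow]
  ring

lemma prod_coeffa_succ (β lam : ℂ) (m : ℕ) :
    ∏ k ∈ Finset.Icc 1 (m + 1), coeffa β lam (2 * k) =
      (∏ k ∈ Finset.Icc 1 m, coeffa β lam (2 * k)) * coeffa β lam (2 * (m + 1)) := by
  rw [Finset.prod_Icc_succ_top (by omega)]
  push_cast
  rfl

/-- The polynomial in `δd` which gives `ω_{2k}^(-)` in terms of `δφ`; it vanishes for `k ≤ 0`. -/
def pMinus (β lam c : ℂ) : ℤ → ℂ[X]
  | Int.ofNat (m + 1) => C (((lam - β) * ∏ k ∈ Finset.Icc 1 m, coeffa β lam (2 * k))⁻¹) *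
      hHyp (β / 2 - lam) (-β / 2 - 1) (β / 2 * (β / 2 + 1)) (4 * c) m
  | _ => 0

/-- The polynomial in `δd` in `ω_{2k}^(+)`; it vanishes for `k < 0`. -/
def pPlus (β lam c : ℂ) : ℤ → ℂ[X]
  | Int.ofNat m => C ((∏ k ∈ Finset.Icc 1 m, coeffa β lam (2 * k))⁻¹) *
      hHyp (β / 2 - lam) (-β / 2 + 1) (β / 2 * (β / 2 - 1)) (4 * c) m
  | _ => 0

/-- The polynomial in `dδ` in `ω_{2k}^(+)`; it vanishes for `k < 0`. -/
def pMixed (β lam c : ℂ) (i : ℤ) : ℂ[X] :=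
  C (lam + 2 * i - β) * pMinus β lam c (i + 1) - C (2 * c * (lam + 2 * i)) * pMinus β lam c i +
    C (c ^ 2 * (lam + 2 * i + β)) * pMinus β lam c (i - 1)

lemma pMinus_nonpos (β lam c : ℂ) {i : ℤ} (hi : i ≤ 0) : pMinus β lam c i = 0 := by
  match i, hi with
  | Int.ofNat 0, _ => rfl
  | Int.negSucc _, _ => rfl

lemma pPlus_neg (β lam c : ℂ) {i : ℤ} (hi : i < 0) : pPlus β lam c i = 0 := by
  match i, hi with
  | Int.negSucc _, _ => rfl

lemma pMixed_neg (β lam c : ℂ) {i : ℤ} (hi : i < 0) : pMixed β lam c i = 0 := by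
  rw [pMixed, pMinus_nonpos _ _ _ (by omega), pMinus_nonpos _ _ _ (by omega),
    pMinus_nonpos _ _ _ (by omega)]
  simp

lemma pMinus_succ (β lam c : ℂ) (m : ℕ) : pMinus β lam c (m + 1) =
    C (((lam - β) * ∏ k ∈ Finset.Icc 1 m, coeffa β lam (2 * k))⁻¹) *
      hHyp (β / 2 - lam) (-β / 2 - 1) (β / 2 * (β / 2 + 1)) (4 * c) m := rfl

lemma pPlus_nat (β lam c : ℂ) (m : ℕ) : pPlus β lam c m =
    C ((∏ k ∈ Finset.Icc 1 m, coeffa β lam (2 * k))⁻¹) *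
      hHyp (β / 2 - lam) (-β / 2 + 1) (β / 2 * (β / 2 - 1)) (4 * c) m := rfl

/-! ### Recurrences of the solution polynomials when `a_2, …, a_{2m}` do not vanish. -/

section Nonresonant

variable {β lam c : ℂ} {m : ℕ}

lemma prod_coeffa_ne_zero (ha : ∀ i : ℕ, 1 ≤ i → i ≤ m → coeffa β lam (2 * i) ≠ 0)
    {i : ℕ} (hi : i ≤ m) :
    ∏ k ∈ Finset.Icc 1 i, coeffa β lam (2 * k) ≠ 0 :=
  Finset.prod_ne_zero_iff.2 fun k hk =>
    ha k (Finset.mem_Icc.1 hk).1 ((Finset.mem_Icc.1 hk).2.trans hi)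

lemma pMinus_rec (ha : ∀ i : ℕ, 1 ≤ i → i ≤ m → coeffa β lam (2 * i) ≠ 0)
    {i : ℤ} (hi : i ≤ m) :
    C (coeffa β lam (2 * i)) * pMinus β lam c (i + 1) =
      (C (2 * c * ((lam + 2 * i) ^ 2 + lam * (β - lam))) + X) * pMinus β lam c i -
        C (c ^ 2 * (2 * lam + 2 * i) * (2 * i + β)) * pMinus β lam c (i - 1) := by
  rcases lt_trichotomy i 0 with h | rfl | h
  · rw [pMinus_nonpos _ _ _ (by omega), pMinus_nonpos _ _ _ (by omega),
      pMinus_nonpos _ _ _ (by omega)]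
    simp
  -- The first nonzero polynomial `P_1` is multiplied by `a_0 = 0`, so the recurrence needs no
  -- initial term.
  · rw [pMinus_nonpos _ _ _ (le_refl (0 : ℤ)),
      pMinus_nonpos _ _ _ (show (0 : ℤ) - 1 ≤ 0 by omega)]
    simp [coeffa]
  · obtain ⟨k, rfl⟩ : ∃ k : ℕ, i = k + 1 := ⟨(i - 1).toNat, by omega⟩
    have hk : k + 1 ≤ m := by exact_mod_cast hi
    have hak := ha (k + 1) (by omega) hk
    have e1 : pMinus β lam c ((k : ℤ) + 1 + 1) = pMinus β lam c ((k + 1 : ℕ) + 1) := rfl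
    push_cast at hak
    rw [e1, pMinus_succ, pMinus_succ, prod_coeffa_succ, add_sub_cancel_right]
    push_cast
    rw [← mul_assoc, ← C_mul, mul_inv, mul_inv, mul_left_comm _ (lam - β)⁻¹, mul_left_comm _ _
      (coeffa β lam (2 * (k + 1)))⁻¹, mul_inv_cancel₀ hak, mul_one, ← mul_inv]
    -- `hHyp_rec` reaches back two steps; the first instance is read off from `hHyp_one`.
    rcases k with _ | k
    · rw [hHyp_zero, hHyp_one, pMinus_nonpos _ _ _ (by simp)]
      simp only [hypRho]
      rw [mul_zero, sub_zero, mul_one, mul_comm, add_comm X]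
      congr 3
      push_cast
      ring
    · have hp := prod_coeffa_ne_zero ha (show k + 1 ≤ m by omega)
      have hak' := ha (k + 1) (by omega) (by omega)
      have e2 : pMinus β lam c ((k + 1 : ℕ) : ℤ) = pMinus β lam c (k + 1) := rfl
      rw [hHyp_rec, e2, pMinus_succ, prod_coeffa_succ]
      push_cast at hak' ⊢
      -- The normalising constants of `P_{k+1}` and `P_{k+2}` differ by the factor `a_{2(k+1)}`,
      -- which is exactly the factor contained in `hypSigma`.
      have e3 : ((lam - β) * ((∏ k ∈ Finset.Icc 1 k, coeffa β lam (2 * k)))) ⁻¹ =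
        coeffa β lam (2 * (k + 1)) * ((lam - β) * ((∏ k ∈ Finset.Icc 1 k, coeffa β lam (2 * k)) *
          coeffa β lam (2 * (k + 1))))⁻¹ := by
        rw [mul_inv, mul_inv, mul_inv]
        field_simp
      rw [e3]
      generalize ((lam - β) * ((∏ k ∈ Finset.Icc 1 k, coeffa β lam (2 * k)) *
          coeffa β lam (2 * (k + 1))))⁻¹ = p
      rw [show 4 * c * (β / 2 * (β / 2 + 1) + hypRho (β / 2 - lam) (-β / 2 - 1) (k + 2)) =
        2 * c * ((lam + 2 * (k + 1 + 1)) ^ 2 + lam * (β - lam)) by unfold hypRho; ring,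
        show (4 * c) ^ 2 * hypSigma (β / 2 - lam) (-β / 2 - 1) (k + 2) =
          c ^ 2 * (2 * lam + 2 * (k + 1 + 1)) * (2 * (k + 1 + 1) + β) *
            coeffa β lam (2 * (k + 1)) by unfold hypSigma coeffa; ring]
      simp only [C_mul]
      ring

lemma pPlus_rec (ha : ∀ i : ℕ, 1 ≤ i → i ≤ m → coeffa β lam (2 * i) ≠ 0)
    {i : ℤ} (hi : i ≤ m) :
    C (coeffa β lam (2 * i)) * pPlus β lam c i =
      (C (coeffb β lam (2 * i) * c) + X) * pPlus β lam c (i - 1) +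
        C (coeffc β lam (2 * i) * c ^ 2) * pPlus β lam c (i - 2) := by
  rcases lt_trichotomy i 0 with h | rfl | h
  · rw [pPlus_neg _ _ _ (by omega), pPlus_neg _ _ _ (by omega), pPlus_neg _ _ _ (by omega)]
    simp
  · rw [pPlus_neg _ _ _ (show (0 : ℤ) - 1 < 0 by omega),
      pPlus_neg _ _ _ (show (0 : ℤ) - 2 < 0 by omega)]
    simp [coeffa]
  · obtain ⟨k, rfl⟩ : ∃ k : ℕ, i = k + 1 := ⟨(i - 1).toNat, by omega⟩
    have hk : k + 1 ≤ m := by exact_mod_cast hi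
    have hak := ha (k + 1) (by omega) hk
    have e1 : pPlus β lam c ((k : ℤ) + 1) = pPlus β lam c ((k + 1 : ℕ)) := rfl
    push_cast at hak
    rw [e1, pPlus_nat, prod_coeffa_succ, add_sub_cancel_right, pPlus_nat]
    push_cast
    rw [← mul_assoc, ← C_mul, mul_inv, mul_left_comm, mul_inv_cancel₀ hak, mul_one]
    rcases k with _ | k
    · rw [hHyp_zero, hHyp_one, pPlus_neg _ _ _ (by simp)]
      simp only [hypRho]
      rw [mul_zero, add_zero, mul_one, mul_comm, add_comm X]
      congr 3
      push_cast
      unfold coeffb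
      ring
    · have hp := prod_coeffa_ne_zero ha (show k + 1 ≤ m by omega)
      have hak' := ha (k + 1) (by omega) (by omega)
      have e2 : pPlus β lam c (((k + 1 : ℕ) : ℤ) + 1 - 2) = pPlus β lam c k := by
        congr 1; push_cast; ring
      rw [hHyp_rec, e2, pPlus_nat, prod_coeffa_succ]
      push_cast at hak' ⊢
      have e3 : (∏ k ∈ Finset.Icc 1 k, coeffa β lam (2 * k)) ⁻¹ =
        coeffa β lam (2 * (k + 1)) * ((∏ k ∈ Finset.Icc 1 k, coeffa β lam (2 * k)) *
          coeffa β lam (2 * (k + 1)))⁻¹ := by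
        rw [mul_inv]
        field_simp
      rw [e3]
      generalize ((∏ k ∈ Finset.Icc 1 k, coeffa β lam (2 * k)) *
          coeffa β lam (2 * (k + 1)))⁻¹ = p
      rw [show 4 * c * (β / 2 * (β / 2 - 1) + hypRho (β / 2 - lam) (-β / 2 + 1) (k + 2)) =
        coeffb β lam (2 * (k + 1 + 1)) * c by unfold hypRho coeffb; ring,
        show (4 * c) ^ 2 * hypSigma (β / 2 - lam) (-β / 2 + 1) (k + 2) =
          -(coeffc β lam (2 * (k + 1 + 1)) * c ^ 2 * coeffa β lam (2 * (k + 1))) by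
            unfold hypSigma coeffa coeffc; ring]
      simp only [C_mul, C_neg]
      ring

/-- The recurrence for the `dδ`-part of `ω^(+)`. -/
lemma pMixed_rec (ha : ∀ i : ℕ, 1 ≤ i → i ≤ m → coeffa β lam (2 * i) ≠ 0)
    {i : ℤ} (hi : i ≤ m) :
    C (coeffa β lam (2 * i)) * pMixed β lam c i =
      (C (coeffb β lam (2 * i) * c) + X) * pMixed β lam c (i - 1) +
        C (coeffc β lam (2 * i) * c ^ 2) * pMixed β lam c (i - 2) +
        2 * X * pMinus β lam c i - C (2 * c ^ 2) * X * pMinus β lam c (i - 2) := by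
  have h0 := pMinus_rec (c := c) ha hi
  have h1 := pMinus_rec (c := c) ha (show i - 1 ≤ m by omega)
  have h2 := pMinus_rec (c := c) ha (show i - 2 ≤ m by omega)
  have e1 : i - 1 - 1 = i - 2 := by ring
  have e2 : i - 2 - 1 = i - 3 := by ring
  have e3 : i - 2 + 1 = i - 1 := by ring
  have e4 : i - 1 + 1 = i := by ring
  simp only [pMixed, e1, e2, e3, e4] at h0 h1 h2 ⊢
  push_cast at h0 h1 h2 ⊢
  simp only [coeffa, coeffb, coeffc, C_add, C_sub, C_mul, C_neg, C_pow, C_ofNat, C_1] at h0 h1 h2 ⊢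
  -- The multipliers are the coefficient of `P_{i+1}` in `Q_i`, that of `P_{i-1}` in `Q_{i-1}` and
  -- that of `P_{i-3}` in `Q_{i-2}`.
  linear_combination (C lam + 2 * C (i : ℂ) - C β) * h0 - C c * 2 * (C lam + 2 * C (i : ℂ) - 2) * h1 +
    C c ^ 2 * (C lam + 2 * C (i : ℂ) + C β - 4) * h2

/-- The recurrence for `ω^(-)`. -/
lemma pMinus_full_rec (ha : ∀ i : ℕ, 1 ≤ i → i ≤ m → coeffa β lam (2 * i) ≠ 0)
    {i : ℤ} (hi : i ≤ m) :
    C (coeffA β lam (2 * i)) * pMinus β lam c i =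
      C (coeffB β lam (2 * i) * c) * pMinus β lam c (i - 1) +
        C (coeffC β lam (2 * i) * c ^ 2) * pMinus β lam c (i - 2) +
        C (coeffD β lam (2 * i) * c ^ 3) * pMinus β lam c (i - 3) +
        X * pMinus β lam c (i - 1) - C c * X * pMinus β lam c (i - 2) +
        2 * pMixed β lam c (i - 1) + C (2 * c) * pMixed β lam c (i - 2) := by
  have h1 := pMinus_rec (c := c) ha (show i - 1 ≤ m by omega)
  have h2 := pMinus_rec (c := c) ha (show i - 2 ≤ m by omega)
  have e1 : i - 1 - 1 = i - 2 := by ring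
  have e2 : i - 2 - 1 = i - 3 := by ring
  have e3 : i - 2 + 1 = i - 1 := by ring
  have e4 : i - 1 + 1 = i := by ring
  simp only [pMixed, e1, e2, e3, e4] at h1 h2 ⊢
  push_cast at h1 h2 ⊢
  simp only [coeffa, coeffA, coeffB, coeffC, coeffD, C_add, C_sub, C_mul, C_neg, C_pow, C_ofNat, C_1]
    at h1 h2 ⊢
  -- Since `A_{2i} = a_{2i-2} + 2(λ+2i-2-β)`, the leading term of `2 Q_{i-1}` reduces `A_{2i} P_i`
  -- to `a_{2i-2} P_i`. What remains is the three-term recurrence at `i-1` minus `c` times the one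
  -- at `i-2`.
  linear_combination h1 - C c * h2

/-- The closed form of the `dδ`-part of `ω^(+)` in terms of `s^(-)`. -/
lemma pMixed_eq_sComb (ha : ∀ i : ℕ, 1 ≤ i → i ≤ m → coeffa β lam (2 * i) ≠ 0)
    {k : ℕ} (hk : k ≤ m) :
    pMixed β lam c k = C (((lam - β) * ∏ k ∈ Finset.Icc 1 k, coeffa β lam (2 * k))⁻¹) *
      homog k (4 * c) ((sComb β lam k).comp (X + C (β / 2 * (β / 2 + 1)))) := by
  have hM : ∀ m, homog m (4 * c) ((sMinus β lam m).comp (X + C (β / 2 * (β / 2 + 1)))) =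
      hHyp (β / 2 - lam) (-β / 2 - 1) (β / 2 * (β / 2 + 1)) (4 * c) m := fun m => by
    rw [hHyp, sMinus_eq]
  have hdeg : ∀ m, ((sMinus β lam m).comp (X + C (β / 2 * (β / 2 + 1)))).natDegree ≤ m :=
    fun m => natDegree_comp_X_add_C_le (natDegree_sMinus_le β lam m) _
  -- All normalising constants are brought to the index `k`; the factors `a_{2k}`, `a_{2k-2}` picked
  -- up on the way are the quadratic factors in `sComb`.
  have hP : ∀ j : ℕ, j + 1 ≤ m → ((lam - β) * ∏ k ∈ Finset.Icc 1 j, coeffa β lam (2 * k))⁻¹ =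
      coeffa β lam (2 * (j + 1)) *
        ((lam - β) * ∏ k ∈ Finset.Icc 1 (j + 1), coeffa β lam (2 * k))⁻¹ := fun j hj => by
    have := ha (j + 1) (by omega) hj
    push_cast at this
    rw [prod_coeffa_succ, ← mul_assoc, mul_inv _ (coeffa _ _ _), mul_left_comm,
      mul_inv_cancel₀ this, mul_one]
  match k with
  | 0 =>
    rw [pMixed, pMinus_nonpos _ _ _ (show ((0 : ℕ) : ℤ) ≤ 0 by simp),
      pMinus_nonpos _ _ _ (show ((0 : ℕ) : ℤ) - 1 ≤ 0 by simp), pMinus_succ, hHyp_zero, sComb,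
      C_comp, homog_C]
    simp
    ring
  | 1 =>
    have e : pMinus β lam c ((1 : ℕ) : ℤ) = pMinus β lam c ((0 : ℕ) + 1) := rfl
    rw [pMixed, pMinus_nonpos _ _ _ (show ((1 : ℕ) : ℤ) - 1 ≤ 0 by simp), pMinus_succ, e,
      pMinus_succ, hP 0 hk, sComb, sub_comp, mul_comp, C_comp, C_comp, homog_sub, homog_C_mul, hM,
      homog_C, hHyp_zero]
    generalize hp : ((lam - β) * ∏ k ∈ Finset.Icc 1 (0 + 1), coeffa β lam (2 * (k : ℕ)))⁻¹ = p
    generalize hHyp (β / 2 - lam) (-β / 2 - 1) (β / 2 * (β / 2 + 1)) (4 * c) 1 = h1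
    clear hM hdeg hP ha hp
    obtain ⟨B, rfl⟩ : ∃ B, β = 2 * B := ⟨β / 2, by ring⟩
    rw [show 2 * B / 2 = B by ring]
    push_cast
    simp only [coeffa, C_add, C_sub, C_mul, C_neg, C_pow, C_ofNat, C_1, C_0]
    ring
  | k + 2 =>
    have e1 : ((k + 2 : ℕ) : ℤ) + 1 = (k + 2 : ℕ) + 1 := rfl
    have e2 : ((k + 2 : ℕ) : ℤ) = (k + 1 : ℕ) + 1 := by push_cast; ring
    have e3 : ((k + 2 : ℕ) : ℤ) - 1 = (k : ℕ) + 1 := by push_cast; ring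
    rw [pMixed, e3, pMinus_succ, pMinus_succ, e2, pMinus_succ, hP k (by omega), hP (k + 1) hk,
      sComb, add_comp, sub_comp, mul_comp, mul_comp, mul_comp, C_comp, C_comp, C_comp, homog_add,
      homog_sub, homog_C_mul, homog_C_mul, homog_C_mul, hM, homog_succ (k + 1) _ _ (hdeg _), hM,
      homog_succ (k + 1) _ _ ((hdeg k).trans (Nat.le_succ k)), homog_succ k _ _ (hdeg _), hM]
    generalize hp : ((lam - β) * ∏ k ∈ Finset.Icc 1 (k + 1 + 1), coeffa β lam (2 * (k : ℕ)))⁻¹ = p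
    generalize hHyp (β / 2 - lam) (-β / 2 - 1) (β / 2 * (β / 2 + 1)) (4 * c) (k + 2) = hk2
    generalize hHyp (β / 2 - lam) (-β / 2 - 1) (β / 2 * (β / 2 + 1)) (4 * c) (k + 1) = hk1
    generalize hHyp (β / 2 - lam) (-β / 2 - 1) (β / 2 * (β / 2 + 1)) (4 * c) k = hk
    clear hM hdeg hP ha hp
    -- Substituting `β = 2B` removes the halves, which `C` would otherwise hide from `ring`.
    obtain ⟨B, rfl⟩ : ∃ B, β = 2 * B := ⟨β / 2, by ring⟩
    rw [show 2 * B / 2 = B by ring]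
    push_cast
    simp only [coeffa, C_add, C_sub, C_mul, C_neg, C_pow, C_ofNat, C_1]
    ring

/-- At `X = 0` the source terms in `pMixed_rec` disappear and it coincides with `pPlus_rec`; both
sequences vanish for negative index and have the value `1` at index `0`. -/
lemma eval_zero_pMixed (hlam : lam ≠ β)
    (ha : ∀ i : ℕ, 1 ≤ i → i ≤ m → coeffa β lam (2 * i) ≠ 0) {k : ℤ} (hk : k ≤ m) :
    (pMixed β lam c k).eval 0 = (pPlus β lam c k).eval 0 := by
  have hs : lam - β ≠ 0 := sub_ne_zero.2 hlam
  have key : ∀ k : ℕ, k ≤ m → ∀ i : ℤ, i ≤ k →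
      (pMixed β lam c i).eval 0 = (pPlus β lam c i).eval 0 := by
    intro k
    induction k with
    | zero =>
      intro _ i hi
      rcases lt_or_eq_of_le hi with h | rfl
      · rw [pMixed_neg _ _ _ (by exact_mod_cast h), pPlus_neg _ _ _ (by exact_mod_cast h)]
      · rw [pMixed_eq_sComb ha (Nat.zero_le m), pPlus_nat, hHyp_zero, sComb, C_comp, homog_C]
        simp [hs]
    | succ k ih =>
      intro hk i hi
      rcases lt_or_eq_of_le hi with h | rfl
      · exact ih (by omega) i (by push_cast at h; omega)
      · have h1 := congrArg (eval 0) (pMixed_rec (c := c) ha (show ((k + 1 : ℕ) : ℤ) ≤ m by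
          exact_mod_cast hk))
        have h2 := congrArg (eval 0) (pPlus_rec (c := c) ha (show ((k + 1 : ℕ) : ℤ) ≤ m by
          exact_mod_cast hk))
        simp only [eval_add, eval_sub, eval_mul, eval_C, eval_X, mul_zero, zero_mul, add_zero,
          sub_zero] at h1 h2
        rw [ih (by omega) (((k + 1 : ℕ) : ℤ) - 1) (by push_cast; omega),
          ih (by omega) (((k + 1 : ℕ) : ℤ) - 2) (by push_cast; omega), ← h2] at h1
        exact mul_left_cancel₀ (by exact_mod_cast ha (k + 1) (by omega) hk) h1
  exact key m le_rfl k hk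

/-- The closed form of the `dδ`-part of `ω^(+)` in terms of `s^(1)`. -/
lemma homog_s1_eq (ha : ∀ i : ℕ, 1 ≤ i → i ≤ m → coeffa β lam (2 * i) ≠ 0) {k : ℕ} (hk : k ≤ m) :
    C (((lam - β) * ∏ k ∈ Finset.Icc 1 k, coeffa β lam (2 * k))⁻¹) *
      homog k (4 * c) ((s1 β lam k).comp (X + C (β / 2 * (β / 2 + 1)))) =
    pMixed β lam c k - C ((pMixed β lam c k).eval 0) := by
  rw [pMixed_eq_sComb ha hk, s1_eq_sComb, sub_comp, C_comp, homog_sub, homog_C, mul_sub, eval_mul,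
    eval_C, eval_zero_homog, eval_comp]
  simp

/-! ### The solution operators in an abstract complex -/

variable {V L : Type*} [AddCommGroup V] [Module ℂ V] [AddCommGroup L] [Module ℂ L]
  (d : L →ₗ[ℂ] V) (δ : V →ₗ[ℂ] L) (Dx : Module.End ℂ V) (E : Module.End ℂ L)

/-- Every positive power of `B` is annihilated by `A`, so only the constant term survives. -/
lemma aeval_apply_of_comp_eq_zero {W : Type*} [AddCommGroup W] [Module ℂ W] {A : V →ₗ[ℂ] W}
    {B : Module.End ℂ V} (h : ∀ v, A (B v) = 0) (q : ℂ[X]) (v : V) :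
    A (aeval B q v) = q.eval 0 • A v := by
  induction q using Polynomial.induction_on' with
  | add p q hp hq => simp [hp, hq, add_smul]
  | monomial n a =>
    rw [aeval_monomial, Module.End.mul_apply, Module.algebraMap_end_apply, map_smul, eval_monomial]
    rcases n with _ | n
    · simp
    · rw [pow_succ', Module.End.mul_apply, h]
      simp

/-- `δ (dδ)^n = (δd)^n δ`, extended linearly. -/
lemma aeval_comp_apply_comm (q : ℂ[X]) (v : V) :
    δ (aeval (d ∘ₗ δ : Module.End ℂ V) q v) = aeval (δ ∘ₗ d : Module.End ℂ L) q (δ v) := by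
  induction q using Polynomial.induction_on' with
  | add p q hp hq => simp [hp, hq]
  | monomial n a =>
    rw [aeval_monomial, aeval_monomial, Module.End.mul_apply, Module.End.mul_apply,
      Module.algebraMap_end_apply, Module.algebraMap_end_apply, map_smul]
    congr 1
    induction n with
    | zero => simp
    | succ n ih =>
      rw [pow_succ', pow_succ', Module.End.mul_apply, Module.End.mul_apply, ← ih]
      rfl

/-- The abstract form of `ω_{2k}^(-)`. -/
def solMinus (β lam c : ℂ) (k : ℤ) (φ : V) : L :=
  aeval (δ ∘ₗ d : Module.End ℂ L) (pMinus β lam c k) (δ φ)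

/-- The abstract form of `ω_{2k}^(+)`. -/
def solPlus (β lam c : ℂ) (k : ℤ) (φ : V) : V :=
  aeval Dx (pPlus β lam c k) φ + aeval (d ∘ₗ δ : Module.End ℂ V) (pMixed β lam c k) φ -
    (pMixed β lam c k).eval 0 • φ

lemma aeval_C_mul_apply (B : Module.End ℂ V) (a : ℂ) (q : ℂ[X]) (v : V) :
    aeval B (C a * q) v = a • aeval B q v := by
  simp

lemma aeval_X_mul_apply (B : Module.End ℂ V) (q : ℂ[X]) (v : V) :
    aeval B (X * q) v = B (aeval B q v) := by
  simp

variable {d δ Dx E}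

/-- Under `δ` the part `S_k(δd) φ` contributes only `S_k(0) δφ`, which the correction `-Q_k(0) φ`
cancels. By the definition of `pMixed` the result is a combination of `ω^(-)_{2k+2}`, `ω^(-)_{2k}`,
`ω^(-)_{2k-2}`: the tangential part of the equation saying that `ω` is coclosed. -/
lemma codiff_solPlus (hlam : lam ≠ β) (ha : ∀ i : ℕ, 1 ≤ i → i ≤ m → coeffa β lam (2 * i) ≠ 0)
    (h1 : ∀ v, δ (Dx v) = 0) {k : ℤ} (hk : k ≤ m) (φ : V) :
    δ (solPlus d δ Dx β lam c k φ) = aeval (δ ∘ₗ d : Module.End ℂ L) (pMixed β lam c k) (δ φ) := by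
  rw [solPlus, map_sub, map_add, aeval_apply_of_comp_eq_zero h1, aeval_comp_apply_comm, map_smul,
    eval_zero_pMixed hlam ha hk]
  abel

/-- `pMinus_full_rec` evaluated at `δd` and applied to `δφ`. Of the Laplacian only `δd` acts,
because `ω^(-)` lies in the image of `δ`. -/
lemma solMinus_rec (hlam : lam ≠ β) (ha : ∀ i : ℕ, 1 ≤ i → i ≤ m → coeffa β lam (2 * i) ≠ 0)
    (h1 : ∀ v, δ (Dx v) = 0) (h3 : ∀ v, E (δ v) = 0) {k : ℤ} (hk : k ≤ m) (φ : V) :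
    coeffA β lam (2 * k) • solMinus d δ β lam c k φ =
      (coeffB β lam (2 * k) * c) • solMinus d δ β lam c (k - 1) φ +
        (coeffC β lam (2 * k) * c ^ 2) • solMinus d δ β lam c (k - 2) φ +
        (coeffD β lam (2 * k) * c ^ 3) • solMinus d δ β lam c (k - 3) φ +
        (E (solMinus d δ β lam c (k - 1) φ) + δ (d (solMinus d δ β lam c (k - 1) φ))) -
        c • (E (solMinus d δ β lam c (k - 2) φ) + δ (d (solMinus d δ β lam c (k - 2) φ))) +
        (2 : ℂ) • δ (solPlus d δ Dx β lam c (k - 1) φ) +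
        (2 * c) • δ (solPlus d δ Dx β lam c (k - 2) φ) := by
  have hE : ∀ i, E (solMinus d δ β lam c i φ) = 0 := fun i => by
    rw [solMinus, ← aeval_comp_apply_comm, h3]
  have h := congrArg (fun q => aeval (δ ∘ₗ d : Module.End ℂ L) q (δ φ)) (pMinus_full_rec (c := c) ha hk)
  simp only [map_add, map_sub, LinearMap.add_apply, LinearMap.sub_apply, mul_assoc (C c) X,
    aeval_C_mul_apply, aeval_X_mul_apply, ← C_ofNat (2 : ℕ)] at h
  rw [hE, hE, zero_add, zero_add, codiff_solPlus hlam ha h1 (by omega),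
    codiff_solPlus hlam ha h1 (by omega)]
  exact h

/-- The claim is the sum of three identities: `pPlus_rec` at `δd`, `pMixed_rec` at `dδ`, and
`pMixed_rec` at `0` for the subtracted constants. They do not interact, since `δd` annihilates the
image of `d` and `δ` that of `δd`. -/
lemma solPlus_rec (hlam : lam ≠ β) (ha : ∀ i : ℕ, 1 ≤ i → i ≤ m → coeffa β lam (2 * i) ≠ 0)
    (h1 : ∀ v, δ (Dx v) = 0) (h2 : ∀ v, Dx (d v) = 0) {k : ℤ} (hk : k ≤ m) (φ : V) :
    coeffa β lam (2 * k) • solPlus d δ Dx β lam c k φ =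
      (coeffb β lam (2 * k) * c) • solPlus d δ Dx β lam c (k - 1) φ +
        (coeffc β lam (2 * k) * c ^ 2) • solPlus d δ Dx β lam c (k - 2) φ +
        (d (δ (solPlus d δ Dx β lam c (k - 1) φ)) + Dx (solPlus d δ Dx β lam c (k - 1) φ)) +
        (2 : ℂ) • d (solMinus d δ β lam c k φ) -
        (2 * c ^ 2) • d (solMinus d δ β lam c (k - 2) φ) := by
  have hM : ∀ i, d (solMinus d δ β lam c i φ) =
      aeval (d ∘ₗ δ : Module.End ℂ V) (X * pMinus β lam c i) φ := fun i => by
    rw [solMinus, ← aeval_comp_apply_comm, aeval_X_mul_apply]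
    rfl
  have hx := congrArg (fun q => aeval Dx q φ) (pPlus_rec (c := c) ha hk)
  have hy := congrArg (fun q => aeval (d ∘ₗ δ : Module.End ℂ V) q φ) (pMixed_rec (c := c) ha hk)
  have h0 := congrArg (eval 0) (pMixed_rec (c := c) ha hk)
  simp only [map_add, map_sub, LinearMap.add_apply, LinearMap.sub_apply, mul_assoc (C _) X,
    aeval_C_mul_apply, aeval_X_mul_apply, add_mul, ← C_ofNat (2 : ℕ)] at hx hy
  simp only [eval_add, eval_sub, eval_mul, eval_C, eval_X, mul_zero, zero_mul, add_zero,
    sub_zero] at h0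
  have hdδ : d (δ (solPlus d δ Dx β lam c (k - 1) φ)) =
      (d ∘ₗ δ) (aeval (d ∘ₗ δ : Module.End ℂ V) (pMixed β lam c (k - 1)) φ) := by
    rw [codiff_solPlus hlam ha h1 (by omega), ← aeval_comp_apply_comm]
    rfl
  have hDx : Dx (solPlus d δ Dx β lam c (k - 1) φ) = Dx (aeval Dx (pPlus β lam c (k - 1)) φ) := by
    rw [solPlus, map_sub, map_add, aeval_apply_of_comp_eq_zero (A := Dx) (B := d ∘ₗ δ)
      (fun v => h2 _), map_smul]
    abel
  rw [hdδ, hDx, hM, hM, aeval_X_mul_apply, aeval_X_mul_apply]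
  simp only [solPlus, smul_sub, smul_add, smul_smul, h0, add_smul, hx, hy]
  module

end Nonresonant

/-! ### The Hodge star of a scalar product -/

section Star

lemma append_eq_dite {V : Type*} {p q : ℕ} (w : Fin p → V) (v : Fin q → V) (k : Fin (p + q)) :
    Fin.append w v k = if h : (k : ℕ) < p then w ⟨k, h⟩ else v ⟨k - p, by omega⟩ := by
  refine Fin.addCases (fun l => ?_) (fun l => ?_) k
  · simp
  · simp

lemma map_append_cast {V W : Type*} (T : V → W) {p q N : ℕ} (h : p + q = N) (w : Fin p → V)
    (v : Fin q → V) (k : Fin N) :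
    T (Fin.append w v (Fin.cast h.symm k)) =
      Fin.append (fun a => T (w a)) (fun a => T (v a)) (Fin.cast h.symm k) := by
  subst h
  refine Fin.addCases (fun l => ?_) (fun l => ?_) k <;> simp

lemma finRotate_pow_apply (n m : ℕ) (k : Fin (n + 1)) :
    (((finRotate (n + 1)) ^ m) k : ℕ) = (k + m) % (n + 1) := by
  induction m with
  | zero => simp [Nat.mod_eq_of_lt k.2]
  | succ m ih =>
    rw [pow_succ', Equiv.Perm.mul_apply, finRotate_apply, Fin.val_add, ih, ← add_assoc]
    simp

/-- Interchanging the two blocks is a cyclic rotation by `q` places. -/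
lemma append_swap_eq {V : Type*} {p q n : ℕ} (h : p + q = n + 1) (h' : q + p = n + 1)
    (w : Fin p → V) (v : Fin q → V) :
    (fun k : Fin (n + 1) => Fin.append w v (Fin.cast h.symm k)) =
      (fun k : Fin (n + 1) => Fin.append v w (Fin.cast h'.symm k)) ∘ ((finRotate (n + 1)) ^ q) := by
  funext k
  have hk := k.2
  simp only [Function.comp_apply, append_eq_dite, Fin.val_cast, finRotate_pow_apply]
  by_cases hkp : (k : ℕ) < p
  · have e : ((k : ℕ) + q) % (n + 1) = k + q := Nat.mod_eq_of_lt (by omega)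
    simp [hkp, e]
  · have e : ((k : ℕ) + q) % (n + 1) = k - p := by
      rw [show (k : ℕ) + q = (k - p) + (n + 1) by omega, Nat.add_mod_right]
      exact Nat.mod_eq_of_lt (by omega)
    have : (k : ℕ) - p < q := by omega
    simp [hkp, e, this]

set_option linter.unusedSectionVars false

variable {V : Type*} [AddCommGroup V] [Module ℝ V] [TopologicalSpace V]

/-- The rotation by `q` of `p + q` entries has sign `(-1)^((p+q-1)q)`, and `q(q-1)` is even. -/
lemma map_append_swap {p q N : ℕ} (h : p + q = N) (h' : q + p = N) (μ : V [⋀^Fin N]→L[ℝ] ℝ)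
    (w : Fin p → V) (v : Fin q → V) :
    μ (fun k => Fin.append w v (Fin.cast h.symm k)) =
      (-1) ^ (p * q) * μ (fun k => Fin.append v w (Fin.cast h'.symm k)) := by
  rcases N with _ | n
  · obtain rfl : p = 0 := by omega
    obtain rfl : q = 0 := by omega
    simp only [mul_zero, pow_zero, one_mul]
    congr 1
    funext k
    exact k.elim0
  · rw [append_swap_eq h h', ← ContinuousAlternatingMap.coe_toAlternatingMap,
      AlternatingMap.map_perm, map_pow, sign_finRotate]
    have : ((-1 : ℝ) ^ n) ^ q = (-1) ^ (p * q) := by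
      rw [← pow_mul]
      rcases Nat.even_or_odd q with hq | hq
      · rw [(hq.mul_left n).neg_one_pow, (hq.mul_left p).neg_one_pow]
      · rcases Nat.even_or_odd p with hp | hp
        · have : Even n := by
            have : Odd (n + 1) := h ▸ hp.add_odd hq
            simpa [Nat.odd_add_one] using this
          rw [(this.mul_right q).neg_one_pow, (hp.mul_right q).neg_one_pow]
        · have : Odd n := by
            have : Even (n + 1) := h ▸ hp.add_odd hq
            simpa [Nat.even_add_one] using this
          rw [(this.mul hq).neg_one_pow, (hp.mul hq).neg_one_pow]
    rw [← this]
    simp [Units.smul_def]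

lemma append_update_left_cast {V : Type*} {p q N : ℕ} (h : p + q = N) (w : Fin p → V)
    [DecidableEq (Fin p)] (v : Fin q → V) (i : Fin p) (x : V) :
    (fun k : Fin N => Fin.append (Function.update w i x) v (Fin.cast h.symm k)) =
      Function.update (fun k : Fin N => Fin.append w v (Fin.cast h.symm k))
        (Fin.cast h (Fin.castAdd q i)) x := by
  subst h
  ext k
  refine Fin.addCases (fun l => ?_) (fun l => ?_) k
  · by_cases hl : l = i
    · subst hl; simp
    · have : Fin.castAdd q l ≠ Fin.castAdd q i := fun hh => hl (by simpa using hh)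
      simp [Function.update_of_ne this, Function.update_of_ne hl]
  · have : Fin.natAdd p l ≠ Fin.castAdd q i := by
      intro hh
      have := congrArg Fin.val hh
      simp at this
      omega
    simp [Function.update_of_ne this]

/-- The multilinear map `w ↦ μ (w₁, …, w_p, v₁, …, v_q)`. -/
def insertLast {p q N : ℕ} (h : p + q = N) (μ : V [⋀^Fin N]→L[ℝ] ℝ) (v : Fin q → V) :
    MultilinearMap ℝ (fun _ : Fin p => V) ℝ where
  toFun w := μ (fun k => Fin.append w v (Fin.cast h.symm k))
  map_update_add' w i x y := by
    simp only [append_update_left_cast h]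
    exact μ.map_update_add _ _ _ _
  map_update_smul' w i c x := by
    simp only [append_update_left_cast h]
    exact μ.map_update_smul _ _ _ _

lemma insertFirst_apply {p q N : ℕ} (h : p + q = N) (μ : V [⋀^Fin N]→L[ℝ] ℝ) (w : Fin p → V)
    (v : Fin q → V) :
    insertFirst h μ w v = μ (fun k => Fin.append w v (Fin.cast h.symm k)) := rfl

variable {g : V → V → ℝ} {B : V →ₗ[ℝ] V →ₗ[ℝ] ℝ} {N : ℕ}

lemma IsOrthonormalFrame.linearIndependent (hg : ∀ u v, g u v = B u v) {e : Fin N → V}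
    (he : IsOrthonormalFrame g e) : LinearIndependent ℝ e := by
  rw [Fintype.linearIndependent_iff]
  intro a ha i
  have h := congrArg (fun x => B x (e i)) ha
  simpa [← hg, he _ _] using h

/-- An orthonormal frame as a basis. -/
def IsOrthonormalFrame.basis (hg : ∀ u v, g u v = B u v) (hN : N ≠ 0)
    (hdim : Module.finrank ℝ V = N) {e : Fin N → V} (he : IsOrthonormalFrame g e) :
    Module.Basis (Fin N) ℝ V :=
  haveI : NeZero N := ⟨hN⟩
  basisOfLinearIndependentOfCardEqFinrank (he.linearIndependent hg) (by simp [hdim])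

lemma IsOrthonormalFrame.coe_basis (hg : ∀ u v, g u v = B u v) (hN : N ≠ 0)
    (hdim : Module.finrank ℝ V = N) {e : Fin N → V} (he : IsOrthonormalFrame g e) :
    ⇑(he.basis hg hN hdim) = e := by
  simp [IsOrthonormalFrame.basis]

lemma exists_orthonormalFrame (hg : ∀ u v, g u v = B u v) (hs : ∀ u v, B u v = B v u)
    (hpos : ∀ u, u ≠ 0 → 0 < B u u) [FiniteDimensional ℝ V] (hdim : Module.finrank ℝ V = N) :
    ∃ e : Fin N → V, IsOrthonormalFrame g e := by
  subst hdim
  have hsymm : LinearMap.IsSymm B := ⟨fun u v => hs u v⟩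
  obtain ⟨b, hb⟩ := LinearMap.BilinForm.exists_orthogonal_basis hsymm
  refine ⟨fun i => (Real.sqrt (B (b i) (b i)))⁻¹ • b i, fun i j => ?_⟩
  have hp := hpos (b i) (b.ne_zero i)
  rw [hg]
  by_cases hij : i = j
  · subst hij
    have := Real.mul_self_sqrt hp.le
    have h0 : Real.sqrt (B (b i) (b i)) ≠ 0 := (Real.sqrt_pos.2 hp).ne'
    simp only [map_smul, LinearMap.smul_apply, smul_eq_mul, if_true]
    field_simp
    rw [← sq] at this
    exact this.symm
  · have : B (b i) (b j) = 0 := hb hij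
    simp [this, hij]

/-- The contraction of two multilinear maps over an orthonormal frame, in terms of a basis. -/
lemma sum_frame_eq_sum_basis (hg : ∀ u v, g u v = B u v) {e : Fin N → V}
    (he : IsOrthonormalFrame g e) (b : Module.Basis (Fin N) ℝ V) {p : ℕ}
    (β : MultilinearMap ℝ (fun _ : Fin p => V) ℂ) (F : MultilinearMap ℝ (fun _ : Fin p => V) ℝ) :
    ∑ i : Fin p → Fin N, F (fun k => e (i k)) • β (fun k => e (i k)) =
      ∑ a : Fin p → Fin N, ∑ a' : Fin p → Fin N,
        ((∏ k, (Matrix.of fun x y => g (b x) (b y))⁻¹ (a k) (a' k)) *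
          F (fun k => b (a' k))) • β (fun k => b (a k)) := by
  set A : Matrix (Fin N) (Fin N) ℝ := Matrix.of fun i x => b.repr (e i) x with hA
  set G : Matrix (Fin N) (Fin N) ℝ := Matrix.of fun x y => g (b x) (b y) with hG
  have hexp : ∀ i, e i = ∑ x, A i x • b x := fun i => (b.sum_repr (e i)).symm
  -- Orthonormality is `A G Aᵀ = 1`, hence `G⁻¹ = Aᵀ A`. The contraction therefore depends on the
  -- frame only through `G⁻¹`, that is, not at all.
  have h1 : A * (G * A.transpose) = 1 := by
    ext i j
    have h := he i j
    rw [hg, hexp i, hexp j] at h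
    simp only [map_sum, map_smul, LinearMap.sum_apply, LinearMap.smul_apply, smul_eq_mul,
      ← hg] at h
    rw [Matrix.one_apply, ← h]
    simp only [Matrix.mul_apply, Matrix.transpose_apply, Finset.mul_sum, hG, Matrix.of_apply]
    rw [Finset.sum_comm]
    refine Finset.sum_congr rfl fun x _ => Finset.sum_congr rfl fun y _ => ?_
    ring
  have h2 : G * A.transpose * A = 1 := mul_eq_one_comm.1 h1
  have h3 : G⁻¹ = A.transpose * A := Matrix.inv_eq_right_inv (by rw [← mul_assoc, h2])
  have hβ : ∀ i : Fin p → Fin N, β (fun k => e (i k)) =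
      ∑ a : Fin p → Fin N, (∏ k, A (i k) (a k)) • β (fun k => b (a k)) := by
    intro i
    simp only [hexp]
    rw [MultilinearMap.map_sum]
    exact Finset.sum_congr rfl fun a _ => β.map_smul_univ _ _
  have hF : ∀ i : Fin p → Fin N, F (fun k => e (i k)) =
      ∑ a : Fin p → Fin N, (∏ k, A (i k) (a k)) • F (fun k => b (a k)) := by
    intro i
    simp only [hexp]
    rw [MultilinearMap.map_sum]
    exact Finset.sum_congr rfl fun a _ => F.map_smul_univ _ _
  have hG' : ∀ a a' : Fin p → Fin N, ∏ k, G⁻¹ (a k) (a' k) =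
      ∑ i : Fin p → Fin N, (∏ k, A (i k) (a k)) * ∏ k, A (i k) (a' k) := by
    intro a a'
    rw [h3]
    simp only [Matrix.mul_apply, Matrix.transpose_apply]
    rw [Finset.prod_univ_sum, Fintype.piFinset_univ]
    exact Finset.sum_congr rfl fun i _ => Finset.prod_mul_distrib
  simp only [hG', Finset.sum_mul, Finset.sum_smul]
  rw [Finset.sum_congr rfl fun a _ => Finset.sum_comm, Finset.sum_comm]
  refine Finset.sum_congr rfl fun i _ => ?_
  rw [hβ, Finset.smul_sum]
  refine Finset.sum_congr rfl fun a _ => ?_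
  rw [hF, Finset.sum_smul]
  refine Finset.sum_congr rfl fun a' _ => ?_
  rw [smul_smul]
  congr 1
  simp only [smul_eq_mul]
  ring

lemma hodgeStar_apply_choose {p q : ℕ} (h : p + q = N) (μ : V [⋀^Fin N]→L[ℝ] ℝ)
    (β : V [⋀^Fin p]→L[ℝ] ℂ) (he : ∃ e : Fin N → V, IsOrthonormalFrame g e) (v : Fin q → V) :
    hodgeStar h g μ β v = ((p.factorial : ℝ)⁻¹) • ∑ i : Fin p → Fin N,
      insertFirst h μ (fun k => he.choose (i k)) v • β (fun k => he.choose (i k)) := by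
  rw [hodgeStar, dif_pos he]
  simp

/-- The Hodge star in terms of an arbitrary basis. -/
lemma hodgeStar_apply_basis (hg : ∀ u v, g u v = B u v) {p q : ℕ} (h : p + q = N)
    (μ : V [⋀^Fin N]→L[ℝ] ℝ) (β : V [⋀^Fin p]→L[ℝ] ℂ)
    (he : ∃ e : Fin N → V, IsOrthonormalFrame g e) (b : Module.Basis (Fin N) ℝ V) (v : Fin q → V) :
    hodgeStar h g μ β v = ((p.factorial : ℝ)⁻¹) • ∑ a : Fin p → Fin N, ∑ a' : Fin p → Fin N,
      ((∏ k, (Matrix.of fun x y => g (b x) (b y))⁻¹ (a k) (a' k)) *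
        insertFirst h μ (fun k => b (a' k)) v) • β (fun k => b (a k)) := by
  rw [hodgeStar_apply_choose h μ β he]
  congr 1
  exact sum_frame_eq_sum_basis hg he.choose_spec b β.toMultilinearMap (insertLast h μ v)

/-- The Hodge star in terms of an arbitrary orthonormal frame. -/
lemma hodgeStar_apply (hg : ∀ u v, g u v = B u v) (hN : N ≠ 0) (hdim : Module.finrank ℝ V = N)
    {p q : ℕ} (h : p + q = N) (μ : V [⋀^Fin N]→L[ℝ] ℝ) (β : V [⋀^Fin p]→L[ℝ] ℂ)
    {e : Fin N → V} (he : IsOrthonormalFrame g e) (v : Fin q → V) :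
    hodgeStar h g μ β v = ((p.factorial : ℝ)⁻¹) • ∑ i : Fin p → Fin N,
      insertFirst h μ (fun k => e (i k)) v • β (fun k => e (i k)) := by
  rw [hodgeStar_apply_choose h μ β ⟨e, he⟩]
  congr 1
  refine (sum_frame_eq_sum_basis hg (Exists.choose_spec ⟨e, he⟩) (he.basis hg hN hdim)
    β.toMultilinearMap (insertLast h μ v)).trans
    (sum_frame_eq_sum_basis hg he (he.basis hg hN hdim)
    β.toMultilinearMap (insertLast h μ v)).symm

lemma hodgeStar_add {p q : ℕ} (h : p + q = N) (μ : V [⋀^Fin N]→L[ℝ] ℝ)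
    (β β' : V [⋀^Fin p]→L[ℝ] ℂ) :
    hodgeStar h g μ (β + β') = hodgeStar h g μ β + hodgeStar h g μ β' := by
  by_cases he : ∃ e : Fin N → V, IsOrthonormalFrame g e
  · ext v
    rw [ContinuousAlternatingMap.add_apply]
    simp only [hodgeStar_apply_choose h μ _ he, ContinuousAlternatingMap.add_apply, smul_add,
      Finset.sum_add_distrib]
  · simp [hodgeStar, he]

lemma hodgeStar_smul {p q : ℕ} (h : p + q = N) (μ : V [⋀^Fin N]→L[ℝ] ℝ) (a : ℂ)
    (β : V [⋀^Fin p]→L[ℝ] ℂ) : hodgeStar h g μ (a • β) = a • hodgeStar h g μ β := by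
  by_cases he : ∃ e : Fin N → V, IsOrthonormalFrame g e
  · ext v
    rw [ContinuousAlternatingMap.smul_apply]
    simp only [hodgeStar_apply_choose h μ _ he, ContinuousAlternatingMap.smul_apply]
    simp only [Finset.smul_sum, smul_comm a]
  · ext v
    simp [hodgeStar, he]

lemma hodgeStar_zero {p q : ℕ} (h : p + q = N) (μ : V [⋀^Fin N]→L[ℝ] ℝ) :
    hodgeStar h g μ (0 : V [⋀^Fin p]→L[ℝ] ℂ) = 0 := by
  by_cases he : ∃ e : Fin N → V, IsOrthonormalFrame g e
  · ext v
    simp [hodgeStar_apply_choose h μ _ he]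
  · simp [hodgeStar, he]

lemma injective_append_iff {α : Type*} {p q N : ℕ} (h : p + q = N) (i : Fin p → α) (j : Fin q → α) :
    Function.Injective (fun k : Fin N => Fin.append i j (Fin.cast h.symm k)) ↔
      Function.Injective i ∧ Function.Injective j ∧ ∀ a b, i a ≠ j b := by
  subst h
  exact Fin.append_injective_iff

lemma sign_mul_sign (m : ℕ) (σ : Equiv.Perm (Fin m)) :
    ((Equiv.Perm.sign σ : ℤ) : ℝ) * ((Equiv.Perm.sign σ : ℤ) : ℝ) = 1 := by
  rw [← Int.cast_mul, Int.units_coe_mul_self, Int.cast_one]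

/-- The permuted block is moved to the back, where `insertFirst` is alternating by construction; the
two block signs agree and drop out. -/
lemma insertFirst_perm_left {p q : ℕ} (h : p + q = N) (μ : V [⋀^Fin N]→L[ℝ] ℝ) (w : Fin p → V)
    (v : Fin q → V) (σ : Equiv.Perm (Fin p)) :
    insertFirst h μ (w ∘ σ) v = (Equiv.Perm.sign σ : ℤ) * insertFirst h μ w v := by
  have h' : q + p = N := by omega
  have e : ∀ w : Fin p → V, insertFirst h μ w v = (-1) ^ (p * q) * insertFirst h' μ v w := fun w =>
    map_append_swap h h' μ w v
  rw [e, e, ← ContinuousAlternatingMap.coe_toAlternatingMap, AlternatingMap.map_perm]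
  simp [Units.smul_def]
  ring

lemma insertFirst_perm_right {p q : ℕ} (h : p + q = N) (μ : V [⋀^Fin N]→L[ℝ] ℝ) (w : Fin p → V)
    (v : Fin q → V) (σ : Equiv.Perm (Fin q)) :
    insertFirst h μ w (v ∘ σ) = (Equiv.Perm.sign σ : ℤ) * insertFirst h μ w v := by
  rw [← ContinuousAlternatingMap.coe_toAlternatingMap, AlternatingMap.map_perm]
  simp [Units.smul_def]

lemma exists_complement {p q : ℕ} (h : p + q = N) {k : Fin p → Fin N} (hk : Function.Injective k) :
    ∃ j : Fin q → Fin N, Function.Injective j ∧ ∀ a b, k a ≠ j b := by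
  have hc : (Finset.univ \ Finset.univ.image k).card = q := by
    rw [Finset.card_sdiff_of_subset (Finset.subset_univ _), Finset.card_image_of_injective _ hk]
    simp
    omega
  refine ⟨(Finset.univ \ Finset.univ.image k).orderEmbOfFin hc, RelEmbedding.injective _,
    fun a b hab => ?_⟩
  have := Finset.orderEmbOfFin_mem _ hc b
  rw [← hab] at this
  simp at this

lemma exists_perm_of_complement {p q : ℕ} (h : p + q = N) {k i : Fin p → Fin N}
    {j : Fin q → Fin N} (hk : Function.Injective k) (hj : Function.Injective j)
    (hkj : ∀ a b, k a ≠ j b) (hi : Function.Injective i) (hij : ∀ a b, i a ≠ j b) :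
    ∃ σ : Equiv.Perm (Fin p), i = k ∘ σ := by
  have hb : Function.Bijective (fun l : Fin N => Fin.append k j (Fin.cast h.symm l)) :=
    Finite.injective_iff_bijective.1 ((injective_append_iff h k j).2 ⟨hk, hj, hkj⟩)
  have hex : ∀ a, ∃ a', k a' = i a := by
    intro a
    obtain ⟨l, hl⟩ := hb.2 (i a)
    revert hl
    subst h
    refine Fin.addCases (fun l hl => ⟨l, by simpa using hl⟩) (fun l hl => ?_) l
    exact absurd (by simpa using hl.symm) (hij a l)
  choose s hs using hex
  have hsi : Function.Injective s := fun a b hab => hi (by rw [← hs, ← hs, hab])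
  exact ⟨Equiv.ofBijective s (Finite.injective_iff_bijective.1 hsi), funext fun a => (hs a).symm⟩

/-- The square of the Hodge star. -/
lemma hodgeStar_hodgeStar (hg : ∀ u v, g u v = B u v) (hN : N ≠ 0)
    (hdim : Module.finrank ℝ V = N) {p q : ℕ} (h : p + q = N) (h' : q + p = N)
    (μ : V [⋀^Fin N]→L[ℝ] ℝ) (β : V [⋀^Fin p]→L[ℝ] ℂ) {e : Fin N → V}
    (he : IsOrthonormalFrame g e)
    (hμ : ∀ e : Fin N → V, IsOrthonormalFrame g e → |μ e| = 1) :
    hodgeStar h' g μ (hodgeStar h g μ β) = ((-1 : ℂ) ^ (p * q)) • β := by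
  apply ContinuousAlternatingMap.toAlternatingMap_injective
  refine (he.basis hg hN hdim).ext_alternating fun k hk => ?_
  rw [he.coe_basis hg hN hdim]
  change hodgeStar h' g μ (hodgeStar h g μ β) (fun a => e (k a)) =
    ((-1 : ℂ) ^ (p * q)) • β (fun a => e (k a))
  rw [hodgeStar_apply hg hN hdim h' μ _ he]
  simp only [hodgeStar_apply hg hN hdim h μ _ he]
  obtain ⟨j₀, hj₀, hkj⟩ := exists_complement h hk
  have hz : ∀ {p q : ℕ} (h : p + q = N) (i : Fin p → Fin N) (j : Fin q → Fin N),
      insertFirst h μ (fun a => e (i a)) (fun a => e (j a)) ≠ 0 →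
      Function.Injective i ∧ Function.Injective j ∧ ∀ a b, i a ≠ j b := by
    intro p q h i j hne
    rw [← injective_append_iff h]
    have : Function.Injective (fun k : Fin N =>
        Fin.append (fun a => e (i a)) (fun a => e (j a)) (Fin.cast h.symm k)) := by
      by_contra hc
      exact hne (μ.toAlternatingMap.map_eq_zero_of_not_injective _ hc)
    have e2 : (fun k : Fin N => Fin.append (fun a => e (i a)) (fun a => e (j a))
        (Fin.cast h.symm k)) = e ∘ (fun k : Fin N => Fin.append i j (Fin.cast h.symm k)) :=
      funext fun l => (map_append_cast e h i j l).symm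
    rw [e2] at this
    exact this.of_comp
  have hsq : insertFirst h μ (fun a => e (k a)) (fun a => e (j₀ a)) *
      insertFirst h μ (fun a => e (k a)) (fun a => e (j₀ a)) = 1 := by
    have hb := (injective_append_iff h k j₀).2 ⟨hk, hj₀, hkj⟩
    have := hμ (fun l => e (Fin.append k j₀ (Fin.cast h.symm l))) (fun i j => by
      rw [he]
      simp only [hb.eq_iff])
    have e2 : (fun l : Fin N => Fin.append (fun a => e (k a)) (fun a => e (j₀ a))
        (Fin.cast h.symm l)) = fun l => e (Fin.append k j₀ (Fin.cast h.symm l)) :=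
      funext fun l => (map_append_cast e h k j₀ l).symm
    rw [insertFirst_apply, e2, ← abs_mul_abs_self, this, one_mul]
  set m₀ := insertFirst h μ (fun a => e (k a)) (fun a => e (j₀ a)) with hm₀
  have hswap : insertFirst h' μ (fun a => e (j₀ a)) (fun a => e (k a)) = (-1) ^ (p * q) * m₀ := by
    rw [hm₀, insertFirst_apply, insertFirst_apply, map_append_swap h' h, mul_comm q p]
  -- A nonzero term requires `x.1` to be a permutation of the complement `j₀` of `k` and `x.2` a
  -- permutation of `k`. In these `q! p!` terms each sign occurs twice, so all have the same value
  -- and the factorials cancel; `(-1)^(pq)` is the sign of exchanging the blocks.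
  have hsum : ∑ x : (Fin q → Fin N) × (Fin p → Fin N),
      (insertFirst h' μ (fun a => e (x.1 a)) (fun a => e (k a)) *
        insertFirst h μ (fun a => e (x.2 a)) (fun a => e (x.1 a))) • β (fun a => e (x.2 a)) =
      ∑ _y : Equiv.Perm (Fin q) × Equiv.Perm (Fin p),
        ((-1 : ℝ) ^ (p * q)) • β (fun a => e (k a)) := by
    symm
    refine Fintype.sum_of_injective
      (fun y : Equiv.Perm (Fin q) × Equiv.Perm (Fin p) => (j₀ ∘ y.1, k ∘ y.2)) ?_ _ _ ?_ ?_
    · rintro ⟨τ, σ⟩ ⟨τ', σ'⟩ hy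
      simp only [Prod.mk.injEq] at hy
      refine Prod.ext (Equiv.ext fun a => hj₀ (congrFun hy.1 a))
        (Equiv.ext fun a => hk (congrFun hy.2 a))
    · rintro ⟨j, i⟩ hy
      by_contra hne
      apply hy
      have h1 : insertFirst h' μ (fun a => e (j a)) (fun a => e (k a)) ≠ 0 := fun h0 => by
        simp [h0] at hne
      have h2 : insertFirst h μ (fun a => e (i a)) (fun a => e (j a)) ≠ 0 := fun h0 => by
        simp [h0] at hne
      obtain ⟨hji, -, hjk⟩ := hz h' j k h1
      obtain ⟨hii, -, hij⟩ := hz h i j h2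
      obtain ⟨τ, hτ⟩ := exists_perm_of_complement h' hj₀ hk (fun a b => (hkj b a).symm) hji hjk
      obtain ⟨σ, hσ⟩ := exists_perm_of_complement h hk hji (fun a b => (hjk b a).symm) hii hij
      exact ⟨(τ, σ), by simp [hτ, hσ]⟩
    · rintro ⟨τ, σ⟩
      have f1 : (fun a => e ((j₀ ∘ τ) a)) = (fun a => e (j₀ a)) ∘ τ := rfl
      have f2 : (fun a => e ((k ∘ σ) a)) = (fun a => e (k a)) ∘ σ := rfl
      have f3 : β ((fun a => e (k a)) ∘ σ) = ((Equiv.Perm.sign σ : ℤ) : ℝ) • β fun a => e (k a) := by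
        rw [← ContinuousAlternatingMap.coe_toAlternatingMap, AlternatingMap.map_perm]
        simp [Units.smul_def]
      simp only [f1, f2]
      rw [insertFirst_perm_left, insertFirst_perm_left, insertFirst_perm_right, hswap, ← hm₀, f3,
        smul_smul]
      congr 1
      have s1 := sign_mul_sign q τ
      have s2 := sign_mul_sign p σ
      rw [show ((Equiv.Perm.sign τ : ℤ) : ℝ) * ((-1) ^ (p * q) * m₀) *
        ((Equiv.Perm.sign σ : ℤ) * ((Equiv.Perm.sign τ : ℤ) * m₀)) * (Equiv.Perm.sign σ : ℤ) =
        (-1) ^ (p * q) * (((Equiv.Perm.sign τ : ℤ) : ℝ) * (Equiv.Perm.sign τ : ℤ)) *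
        (((Equiv.Perm.sign σ : ℤ) : ℝ) * (Equiv.Perm.sign σ : ℤ)) * (m₀ * m₀) by ring, s1, s2, hsq]
      simp
  have hq : (q.factorial : ℝ) ≠ 0 := by exact_mod_cast q.factorial_ne_zero
  have hp : (p.factorial : ℝ) ≠ 0 := by exact_mod_cast p.factorial_ne_zero
  calc _ = (q.factorial : ℝ)⁻¹ • (p.factorial : ℝ)⁻¹ • ∑ x : (Fin q → Fin N) × (Fin p → Fin N),
      (insertFirst h' μ (fun a => e (x.1 a)) (fun a => e (k a)) *
        insertFirst h μ (fun a => e (x.2 a)) (fun a => e (x.1 a))) • β (fun a => e (x.2 a)) := by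
        rw [Fintype.sum_prod_type, Finset.smul_sum (r := (p.factorial : ℝ)⁻¹)]
        refine congrArg _ (Finset.sum_congr rfl fun j _ => ?_)
        rw [smul_comm, Finset.smul_sum]
        simp only [smul_smul]
    _ = _ := by
        rw [hsum, Finset.sum_const, Finset.card_univ, Fintype.card_prod, Fintype.card_perm,
          Fintype.card_perm, Fintype.card_fin, Fintype.card_fin, ← Nat.cast_smul_eq_nsmul ℝ,
          smul_smul, smul_smul]
        push_cast
        rw [show (q.factorial : ℝ)⁻¹ * (p.factorial : ℝ)⁻¹ * (q.factorial * p.factorial) = 1 by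
          field_simp, one_smul, Complex.real_smul]
        simp

end Star

lemma two_le_infty : minSmoothness ℝ 2 ≤ (∞ : WithTop ℕ∞) := by
  simp only [minSmoothness_of_isRCLikeNormedField]
  exact WithTop.coe_le_coe.2 (le_top (a := (2 : ℕ∞)))

/-! ### Smooth forms and the exterior derivative -/

section Forms

set_option linter.unusedSectionVars false

variable {E : Type*} [NormedAddCommGroup E] [NormedSpace ℝ E]
variable {H : Type*} [TopologicalSpace H] {I : ModelWithCorners ℝ E H}
variable {M : Type*} [TopologicalSpace M] [ChartedSpace H M]
variable {F : Type*} [NormedAddCommGroup F] [NormedSpace ℝ F]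

/-- A form as a function with values in a fixed space. -/
def DForm.toFun {p : ℕ} (α : DForm I M F p) : M → E [⋀^Fin p]→L[ℝ] F := α

/-- The derivative of the inverse of a preferred chart, as an endomorphism of the model space. -/
def symmDeriv (I : ModelWithCorners ℝ E H) (x₀ : M) (y : E) : E →L[ℝ] E :=
  mfderiv 𝓘(ℝ, E) I (extChartAt I x₀).symm y

lemma inChart_apply {p : ℕ} (x₀ : M) (α : DForm I M F p) (y : E) (v : Fin p → E) :
    inChart x₀ α y v = α ((extChartAt I x₀).symm y)
      (fun i => mfderiv 𝓘(ℝ, E) I (extChartAt I x₀).symm y (v i)) := rfl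

lemma inChart_add {p : ℕ} (x₀ : M) (α β : DForm I M F p) :
    inChart x₀ (α + β) = inChart x₀ α + inChart x₀ β := rfl

lemma inChart_smul {p : ℕ} (x₀ : M) (a : ℂ) (α : DForm I M ℂ p) :
    inChart x₀ (a • α) = a • inChart x₀ α := rfl

lemma inChart_zero {p : ℕ} (x₀ : M) : inChart x₀ (0 : DForm I M F p) = 0 := rfl

lemma IsSmoothForm.add {p : ℕ} {α β : DForm I M F p} (hα : IsSmoothForm α) (hβ : IsSmoothForm β) :
    IsSmoothForm (α + β) := fun x₀ => by
  rw [inChart_add]; exact (hα x₀).add (hβ x₀)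

lemma IsSmoothForm.smul {p : ℕ} {α : DForm I M ℂ p} (hα : IsSmoothForm α) (a : ℂ) :
    IsSmoothForm (a • α) := fun x₀ => by
  rw [inChart_smul]; exact contDiffOn_const.smul (hα x₀)

lemma isSmoothForm_zero {p : ℕ} : IsSmoothForm (0 : DForm I M F p) := fun x₀ => by
  rw [inChart_zero]; exact contDiffOn_const

variable [I.Boundaryless]

lemma IsSmoothForm.contDiffAt {p : ℕ} {α : DForm I M F p} (hα : IsSmoothForm α) (x₀ : M) {y : E}
    (hy : y ∈ (extChartAt I x₀).target) : ContDiffAt ℝ ∞ (inChart x₀ α) y :=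
  (hα x₀).contDiffAt ((isOpen_extChartAt_target x₀).mem_nhds hy)

lemma IsSmoothForm.differentiableAt {p : ℕ} {α : DForm I M F p} (hα : IsSmoothForm α) (x₀ : M)
    {y : E} (hy : y ∈ (extChartAt I x₀).target) : DifferentiableAt ℝ (inChart x₀ α) y :=
  (hα.contDiffAt x₀ hy).differentiableAt (by simp)

variable [IsManifold I ∞ M]

lemma mdifferentiableAt_extChartAt_symm (x₀ : M) {y : E} (hy : y ∈ (extChartAt I x₀).target) :
    MDifferentiableAt 𝓘(ℝ, E) I (extChartAt I x₀).symm y := by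
  have := mdifferentiableWithinAt_extChartAt_symm (I := I) hy
  rwa [I.range_eq_univ, mdifferentiableWithinAt_univ] at this

/-- The derivative of the preferred chart at its own base point is the identity. -/
lemma extD_eq {p : ℕ} (α : DForm I M F p) (x : M) :
    extD α x = extDeriv (inChart x α) (extChartAt I x x) := by
  have := mfderiv_extChartAt_self (I := I) (x := x)
  rw [extD, this]
  rfl

lemma mfderiv_extChartAt_symm_self (x : M) :
    mfderiv 𝓘(ℝ, E) I (extChartAt I x).symm (extChartAt I x x) = ContinuousLinearMap.id ℝ E := by
  have := mfderivWithin_range_extChartAt_symm (I := I) (x := x)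
  rwa [I.range_eq_univ, mfderivWithin_univ] at this

lemma inChart_self {p : ℕ} (x : M) (α : DForm I M F p) :
    inChart x α (extChartAt I x x) = α x := by
  rw [inChart, mfderiv_extChartAt_symm_self]
  exact congrArg (DForm.toFun α) (extChartAt_to_inv x)

/-- The transition map between two preferred charts. -/
def chartChange (I : ModelWithCorners ℝ E H) (x₁ x₀ : M) (y : E) : E :=
  extChartAt I x₀ ((extChartAt I x₁).symm y)

lemma eventually_mem_overlap (x₁ x₀ : M) {y : E} (hy : y ∈ (extChartAt I x₁).target)
    (hy' : (extChartAt I x₁).symm y ∈ (extChartAt I x₀).source) :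
    ∀ᶠ z in 𝓝 y, z ∈ (extChartAt I x₁).target ∧
      (extChartAt I x₁).symm z ∈ (extChartAt I x₀).source :=
  ((isOpen_extChartAt_target x₁).mem_nhds hy) |> fun h => Filter.Eventually.and h
    ((mdifferentiableAt_extChartAt_symm x₁ hy).continuousAt.eventually
      ((isOpen_extChartAt_source x₀).mem_nhds hy'))

lemma contDiffAt_chartChange (x₁ x₀ : M) {y : E} (hy : y ∈ (extChartAt I x₁).target)
    (hy' : (extChartAt I x₁).symm y ∈ (extChartAt I x₀).source) :
    ContDiffAt ℝ ∞ (chartChange I x₁ x₀) y := by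
  have := contDiffWithinAt_ext_coord_change (I := I) (n := ∞) x₀ x₁ (y := y) (by
    rw [PartialEquiv.trans_source]
    exact ⟨hy, hy'⟩)
  rwa [I.range_eq_univ, contDiffWithinAt_univ] at this

lemma fderiv_chartChange (x₁ x₀ : M) {y : E} (hy : y ∈ (extChartAt I x₁).target)
    (hy' : (extChartAt I x₁).symm y ∈ (extChartAt I x₀).source) :
    fderiv ℝ (chartChange I x₁ x₀) y = (mfderiv I 𝓘(ℝ, E) (extChartAt I x₀)
      ((extChartAt I x₁).symm y)).comp (mfderiv 𝓘(ℝ, E) I (extChartAt I x₁).symm y) := by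
  rw [← mfderiv_eq_fderiv]
  refine mfderiv_comp (I' := I) y ?_ (mdifferentiableAt_extChartAt_symm x₁ hy)
  exact mdifferentiableAt_extChartAt (by rwa [← extChartAt_source (I := I)])

lemma inChart_eq_pullback {p : ℕ} (x₁ x₀ : M) (α : DForm I M F p) {y : E}
    (hy : y ∈ (extChartAt I x₁).target)
    (hy' : (extChartAt I x₁).symm y ∈ (extChartAt I x₀).source) :
    inChart x₁ α y = (inChart x₀ α (chartChange I x₁ x₀ y)).compContinuousLinearMap
      (fderiv ℝ (chartChange I x₁ x₀) y) := by
  have h1 : symmDeriv I x₁ y = (symmDeriv I x₀ (chartChange I x₁ x₀ y)).comp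
        (fderiv ℝ (chartChange I x₁ x₀) y) := by
    have h2 : (extChartAt I x₁).symm =ᶠ[𝓝 y] (extChartAt I x₀).symm ∘ chartChange I x₁ x₀ := by
      filter_upwards [eventually_mem_overlap x₁ x₀ hy hy'] with z hz
      exact ((extChartAt I x₀).left_inv hz.2).symm
    rw [← mfderiv_eq_fderiv]
    refine h2.mfderiv_eq.trans (mfderiv_comp y ?_ ?_)
    · exact mdifferentiableAt_extChartAt_symm x₀ ((extChartAt I x₀).map_source hy')
    · exact ((contDiffAt_chartChange x₁ x₀ hy hy').differentiableAt (by simp)).mdifferentiableAt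
  have h3 : (extChartAt I x₁).symm y = (extChartAt I x₀).symm (chartChange I x₁ x₀ y) :=
    ((extChartAt I x₀).left_inv hy').symm
  change (DForm.toFun α _).compContinuousLinearMap (symmDeriv I x₁ y) = _
  rw [h1, h3]
  rfl

/-- The exterior derivative is computed in an arbitrary preferred chart. -/
lemma inChart_extD {p : ℕ} {α : DForm I M F p} (hα : IsSmoothForm α) (x₀ : M) {y : E}
    (hy : y ∈ (extChartAt I x₀).target) :
    inChart x₀ (extD α) y = extDeriv (inChart x₀ α) y := by
  set x := (extChartAt I x₀).symm y with hx
  have hxs : (extChartAt I x₀).symm y ∈ (extChartAt I x).source := mem_extChartAt_source x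
  have h1 : inChart x₀ α =ᶠ[𝓝 y] fun z => (inChart x α (chartChange I x₀ x z)).compContinuousLinearMap
      (fderiv ℝ (chartChange I x₀ x) z) := by
    filter_upwards [eventually_mem_overlap x₀ x hy hxs] with z hz
    exact inChart_eq_pullback x₀ x α hz.1 hz.2
  -- Naturality under the transition map from the chart at `x₀` to the preferred chart at `x`, in
  -- which `extD` at `x` is computed.
  rw [h1.extDeriv_eq, extDeriv_pullback (f := chartChange I x₀ x) (r := ∞)
    (hα.differentiableAt x ((extChartAt I x).map_source hxs))
    (contDiffAt_chartChange x₀ x hy hxs) two_le_infty, fderiv_chartChange x₀ x hy hxs]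
  rfl

lemma ContDiffOn.extDeriv {p : ℕ} {η : E → E [⋀^Fin p]→L[ℝ] F} {s : Set E} (hs : IsOpen s)
    (h : ContDiffOn ℝ ∞ η s) : ContDiffOn ℝ ∞ (_root_.extDeriv η) s :=
  (ContinuousAlternatingMap.alternatizeUncurryFinCLM ℝ E F).contDiff.comp_contDiffOn
    (h.fderiv_of_isOpen hs (by simp))

lemma IsSmoothForm.extD {p : ℕ} {α : DForm I M F p} (hα : IsSmoothForm α) :
    IsSmoothForm (extD α) := fun x₀ =>
  (ContDiffOn.extDeriv (isOpen_extChartAt_target x₀) (hα x₀)).congr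
    fun _ hy => inChart_extD hα x₀ hy

lemma extD_extD {p : ℕ} {α : DForm I M F p} (hα : IsSmoothForm α) : PoincareEinstein.extD (extD α) = 0 := by
  funext x
  have hx : extChartAt I x x ∈ (extChartAt I x).target := mem_extChartAt_target x
  have h1 : inChart x (PoincareEinstein.extD α) =ᶠ[𝓝 (extChartAt I x x)] extDeriv (inChart x α) := by
    filter_upwards [(isOpen_extChartAt_target x).mem_nhds hx] with y hy
    exact inChart_extD hα x hy
  rw [extD_eq, h1.extDeriv_eq]
  exact extDeriv_extDeriv_apply (r := ∞) (hα.contDiffAt x hx) two_le_infty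

lemma extD_add {p : ℕ} {α β : DForm I M F p} (hα : IsSmoothForm α) (hβ : IsSmoothForm β) :
    PoincareEinstein.extD (α + β) = PoincareEinstein.extD α + PoincareEinstein.extD β := by
  funext x
  have hx : extChartAt I x x ∈ (extChartAt I x).target := mem_extChartAt_target x
  rw [Pi.add_apply, extD_eq, extD_eq, extD_eq, inChart_add]
  exact extDeriv_add (hα.differentiableAt x hx) (hβ.differentiableAt x hx)

lemma extDeriv_complex_smul {p : ℕ} {η : E → E [⋀^Fin p]→L[ℝ] ℂ} (a : ℂ) {y : E}
    (h : DifferentiableAt ℝ η y) : extDeriv (a • η) y = a • extDeriv η y := by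
  ext v
  rw [ContinuousAlternatingMap.smul_apply, extDeriv, extDeriv, fderiv_const_smul h,
    ContinuousAlternatingMap.alternatizeUncurryFin_apply,
    ContinuousAlternatingMap.alternatizeUncurryFin_apply, Finset.smul_sum]
  refine Finset.sum_congr rfl fun i _ => ?_
  rw [smul_comm a]
  rfl

lemma extD_smul {p : ℕ} {α : DForm I M ℂ p} (a : ℂ) (hα : IsSmoothForm α) :
    PoincareEinstein.extD (a • α) = a • PoincareEinstein.extD α := by
  funext x
  have hx : extChartAt I x x ∈ (extChartAt I x).target := mem_extChartAt_target x
  rw [Pi.smul_apply, extD_eq, extD_eq, inChart_smul]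
  exact extDeriv_complex_smul a (hα.differentiableAt x hx)

lemma extD_zero {p : ℕ} : PoincareEinstein.extD (0 : DForm I M F p) = 0 := by
  funext x
  have h : fderiv ℝ (0 : E → E [⋀^Fin p]→L[ℝ] F) (extChartAt I x x) = 0 := fderiv_const_apply 0
  rw [extD_eq, inChart_zero, extDeriv, h]
  exact map_zero (ContinuousAlternatingMap.alternatizeUncurryFinCLM ℝ E F)

end Forms

/-- Smoothness of families of alternating maps on a finite-dimensional space can be checked on
vectors. -/
lemma contDiffOn_of_apply {E E' F : Type*} [NormedAddCommGroup E] [NormedSpace ℝ E]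
    [FiniteDimensional ℝ E] [NormedAddCommGroup F] [NormedSpace ℝ F] [FiniteDimensional ℝ F]
    [NormedAddCommGroup E'] [NormedSpace ℝ E'] {p : ℕ} {f : E' → E [⋀^Fin p]→L[ℝ] F} {s : Set E'}
    (h : ∀ v, ContDiffOn ℝ ∞ (fun y => f y v) s) : ContDiffOn ℝ ∞ f s := by
  let b := Module.finBasis ℝ E
  let T : (E [⋀^Fin p]→L[ℝ] F) →ₗ[ℝ] ((Fin p → Fin (Module.finrank ℝ E)) → F) :=
    { toFun := fun η i => η fun k => b (i k)
      map_add' := fun _ _ => rfl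
      map_smul' := fun _ _ => rfl }
  have hT : LinearMap.ker T = ⊥ := by
    rw [LinearMap.ker_eq_bot]
    intro η η' hη
    apply ContinuousAlternatingMap.toAlternatingMap_injective
    exact b.ext_alternating fun v _ => congrFun hη v
  -- An alternating map is recovered linearly, hence smoothly, from its finitely many values on
  -- basis vectors.
  obtain ⟨S, hS⟩ := T.exists_leftInverse_of_injective hT
  have hf : f = fun y => S.toContinuousLinearMap (fun i => f y fun k => b (i k)) := by
    funext y
    exact (LinearMap.congr_fun hS (f y)).symm
  rw [hf]
  exact S.toContinuousLinearMap.contDiff.comp_contDiffOn (contDiffOn_pi.2 fun i => h _)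

/-! ### The Hodge star and the codifferential of a Riemannian manifold -/

section Metric

open Bundle

set_option linter.unusedSectionVars false

variable {n : ℕ} {M : Type*} [TopologicalSpace M] [ChartedSpace (EuclideanSpace ℝ (Fin n)) M]
  [IsManifold (𝓡 n) ∞ M]

/-- In the trivialization at `x₀` this section is constant. -/
lemma contMDiffAt_symmL (x₀ : M) (w : EuclideanSpace ℝ (Fin n)) {z : M}
    (hz : z ∈ (chartAt (EuclideanSpace ℝ (Fin n)) x₀).source) :
    ContMDiffAt (𝓡 n) ((𝓡 n).prod 𝓘(ℝ, EuclideanSpace ℝ (Fin n))) ∞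
      (fun z : M => TotalSpace.mk' (EuclideanSpace ℝ (Fin n)) z
        ((trivializationAt (EuclideanSpace ℝ (Fin n)) (TangentSpace (𝓡 n)) x₀).symmL ℝ z w)) z := by
  have hz' : z ∈ (trivializationAt (EuclideanSpace ℝ (Fin n))
      (TangentSpace (𝓡 n) : M → Type _) x₀).baseSet := hz
  rw [Trivialization.contMDiffAt_section_iff _ hz']
  refine (contMDiffAt_const (c := w)).congr_of_eventuallyEq ?_
  filter_upwards [(trivializationAt (EuclideanSpace ℝ (Fin n))
      (TangentSpace (𝓡 n) : M → Type _) x₀).open_baseSet.mem_nhds hz'] with y hy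
  have := Trivialization.continuousLinearMapAt_symmL (R := ℝ) (trivializationAt
    (EuclideanSpace ℝ (Fin n)) (TangentSpace (𝓡 n) : M → Type _) x₀) hy w
  rwa [Trivialization.continuousLinearMapAt_apply_of_mem (R := ℝ) _ hy] at this

/-- The coordinate vector fields are the smooth sections of the previous lemma, because the inverse
trivialization at `x₀` is the derivative of the inverse chart. -/
lemma contDiffOn_metric (h : RMetric n M) (x₀ : M) (u v : EuclideanSpace ℝ (Fin n)) :
    ContDiffOn ℝ ∞ (fun y => h.toFun ((extChartAt (𝓡 n) x₀).symm y)
      (symmDeriv (𝓡 n) x₀ y u) (symmDeriv (𝓡 n) x₀ y v)) (extChartAt (𝓡 n) x₀).target := by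
  set e := trivializationAt (EuclideanSpace ℝ (Fin n)) (TangentSpace (𝓡 n) : M → Type _) x₀
  have h1 : ContMDiffOn (𝓡 n) 𝓘(ℝ, ℝ) ∞
      (fun z => h.inner z (e.symmL ℝ z u) (e.symmL ℝ z v)) (chartAt (EuclideanSpace ℝ (Fin n)) x₀).source := by
    intro z hz
    refine ContMDiffAt.contMDiffWithinAt ?_
    have : ContMDiffAt (𝓡 n) ((𝓡 n).prod 𝓘(ℝ)) ∞
        (fun m ↦ TotalSpace.mk' ℝ (E := Bundle.Trivial M ℝ) m
          (h.inner m (e.symmL ℝ m u) (e.symmL ℝ m v))) z := by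
      apply ContMDiffAt.clm_bundle_apply₂ (F₁ := EuclideanSpace ℝ (Fin n))
        (F₂ := EuclideanSpace ℝ (Fin n))
      · exact h.contMDiff z
      · exact contMDiffAt_symmL x₀ u hz
      · exact contMDiffAt_symmL x₀ v hz
    simp only [contMDiffAt_totalSpace] at this
    exact this.2
  have h2 := h1.comp (contMDiffOn_extChartAt_symm (I := 𝓡 n) (n := ∞) x₀) (fun y hy => by
    rw [← extChartAt_source (I := 𝓡 n)]
    exact (extChartAt (𝓡 n) x₀).map_target hy)
  refine (contMDiffOn_iff_contDiffOn.1 h2).congr fun y hy => ?_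
  have hy' : (extChartAt (𝓡 n) x₀).symm y ∈ (chartAt (EuclideanSpace ℝ (Fin n)) x₀).source := by
    rw [← extChartAt_source (I := 𝓡 n)]
    exact (extChartAt (𝓡 n) x₀).map_target hy
  have h3 := TangentBundle.symmL_trivializationAt (I := 𝓡 n) (𝕜 := ℝ) hy'
  rw [(extChartAt (𝓡 n) x₀).right_inv hy, (𝓡 n).range_eq_univ, mfderivWithin_univ] at h3
  simp only [Function.comp_apply]
  change h.inner _ _ _ = h.inner _ (e.symmL ℝ ((extChartAt (𝓡 n) x₀).symm y) u) (e.symmL ℝ _ v)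
  rw [h3]
  rfl

/-- The metric at a point as a bilinear form. -/
def RMetric.bilin (h : RMetric n M) (x : M) :
    TangentSpace (𝓡 n) x →ₗ[ℝ] TangentSpace (𝓡 n) x →ₗ[ℝ] ℝ :=
  LinearMap.mk₂ ℝ (h.toFun x) (fun _ _ _ => by simp [RMetric.toFun])
    (fun _ _ _ => by simp [RMetric.toFun]) (fun _ _ _ => by simp [RMetric.toFun])
    (fun _ _ _ => by simp [RMetric.toFun])

lemma RMetric.toFun_eq_bilin (h : RMetric n M) (x : M) (u v : TangentSpace (𝓡 n) x) :
    h.toFun x u v = h.bilin x u v := rfl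

lemma finrank_tangentSpace (x : M) : Module.finrank ℝ (TangentSpace (𝓡 n) x) = n :=
  finrank_euclideanSpace_fin (𝕜 := ℝ)

lemma exists_frame (h : RMetric n M) (x : M) :
    ∃ e : Fin n → TangentSpace (𝓡 n) x, IsOrthonormalFrame (h.toFun x) e := by
  have : FiniteDimensional ℝ (TangentSpace (𝓡 n) x) :=
    inferInstanceAs (FiniteDimensional ℝ (EuclideanSpace ℝ (Fin n)))
  exact exists_orthonormalFrame (h.toFun_eq_bilin x) (fun u v => h.symm x u v)
    (fun u hu => h.pos x u hu) (finrank_tangentSpace x)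

/-- The coordinate basis of a tangent space. -/
def coordBasis (x₀ : M) {y : EuclideanSpace ℝ (Fin n)} (hy : y ∈ (extChartAt (𝓡 n) x₀).target) :
    Module.Basis (Fin n) ℝ (TangentSpace (𝓡 n) ((extChartAt (𝓡 n) x₀).symm y)) :=
  have h := isInvertible_mfderivWithin_extChartAt_symm (I := 𝓡 n) hy
  (EuclideanSpace.basisFun (Fin n) ℝ).toBasis.map h.choose.toLinearEquiv

lemma coordBasis_apply (x₀ : M) {y : EuclideanSpace ℝ (Fin n)}
    (hy : y ∈ (extChartAt (𝓡 n) x₀).target) (i : Fin n) :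
    coordBasis x₀ hy i = symmDeriv (𝓡 n) x₀ y (EuclideanSpace.single i 1) := by
  have h2 := (isInvertible_mfderivWithin_extChartAt_symm (I := 𝓡 n) hy).choose_spec
  have h1 : mfderivWithin 𝓘(ℝ, EuclideanSpace ℝ (Fin n)) (𝓡 n) (extChartAt (𝓡 n) x₀).symm
      (range (𝓡 n)) y = symmDeriv (𝓡 n) x₀ y := by
    rw [(𝓡 n).range_eq_univ, mfderivWithin_univ]
    rfl
  have h3 := DFunLike.congr_fun (h2.trans h1) (EuclideanSpace.basisFun (Fin n) ℝ i)
  rw [EuclideanSpace.basisFun_apply] at h3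
  refine Eq.trans ?_ h3
  rw [← EuclideanSpace.basisFun_apply]
  rfl

/-- By Cramer's rule the entries are quotients of determinants. -/
lemma contDiffOn_inv_matrix {E' : Type*} [NormedAddCommGroup E'] [NormedSpace ℝ E'] {s : Set E'}
    {G : E' → Matrix (Fin n) (Fin n) ℝ} (hG : ∀ i j, ContDiffOn ℝ ∞ (fun y => G y i j) s)
    (hdet : ∀ y ∈ s, (G y).det ≠ 0) (i j : Fin n) : ContDiffOn ℝ ∞ (fun y => (G y)⁻¹ i j) s := by
  have hd : ∀ A : E' → Matrix (Fin n) (Fin n) ℝ, (∀ i j, ContDiffOn ℝ ∞ (fun y => A y i j) s) →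
      ContDiffOn ℝ ∞ (fun y => (A y).det) s := by
    intro A hA
    simp only [Matrix.det_apply]
    refine ContDiffOn.sum fun σ _ => ?_
    refine ContDiffOn.const_smul _ ?_
    exact contDiffOn_prod fun k _ => hA _ _
  simp only [Matrix.inv_def, Matrix.smul_apply, Ring.inverse_eq_inv', smul_eq_mul,
    Matrix.adjugate_apply]
  refine ((hd G hG).inv hdet).mul (hd _ fun a b => ?_)
  by_cases hab : a = j
  · subst hab
    simpa using contDiffOn_const
  · simpa [Matrix.updateRow_ne hab] using hG a b

/-- The Hodge star of a form on an oriented Riemannian manifold. -/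
def starForm (h : RMetric n M) (vol : DForm (𝓡 n) M ℝ n) {p q : ℕ} (hpq : p + q = n)
    (α : DForm (𝓡 n) M ℂ p) : DForm (𝓡 n) M ℂ q :=
  fun z => hodgeStar hpq (h.toFun z) (vol z) (α z)

/-- A kernel vector of the Gram matrix yields a nonzero `u` orthogonal to the whole basis,
contradicting `B u u > 0`. -/
lemma det_gram_ne_zero {V : Type*} [AddCommGroup V] [Module ℝ V]
    {g : V → V → ℝ} {B : V →ₗ[ℝ] V →ₗ[ℝ] ℝ} (hg : ∀ u v, g u v = B u v)
    (hpos : ∀ u, u ≠ 0 → 0 < B u u) (b : Module.Basis (Fin n) ℝ V) :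
    (Matrix.of fun x y => g (b x) (b y)).det ≠ 0 := by
  intro h0
  obtain ⟨v, hv, hGv⟩ := Matrix.exists_mulVec_eq_zero_iff.2 h0
  set u := ∑ i, v i • b i with hu
  have hu0 : u ≠ 0 := by
    intro hu'
    apply hv
    funext i
    exact Fintype.linearIndependent_iff.1 b.linearIndependent v hu' i
  have h1 : ∀ i, B (b i) u = 0 := by
    intro i
    have := congrFun hGv i
    simp only [Matrix.mulVec, dotProduct, Matrix.of_apply, hg, Pi.zero_apply] at this
    rw [hu, map_sum, ← this]
    exact Finset.sum_congr rfl fun j _ => by simp [mul_comm]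
  have h2 : B u u = 0 := by
    have : B u u = ∑ i, B (v i • b i) u := by
      conv_lhs => enter [1]; rw [hu, map_sum]
      rw [LinearMap.sum_apply]
    rw [this]
    refine Finset.sum_eq_zero fun i _ => ?_
    rw [map_smul, LinearMap.smul_apply, h1, smul_zero]
  exact (hpos u hu0).ne' h2

lemma insertFirst_inChart (vol : DForm (𝓡 n) M ℝ n) {p q : ℕ} (hpq : p + q = n) (x₀ : M)
    (y : EuclideanSpace ℝ (Fin n)) (w : Fin p → EuclideanSpace ℝ (Fin n))
    (v : Fin q → EuclideanSpace ℝ (Fin n)) :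
    insertFirst hpq (inChart x₀ vol y) w v =
      insertFirst hpq (vol ((extChartAt (𝓡 n) x₀).symm y))
        (fun k => symmDeriv (𝓡 n) x₀ y (w k)) (fun k => symmDeriv (𝓡 n) x₀ y (v k)) := by
  exact congrArg (DForm.toFun vol _) (funext fun k => map_append_cast (symmDeriv (𝓡 n) x₀ y) hpq w v k)

/-- The frames in the definition of the star are chosen pointwise, with no regularity. Smoothness is
visible only in the formula through the inverse Gram matrix of the coordinate basis. -/
lemma IsSmoothForm.starForm {h : RMetric n M} {vol : DForm (𝓡 n) M ℝ n} (hvol : IsSmoothForm vol)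
    {p q : ℕ} (hpq : p + q = n) {α : DForm (𝓡 n) M ℂ p} (hα : IsSmoothForm α) :
    IsSmoothForm (starForm h vol hpq α) := by
  intro x₀
  apply contDiffOn_of_apply
  intro v
  have happ : ∀ {F : Type} [NormedAddCommGroup F] [NormedSpace ℝ F] {k : ℕ}
      {f : EuclideanSpace ℝ (Fin n) → (EuclideanSpace ℝ (Fin n)) [⋀^Fin k]→L[ℝ] F} {s : Set _}
      (_ : ContDiffOn ℝ ∞ f s) (w), ContDiffOn ℝ ∞ (fun y => f y w) s := by
    intro F _ _ k f s hf w
    exact (ContinuousAlternatingMap.apply ℝ _ F w).contDiff.comp_contDiffOn hf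
  set G : EuclideanSpace ℝ (Fin n) → Matrix (Fin n) (Fin n) ℝ := fun y => Matrix.of fun a b =>
    h.toFun ((extChartAt (𝓡 n) x₀).symm y) (symmDeriv (𝓡 n) x₀ y (EuclideanSpace.single a 1))
      (symmDeriv (𝓡 n) x₀ y (EuclideanSpace.single b 1)) with hG
  have hGe : ∀ (y) (hy : y ∈ (extChartAt (𝓡 n) x₀).target), G y = Matrix.of fun a b =>
      h.toFun ((extChartAt (𝓡 n) x₀).symm y) (coordBasis x₀ hy a) (coordBasis x₀ hy b) := by
    intro y hy
    simp only [coordBasis_apply]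
    rfl
  have hGinv := contDiffOn_inv_matrix (G := G) (fun i j => contDiffOn_metric h x₀ _ _)
    (fun y hy => by
      rw [hGe y hy]
      exact det_gram_ne_zero (h.toFun_eq_bilin _) (fun u hu => h.pos _ u hu) _)
  have key : ContDiffOn ℝ ∞ (fun y => ((p.factorial : ℝ)⁻¹) • ∑ a : Fin p → Fin n,
      ∑ a' : Fin p → Fin n, ((∏ k, (G y)⁻¹ (a k) (a' k)) *
        inChart x₀ vol y (fun k => Fin.append (fun k => EuclideanSpace.single (a' k) (1 : ℝ)) v
          (Fin.cast hpq.symm k))) •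
        inChart x₀ α y (fun k => EuclideanSpace.single (a k) (1 : ℝ)))
      (extChartAt (𝓡 n) x₀).target := by
    refine ContDiffOn.const_smul _ (ContDiffOn.sum fun a _ => ContDiffOn.sum fun a' _ => ?_)
    refine ContDiffOn.smul (ContDiffOn.mul (contDiffOn_prod fun k _ => hGinv _ _) ?_) ?_
    · exact happ (hvol x₀) _
    · exact happ (hα x₀) _
  refine key.congr fun y hy => ?_
  rw [inChart_apply, PoincareEinstein.starForm,
    hodgeStar_apply_basis (h.toFun_eq_bilin _) hpq _ _ (exists_frame h _) (coordBasis x₀ hy),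
    ← hGe y hy]
  refine congrArg _ (Finset.sum_congr rfl fun a _ => Finset.sum_congr rfl fun a' _ => ?_)
  have e1 := insertFirst_inChart vol hpq x₀ y (fun k => EuclideanSpace.single (a' k) (1 : ℝ)) v
  rw [insertFirst_apply] at e1
  rw [e1]
  simp only [coordBasis_apply]
  rfl

lemma starForm_add (h : RMetric n M) (vol : DForm (𝓡 n) M ℝ n) {p q : ℕ} (hpq : p + q = n)
    (α β : DForm (𝓡 n) M ℂ p) :
    starForm h vol hpq (α + β) = starForm h vol hpq α + starForm h vol hpq β :=
  funext fun _ => hodgeStar_add _ _ _ _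

lemma starForm_smul (h : RMetric n M) (vol : DForm (𝓡 n) M ℝ n) {p q : ℕ} (hpq : p + q = n)
    (a : ℂ) (α : DForm (𝓡 n) M ℂ p) :
    starForm h vol hpq (a • α) = a • starForm h vol hpq α :=
  funext fun _ => hodgeStar_smul _ _ _ _

lemma starForm_zero (h : RMetric n M) (vol : DForm (𝓡 n) M ℝ n) {p q : ℕ} (hpq : p + q = n) :
    starForm h vol hpq (0 : DForm (𝓡 n) M ℂ p) = 0 :=
  funext fun _ => hodgeStar_zero _ _

lemma starForm_starForm (hn : n ≠ 0) {h : RMetric n M} {vol : DForm (𝓡 n) M ℝ n}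
    (hvol : IsVolumeForm h.toFun vol) {p q : ℕ} (hpq : p + q = n) (hqp : q + p = n)
    (α : DForm (𝓡 n) M ℂ p) :
    starForm h vol hqp (starForm h vol hpq α) = ((-1 : ℂ) ^ (p * q)) • α := by
  funext z
  obtain ⟨e, he⟩ := exists_frame h z
  exact hodgeStar_hodgeStar (h.toFun_eq_bilin z) hn (finrank_tangentSpace z) hpq hqp (vol z) (α z)
    he (hvol.2 z)

end Metric

/-! ### The codifferential of `h`: smoothness, linearity and `δδ = 0`. -/

section Codiff

/-- Replaces the truncated difference `N - (p + 1)` by a free complementary degree `q`. -/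
lemma codiffSucc_apply {E : Type*} [NormedAddCommGroup E] [NormedSpace ℝ E] {H : Type*}
    [TopologicalSpace H] {I : ModelWithCorners ℝ E H} {M : Type*} [TopologicalSpace M]
    [ChartedSpace H M] {N : ℕ} (g : ∀ x : M, TangentSpace I x → TangentSpace I x → ℝ)
    (vol : DForm I M ℝ N) {p q : ℕ} (h : p + 1 + q = N) (α : DForm I M ℂ (p + 1)) (x : M) :
    codiffSucc g vol α x = ((-1 : ℂ) ^ (p + 1 + p * (q + 1))) •
      hodgeStar (p := q + 1) (q := p) (by omega) (g x) (vol x)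
        (extD (fun z => hodgeStar (p := p + 1) (q := q) h (g z) (vol z) (α z)) x) := by
  obtain rfl : q = N - (p + 1) := by omega
  have h1 : p + 1 ≤ N := by omega
  rw [codiffSucc, dif_pos h1, show N - p = N - (p + 1) + 1 by omega]

lemma codiffSucc_of_lt {E : Type*} [NormedAddCommGroup E] [NormedSpace ℝ E] {H : Type*}
    [TopologicalSpace H] {I : ModelWithCorners ℝ E H} {M : Type*} [TopologicalSpace M]
    [ChartedSpace H M] {N : ℕ} (g : ∀ x : M, TangentSpace I x → TangentSpace I x → ℝ)
    (vol : DForm I M ℝ N) {p : ℕ} (h : ¬ p + 1 ≤ N) (α : DForm I M ℂ (p + 1)) :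
    codiffSucc g vol α = 0 := by
  rw [codiffSucc, dif_neg h]

set_option linter.unusedSectionVars false

variable {n : ℕ} {M : Type*} [TopologicalSpace M] [ChartedSpace (EuclideanSpace ℝ (Fin n)) M]
  [IsManifold (𝓡 n) ∞ M] {h : RMetric n M} {vol : DForm (𝓡 n) M ℝ n}

lemma codiffSucc_eq_starForm {p q : ℕ} (hpq : p + 1 + q = n) (hqp : q + 1 + p = n)
    (α : DForm (𝓡 n) M ℂ (p + 1)) :
    codiffSucc h.toFun vol α = ((-1 : ℂ) ^ (p + 1 + p * (q + 1))) •
      starForm h vol hqp (extD (starForm h vol hpq α)) :=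
  funext fun x => codiffSucc_apply h.toFun vol hpq α x

lemma IsSmoothForm.codiffSucc (hvol : IsSmoothForm vol) {p : ℕ} {α : DForm (𝓡 n) M ℂ (p + 1)}
    (hα : IsSmoothForm α) : IsSmoothForm (codiffSucc h.toFun vol α) := by
  by_cases hp : p + 1 ≤ n
  · obtain ⟨q, hq⟩ := Nat.exists_eq_add_of_le hp
    rw [codiffSucc_eq_starForm hq.symm (by omega)]
    exact ((IsSmoothForm.starForm hvol _ (IsSmoothForm.starForm hvol _ hα).extD)).smul _
  · rw [codiffSucc_of_lt _ _ hp]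
    exact isSmoothForm_zero

lemma codiffSucc_add (hvol : IsSmoothForm vol) {p : ℕ} {α β : DForm (𝓡 n) M ℂ (p + 1)}
    (hα : IsSmoothForm α) (hβ : IsSmoothForm β) :
    PoincareEinstein.codiffSucc h.toFun vol (α + β) =
      PoincareEinstein.codiffSucc h.toFun vol α + PoincareEinstein.codiffSucc h.toFun vol β := by
  by_cases hp : p + 1 ≤ n
  · obtain ⟨q, hq⟩ := Nat.exists_eq_add_of_le hp
    rw [codiffSucc_eq_starForm hq.symm (by omega), codiffSucc_eq_starForm hq.symm (by omega),
      codiffSucc_eq_starForm hq.symm (by omega), starForm_add, extD_add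
      (IsSmoothForm.starForm hvol _ hα) (IsSmoothForm.starForm hvol _ hβ), starForm_add, smul_add]
  · simp [codiffSucc_of_lt _ _ hp]

lemma codiffSucc_smul (hvol : IsSmoothForm vol) {p : ℕ} (a : ℂ) {α : DForm (𝓡 n) M ℂ (p + 1)}
    (hα : IsSmoothForm α) :
    PoincareEinstein.codiffSucc h.toFun vol (a • α) =
      a • PoincareEinstein.codiffSucc h.toFun vol α := by
  by_cases hp : p + 1 ≤ n
  · obtain ⟨q, hq⟩ := Nat.exists_eq_add_of_le hp
    rw [codiffSucc_eq_starForm hq.symm (by omega), codiffSucc_eq_starForm hq.symm (by omega),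
      starForm_smul, extD_smul a (IsSmoothForm.starForm hvol _ hα), starForm_smul, smul_comm]
  · simp [codiffSucc_of_lt _ _ hp]

lemma codiffSucc_zero {p : ℕ} :
    PoincareEinstein.codiffSucc h.toFun vol (0 : DForm (𝓡 n) M ℂ (p + 1)) = 0 := by
  by_cases hp : p + 1 ≤ n
  · obtain ⟨q, hq⟩ := Nat.exists_eq_add_of_le hp
    rw [codiffSucc_eq_starForm hq.symm (by omega), starForm_zero, extD_zero, starForm_zero,
      smul_zero]
  · simp [codiffSucc_of_lt _ _ hp]

/-- Up to sign `⋆d⋆⋆d⋆ = ⋆dd⋆`, which vanishes. -/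
lemma codiffSucc_codiffSucc (hn : n ≠ 0) (hvol : IsVolumeForm h.toFun vol) {p : ℕ}
    {α : DForm (𝓡 n) M ℂ (p + 1 + 1)} (hα : IsSmoothForm α) :
    PoincareEinstein.codiffSucc h.toFun vol (PoincareEinstein.codiffSucc h.toFun vol α) = 0 := by
  by_cases hp : p + 1 + 1 ≤ n
  · obtain ⟨q, hq⟩ := Nat.exists_eq_add_of_le hp
    have hs := (IsSmoothForm.starForm (h := h) hvol.1 hq.symm hα).extD
    rw [codiffSucc_eq_starForm hq.symm (by omega),
      codiffSucc_eq_starForm (q := q + 1) (by omega) (by omega), starForm_smul,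
      starForm_starForm hn hvol (by omega), extD_smul _ (hs.smul _), extD_smul _ hs,
      extD_extD (IsSmoothForm.starForm hvol.1 _ hα), smul_zero, smul_zero, starForm_zero, smul_zero]
  · rw [codiffSucc_of_lt _ _ hp, codiffSucc_zero]

end Codiff

/-! ### The Hodge star of a warped product -/

section Warped

set_option linter.unusedSectionVars false

lemma removeNth_natAdd_append {V : Type*} {p q : ℕ} (w : Fin p → V) (v : Fin (q + 1) → V)
    (j : Fin (q + 1)) :
    (Fin.natAdd p j : Fin (p + q + 1)).removeNth (Fin.append w v : Fin (p + (q + 1)) → V) =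
      Fin.append w (j.removeNth v) := by
  funext l
  refine Fin.addCases (fun l => ?_) (fun l => ?_) l
  · have : (Fin.natAdd p j : Fin (p + q + 1)).succAbove (Fin.castAdd q l) =
        (Fin.castAdd (q + 1) l : Fin (p + (q + 1))) := by
      ext
      have := l.2
      simp only [Fin.succAbove, Fin.lt_def, Fin.val_castSucc, Fin.val_natAdd, Fin.val_castAdd]
      rw [if_pos (by omega)]
      rfl
    rw [Fin.removeNth_apply, this]
    simp
  · have : (Fin.natAdd p j : Fin (p + q + 1)).succAbove (Fin.natAdd p l) =
        (Fin.natAdd p (j.succAbove l) : Fin (p + (q + 1))) := by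
      ext
      simp only [Fin.succAbove, Fin.lt_def, Fin.val_castSucc, Fin.val_natAdd]
      split_ifs <;> simp_all <;> omega
    rw [Fin.removeNth_apply, this]
    simp
    rfl

lemma append_cons_cast {V : Type*} {p q n : ℕ} (h : p + 1 + q = n + 1) (h' : p + q = n) (t : V)
    (w : Fin p → V) (v : Fin q → V) :
    (fun k : Fin (n + 1) => Fin.append (Fin.cons t w : Fin (p + 1) → V) v (Fin.cast h.symm k)) =
      Fin.cons t (fun k : Fin n => Fin.append w v (Fin.cast h'.symm k)) := by
  funext k
  refine Fin.cases ?_ (fun k => ?_) k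
  · simp only [append_eq_dite, Fin.val_cast, Fin.val_zero, Fin.cons_zero]
    simp
  · have hk := k.2
    simp only [append_eq_dite, Fin.val_cast, Fin.val_succ, Fin.cons_succ, Nat.add_lt_add_iff_right,
      Nat.add_sub_add_right]
    split_ifs with h1
    · exact Fin.cons_succ (α := fun _ => V) t w ⟨k, h1⟩
    · rfl

variable {V V' : Type*} [AddCommGroup V] [Module ℝ V] [TopologicalSpace V]
  [AddCommGroup V'] [Module ℝ V'] [TopologicalSpace V'] {n : ℕ}
  {π : V' →L[ℝ] V} {ρ : V' →L[ℝ] ℝ} {ι : V → V'} {t : V'}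

/-- Since `ρ` kills lifted vectors, it can only take one of the last `q + 1` arguments, each
preceded by `p` further places; hence the sign `(-1)^p`. -/
lemma insertFirst_wedge_lift (hπ : ∀ v, π (ι v) = v) (hρ : ∀ v, ρ (ι v) = 0) {p q : ℕ}
    (h : p + (q + 1) = n + 1) (h' : p + q = n) (vol : V [⋀^Fin n]→L[ℝ] ℝ) (w : Fin p → V)
    (v : Fin (q + 1) → V') :
    insertFirst h (wedge ρ (vol.compContinuousLinearMap π)) (fun k => ι (w k)) v =
      (-1) ^ p * wedge ρ ((insertFirst h' vol w).compContinuousLinearMap π) v := by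
  subst h'
  rw [insertFirst_apply, wedge_apply, wedge_apply]
  have e : (fun k => Fin.append (fun k => ι (w k)) v (Fin.cast h.symm k)) =
    (Fin.append (fun k => ι (w k)) v : Fin (p + (q + 1)) → V') := rfl
  rw [e]
  refine (Fin.sum_univ_add (a := p) (b := q + 1) (fun i => (-1 : ℤ) ^ (i : ℕ) •
    ρ ((Fin.append (fun k => ι (w k)) v : Fin (p + (q + 1)) → V') i) •
      (vol.compContinuousLinearMap π) ((i : Fin (p + q + 1)).removeNth
        (Fin.append (fun k => ι (w k)) v : Fin (p + (q + 1)) → V')))).trans ?_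
  rw [Finset.sum_eq_zero (s := Finset.univ (α := Fin p)) fun i _ => ?_, zero_add,
    Finset.mul_sum]
  swap
  · rw [Fin.append_left, hρ, zero_smul, smul_zero]
  refine Finset.sum_congr rfl fun j _ => ?_
  rw [removeNth_natAdd_append, Fin.append_right]
  have e2 : (vol.compContinuousLinearMap π) (Fin.append (fun k => ι (w k)) (j.removeNth v)) =
      ((insertFirst rfl vol w).compContinuousLinearMap π) (j.removeNth v) := by
    refine congrArg vol (funext fun k => ?_)
    refine (map_append_cast π rfl _ _ k).trans ?_
    simp only [hπ]
    rfl
  rw [e2]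
  simp only [Fin.val_natAdd, zsmul_eq_mul, smul_eq_mul]
  push_cast
  ring

/-- In all other terms of the wedge, `t` is an argument of the pulled back form. -/
lemma wedge_cons_of_eq_zero {F : Type*} [NormedAddCommGroup F] [NormedSpace ℝ F]
    (hπt : π t = 0) {k : ℕ} (η : V [⋀^Fin k]→L[ℝ] F)
    (v : Fin k → V') :
    wedge ρ (η.compContinuousLinearMap π) (Fin.cons t v) = ρ t • η (fun i => π (v i)) := by
  rw [wedge_apply, Fin.sum_univ_succ, Finset.sum_eq_zero, add_zero]
  · simp
    rfl
  · intro i _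
    have : (η.compContinuousLinearMap π) ((Fin.succ i).removeNth (Fin.cons t v : Fin (k + 1) → V')) = 0 := by
      rcases k with _ | k
      · exact i.elim0
      · refine η.map_coord_zero (0 : Fin (k + 1)) ?_
        simp [Fin.removeNth_apply, hπt]
    rw [this, smul_zero, smul_zero]

lemma insertFirst_wedge_cons (hπ : ∀ v, π (ι v) = v) (hπt : π t = 0)
    (hρt : ρ t = 1) {p q : ℕ} (h : p + 1 + q = n + 1) (h' : p + q = n) (vol : V [⋀^Fin n]→L[ℝ] ℝ)
    (w : Fin p → V) (v : Fin q → V') :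
    insertFirst h (wedge ρ (vol.compContinuousLinearMap π)) (Fin.cons t fun k => ι (w k)) v =
      ((insertFirst h' vol w).compContinuousLinearMap π) v := by
  rw [insertFirst_apply, append_cons_cast h h', wedge_cons_of_eq_zero hπt, hρt, one_smul]
  refine congrArg vol (funext fun k => ?_)
  refine (map_append_cast π h' _ _ k).trans ?_
  simp only [hπ]
  rfl

lemma insertFirst_insertNth {N : ℕ} {p q : ℕ} (h : p + 1 + q = N) (μ : V [⋀^Fin N]→L[ℝ] ℝ)
    (a : Fin (p + 1)) (x : V) (w : Fin p → V) (v : Fin q → V) :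
    insertFirst h μ (a.insertNth x w) v =
      (-1) ^ (a : ℕ) * insertFirst h μ (Fin.cons x w : Fin (p + 1) → V) v := by
  have h' : q + (p + 1) = N := by omega
  have e : ∀ w : Fin (p + 1) → V,
      insertFirst h μ w v = (-1) ^ ((p + 1) * q) * insertFirst h' μ v w := fun w =>
    map_append_swap h h' μ w v
  rw [e, e, ← ContinuousAlternatingMap.coe_toAlternatingMap, AlternatingMap.map_insertNth]
  simp only [zsmul_eq_mul, Matrix.vecCons]
  push_cast
  ring

lemma insertFirst_smul {N : ℕ} {p q : ℕ} (h : p + q = N) (μ : V [⋀^Fin N]→L[ℝ] ℝ) (c : ℝ)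
    (w : Fin p → V) (v : Fin q → V) :
    insertFirst h μ (fun k => c • w k) v = c ^ p * insertFirst h μ w v := by
  have := (insertLast h μ v).map_smul_univ (fun _ => c) w
  simp only [Finset.prod_const, Finset.card_univ, Fintype.card_fin, smul_eq_mul] at this
  exact this

lemma insertFirst_const_smul {N : ℕ} {p q : ℕ} (h : p + q = N) (μ : V [⋀^Fin N]→L[ℝ] ℝ) (c : ℝ)
    (w : Fin p → V) (v : Fin q → V) :
    insertFirst h (c • μ) w v = c * insertFirst h μ w v := rfl

variable {g : V → V → ℝ} {B : V →ₗ[ℝ] V →ₗ[ℝ] ℝ} {g' : V' → V' → ℝ} {B' : V' →ₗ[ℝ] V' →ₗ[ℝ] ℝ}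

/-- The orthonormal frame of a warped product. -/
def warpedFrame (ι : V → V') (t : V') (r σ : ℝ) (e : Fin n → V) : Fin (n + 1) → V' :=
  Fin.cons (r • t) fun i => σ • ι (e i)

/-- In the frame consisting of `r t` and the `σ ι(e_i)` only tuples avoiding `r t` contribute. One
factor `σ^p` comes from `α` and one from the volume form. -/
lemma hodgeStar_warped_pull (hπ : ∀ v, π (ι v) = v) (hρ : ∀ v, ρ (ι v) = 0) (hπt : π t = 0)
    (hg : ∀ u v, g u v = B u v) (hn : n ≠ 0) (hdim : Module.finrank ℝ V = n)
    (hg' : ∀ u v, g' u v = B' u v) (hdim' : Module.finrank ℝ V' = n + 1)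
    {e : Fin n → V} (he : IsOrthonormalFrame g e) {r σ : ℝ}
    (he' : IsOrthonormalFrame g' (warpedFrame ι t r σ e)) {p q : ℕ} (h : p + (q + 1) = n + 1)
    (h' : p + q = n) (vol : V [⋀^Fin n]→L[ℝ] ℝ) (C : ℝ) (α : V [⋀^Fin p]→L[ℝ] ℂ) :
    hodgeStar h g' (C • wedge ρ (vol.compContinuousLinearMap π)) (α.compContinuousLinearMap π) =
      ((-1 : ℂ) ^ p * (C * σ ^ (2 * p) : ℝ)) •
        wedge ρ ((hodgeStar h' g vol α).compContinuousLinearMap π) := by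
  ext v
  rw [hodgeStar_apply hg' (Nat.succ_ne_zero n) hdim' h _ _ he', ContinuousAlternatingMap.smul_apply,
    wedge_apply]
  have hw : ∀ j : Fin (q + 1), ((hodgeStar h' g vol α).compContinuousLinearMap π) (j.removeNth v) =
      ((p.factorial : ℝ)⁻¹) • ∑ i : Fin p → Fin n,
      (((insertFirst h' vol (fun k => e (i k))).compContinuousLinearMap π) (j.removeNth v)) •
        α (fun k => e (i k)) := fun j =>
    hodgeStar_apply hg hn hdim h' vol α he (fun a => π (j.removeNth v a))
  simp only [hw]
  have hs : ∑ i : Fin p → Fin (n + 1),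
      insertFirst h (C • wedge ρ (vol.compContinuousLinearMap π))
        (fun k => warpedFrame ι t r σ e (i k)) v •
        (α.compContinuousLinearMap π) (fun k => warpedFrame ι t r σ e (i k)) =
      ∑ i : Fin p → Fin n, ((-1) ^ p * (C * σ ^ (2 * p)) *
        wedge ρ ((insertFirst h' vol (fun k => e (i k))).compContinuousLinearMap π) v) •
        α (fun k => e (i k)) := by
    symm
    refine Fintype.sum_of_injective (fun i k => (i k).succ) (fun i j hij => funext fun k =>
      Fin.succ_injective _ (congrFun hij k)) _ _ ?_ ?_
    · intro i hi
      have : ∃ k, i k = 0 := by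
        by_contra hc
        push Not at hc
        exact hi ⟨fun k => (i k).pred (hc k), funext fun k => by simp⟩
      obtain ⟨k, hk⟩ := this
      have : (α.compContinuousLinearMap π) (fun k => warpedFrame ι t r σ e (i k)) = 0 :=
        α.map_coord_zero k (by simp [hk, warpedFrame, hπt])
      rw [this, smul_zero]
    · intro i
      have e1 : (fun k => warpedFrame ι t r σ e (i k).succ) = fun k => σ • ι (e (i k)) := rfl
      have e2 : (α.compContinuousLinearMap π) (fun k => σ • ι (e (i k))) =
          σ ^ p • α (fun k => e (i k)) := by
        have := α.toMultilinearMap.map_smul_univ (fun _ => σ) (fun k => e (i k))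
        simp only [Finset.prod_const, Finset.card_univ, Fintype.card_fin] at this
        exact Eq.trans (congrArg α (funext fun k => by simp [hπ])) this
      rw [e1, e2, insertFirst_const_smul, insertFirst_smul, insertFirst_wedge_lift hπ hρ h h',
        smul_smul]
      congr 1
      ring
  rw [hs]
  simp only [wedge_apply, Finset.smul_sum, Finset.mul_sum, Finset.sum_smul]
  rw [Finset.sum_comm]
  refine Finset.sum_congr rfl fun j _ => Finset.sum_congr rfl fun i _ => ?_
  simp only [Complex.real_smul, zsmul_eq_mul, smul_eq_mul]
  push_cast
  ring

/-- In each term of the wedge, `ρ` must receive `r t` and the other arguments must be lifted. The `p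
+ 1` positions contribute equally, which turns `1/(p+1)!` into `1/p!`; `r²` is the product of `ρ(r
t) = r` and the factor that `r t` leaves in the volume form. -/
lemma hodgeStar_warped_wedge (hπ : ∀ v, π (ι v) = v) (hρ : ∀ v, ρ (ι v) = 0) (hπt : π t = 0)
    (hρt : ρ t = 1) (hg : ∀ u v, g u v = B u v) (hn : n ≠ 0) (hdim : Module.finrank ℝ V = n)
    (hg' : ∀ u v, g' u v = B' u v) (hdim' : Module.finrank ℝ V' = n + 1)
    {e : Fin n → V} (he : IsOrthonormalFrame g e) {r σ : ℝ}
    (he' : IsOrthonormalFrame g' (warpedFrame ι t r σ e)) {p q : ℕ} (h : p + 1 + q = n + 1)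
    (h' : p + q = n) (vol : V [⋀^Fin n]→L[ℝ] ℝ) (C : ℝ) (γ : V [⋀^Fin p]→L[ℝ] ℂ) :
    hodgeStar h g' (C • wedge ρ (vol.compContinuousLinearMap π))
        (wedge ρ (γ.compContinuousLinearMap π)) =
      ((C * σ ^ (2 * p) * r ^ 2 : ℝ) : ℂ) •
        (hodgeStar h' g vol γ).compContinuousLinearMap π := by
  ext v
  rw [hodgeStar_apply hg' (Nat.succ_ne_zero n) hdim' h _ _ he', ContinuousAlternatingMap.smul_apply]
  have hw : ((hodgeStar h' g vol γ).compContinuousLinearMap π) v =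
      ((p.factorial : ℝ)⁻¹) • ∑ i : Fin p → Fin n,
      (((insertFirst h' vol (fun k => e (i k))).compContinuousLinearMap π) v) •
        γ (fun k => e (i k)) := hodgeStar_apply hg hn hdim h' vol γ he (fun a => π (v a))
  rw [hw]
  set μ := C • wedge ρ (vol.compContinuousLinearMap π) with hμ
  set f := warpedFrame ι t r σ e with hf
  set S : ℂ := ∑ i : Fin p → Fin n, (C * σ ^ (2 * p) * r ^ 2 *
    ((insertFirst h' vol (fun k => e (i k))).compContinuousLinearMap π) v) • γ (fun k => e (i k))
    with hS
  have hs0 : ∑ i : Fin p → Fin (n + 1), (r * insertFirst h μ (Fin.cons (f 0) fun k => f (i k)) v) •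
      (γ.compContinuousLinearMap π) (fun k => f (i k)) = S := by
    symm
    refine Fintype.sum_of_injective (fun i k => (i k).succ) (fun i j hij => funext fun k =>
      Fin.succ_injective _ (congrFun hij k)) _ _ ?_ ?_
    · intro i hi
      have : ∃ k, i k = 0 := by
        by_contra hc
        push Not at hc
        exact hi ⟨fun k => (i k).pred (hc k), funext fun k => by simp⟩
      obtain ⟨k, hk⟩ := this
      have : (γ.compContinuousLinearMap π) (fun k => f (i k)) = 0 :=
        γ.map_coord_zero k (by simp [hk, hf, warpedFrame, hπt])
      rw [this, smul_zero]
    · intro i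
      have e1 : (fun k => f (i k).succ) = fun k => σ • ι (e (i k)) := rfl
      have e2 : (γ.compContinuousLinearMap π) (fun k => σ • ι (e (i k))) =
          σ ^ p • γ (fun k => e (i k)) := by
        have := γ.toMultilinearMap.map_smul_univ (fun _ => σ) (fun k => e (i k))
        simp only [Finset.prod_const, Finset.card_univ, Fintype.card_fin] at this
        exact Eq.trans (congrArg γ (funext fun k => by simp [hπ])) this
      have e3 : insertFirst h μ (Fin.cons (f 0) fun k => σ • ι (e (i k))) v =
          r * σ ^ p * (C * ((insertFirst h' vol (fun k => e (i k))).compContinuousLinearMap π) v) := by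
        rw [← insertFirst_wedge_cons hπ hπt hρt h h', ← insertFirst_const_smul, ← hμ]
        have := (insertLast h μ v).map_smul_univ (Fin.cons r fun _ => σ)
          (Fin.cons t fun k => ι (e (i k)) : Fin (p + 1) → V')
        rw [Fin.prod_univ_succ] at this
        simp only [Fin.cons_zero, Fin.cons_succ, Finset.prod_const, Finset.card_univ,
          Fintype.card_fin, smul_eq_mul] at this
        refine Eq.trans ?_ this
        refine congrArg (insertLast h μ v) (funext fun k => ?_)
        refine Fin.cases ?_ (fun k => ?_) k <;> simp [hf, warpedFrame]
      rw [e1, e2, e3, smul_smul]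
      congr 1
      ring
  have hs : ∑ i : Fin (p + 1) → Fin (n + 1), insertFirst h μ (fun k => f (i k)) v •
      wedge ρ (γ.compContinuousLinearMap π) (fun k => f (i k)) = (p + 1 : ℝ) • S := by
    simp only [wedge_apply, Finset.smul_sum]
    rw [Finset.sum_comm]
    have : ∀ a : Fin (p + 1), ∑ i : Fin (p + 1) → Fin (n + 1),
        insertFirst h μ (fun k => f (i k)) v • (-1 : ℤ) ^ (a : ℕ) • ρ (f (i a)) •
          (γ.compContinuousLinearMap π) (a.removeNth fun k => f (i k)) = S := by
      intro a
      -- The index in position `a` is split off and must be `0`. The sign `(-1)^a` of the wedge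
      -- cancels the sign of moving `r t` to the front in the volume form.
      rw [← (Fin.insertNthEquiv (fun _ => Fin (n + 1)) a).sum_comp, Fintype.sum_prod_type,
        Fin.sum_univ_succ]
      rw [Finset.sum_eq_zero (s := Finset.univ (α := Fin n)), add_zero, ← hs0]
      · refine Finset.sum_congr rfl fun i _ => ?_
        have e1 : (fun k => f (Fin.insertNthEquiv (fun _ => Fin (n + 1)) a (0, i) k)) =
            (a.insertNth (f 0) (fun k => f (i k)) : Fin (p + 1) → V') := by
          funext k
          refine Fin.succAboveCases a ?_ (fun k => ?_) k <;> simp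
        have e2 : ρ (f 0) = r := by simp [hf, warpedFrame, hρt]
        rw [e1, insertFirst_insertNth]
        simp only [Fin.insertNthEquiv_apply, Fin.insertNth_apply_same, e2]
        have e3 : a.removeNth (a.insertNth (f 0) (fun k => f (i k)) : Fin (p + 1) → V') =
          fun k => f (i k) := by simp
        rw [e3]
        simp only [Complex.real_smul, zsmul_eq_mul]
        push_cast
        have : ((-1 : ℂ) ^ (a : ℕ)) * (-1) ^ (a : ℕ) = 1 := by rw [← mul_pow]; simp
        linear_combination (insertFirst h μ (Fin.cons (f 0) fun k => f (i k)) v * r *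
          (γ.compContinuousLinearMap π) (fun k => f (i k)) : ℂ) * this
      · intro x _
        refine Finset.sum_eq_zero fun i _ => ?_
        have : ρ (f x.succ) = 0 := by simp [hf, warpedFrame, hρ]
        simp [this]
    simp only [this]
    rw [Finset.sum_const, Finset.card_univ, Fintype.card_fin, ← Nat.cast_smul_eq_nsmul ℝ]
    push_cast
    rfl
  rw [hs, hS, Nat.factorial_succ]
  have hp : (p.factorial : ℂ) ≠ 0 := by exact_mod_cast p.factorial_ne_zero
  have hp1 : ((p : ℂ) + 1) ≠ 0 := by exact_mod_cast Nat.succ_ne_zero p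
  simp only [Finset.smul_sum]
  refine Finset.sum_congr rfl fun i _ => ?_
  simp only [Complex.real_smul, smul_eq_mul]
  push_cast
  field_simp

end Warped

/-! ### Exterior calculus on the model space `E × ℝ`. -/

section ModelProduct

variable {E : Type*} [NormedAddCommGroup E] [NormedSpace ℝ E]

lemma wedge_eq_alternatizeUncurryFin {F : Type*} [NormedAddCommGroup F] [NormedSpace ℝ F]
    {p : ℕ} (θ : E →L[ℝ] ℝ) (η : E [⋀^Fin p]→L[ℝ] F) :
    wedge θ η = ContinuousAlternatingMap.alternatizeUncurryFin (θ.smulRight η) := by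
  ext v
  rw [wedge_apply, ContinuousAlternatingMap.alternatizeUncurryFin_apply]
  rfl

lemma wedge_add {V F : Type*} [AddCommGroup V] [Module ℝ V] [TopologicalSpace V]
    [NormedAddCommGroup F] [NormedSpace ℝ F] {p : ℕ} (θ : V →L[ℝ] ℝ) (η η' : V [⋀^Fin p]→L[ℝ] F) :
    wedge θ (η + η') = wedge θ η + wedge θ η' := by
  ext v
  simp only [wedge_apply, ContinuousAlternatingMap.add_apply, smul_add, Finset.sum_add_distrib]

lemma wedge_smul {V : Type*} [AddCommGroup V] [Module ℝ V] [TopologicalSpace V] {p : ℕ}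
    (θ : V →L[ℝ] ℝ) (a : ℂ) (η : V [⋀^Fin p]→L[ℝ] ℂ) :
    wedge θ (a • η) = a • wedge θ η := by
  ext v
  simp only [wedge_apply, ContinuousAlternatingMap.smul_apply, Finset.smul_sum]
  refine Finset.sum_congr rfl fun i _ => ?_
  rw [smul_comm a, smul_comm a]

lemma wedge_zero {V F : Type*} [AddCommGroup V] [Module ℝ V] [TopologicalSpace V]
    [NormedAddCommGroup F] [NormedSpace ℝ F] {p : ℕ} (θ : V →L[ℝ] ℝ) :
    wedge θ (0 : V [⋀^Fin p]→L[ℝ] F) = 0 := by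
  ext v
  simp [wedge_apply]

/-- `θ ⊗ θ` is symmetric, and alternating a symmetric expression in two arguments gives zero. -/
lemma wedge_wedge_self {F : Type*} [NormedAddCommGroup F] [NormedSpace ℝ F]
    {p : ℕ} (θ : E →L[ℝ] ℝ) (η : E [⋀^Fin p]→L[ℝ] F) :
    wedge θ (wedge θ η) = 0 := by
  have := ContinuousAlternatingMap.alternatizeUncurryFin_alternatizeUncurryFinCLM_comp_of_symmetric
    (f := θ.smulRight (θ.smulRight η)) (fun x y => by simp [smul_smul, mul_comm])
  rw [wedge_eq_alternatizeUncurryFin, wedge_eq_alternatizeUncurryFin, ← this]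
  congr 1
  ext x
  simp

lemma extDeriv_smul_snd {p : ℕ} {η : E × ℝ → (E × ℝ) [⋀^Fin p]→L[ℝ] ℂ} {f : ℝ → ℂ} {f' : ℂ}
    {z : E × ℝ} (hη : DifferentiableAt ℝ η z) (hf : HasDerivAt f f' z.2) :
    extDeriv (fun w => f w.2 • η w) z =
      f' • wedge (ContinuousLinearMap.snd ℝ E ℝ) (η z) + f z.2 • extDeriv η z := by
  have h1 : HasFDerivAt (fun w : E × ℝ => f w.2) (((ContinuousLinearMap.snd ℝ E ℝ)).smulRight f') z := by
    have := hf.hasFDerivAt.comp z (hasFDerivAt_snd (𝕜 := ℝ) (E := E) (F := ℝ) (p := z))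
    refine this.congr_fderiv ?_
    ext v <;> simp
  have h2 : HasFDerivAt (fun w => f w.2 • η w) _ z := h1.smul hη.hasFDerivAt
  ext v
  rw [extDeriv, h2.fderiv, ContinuousAlternatingMap.add_apply, ContinuousAlternatingMap.smul_apply,
    ContinuousAlternatingMap.smul_apply, wedge_apply, extDeriv,
    ContinuousAlternatingMap.alternatizeUncurryFin_apply,
    ContinuousAlternatingMap.alternatizeUncurryFin_apply, Finset.smul_sum, Finset.smul_sum,
    ← Finset.sum_add_distrib]
  refine Finset.sum_congr rfl fun i _ => ?_
  simp
  ring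

lemma contDiffAt_wedge {E' : Type*} [NormedAddCommGroup E'] [NormedSpace ℝ E'] {p : ℕ}
    (θ : E →L[ℝ] ℝ) {η : E' → E [⋀^Fin p]→L[ℝ] ℂ} {z : E'} (hη : ContDiffAt ℝ ∞ η z) :
    ContDiffAt ℝ ∞ (fun w => wedge θ (η w)) z := by
  simp only [wedge_eq_alternatizeUncurryFin]
  exact (ContinuousAlternatingMap.alternatizeUncurryFinCLM ℝ E ℂ).contDiff.contDiffAt.comp z
    (contDiffAt_const.smulRight hη)

lemma extDeriv_comp_fst {p : ℕ} {A : E → E [⋀^Fin p]→L[ℝ] ℂ} {z : E × ℝ}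
    (hA : DifferentiableAt ℝ A z.1) :
    extDeriv (fun w : E × ℝ => (A w.1).compContinuousLinearMap (ContinuousLinearMap.fst ℝ E ℝ)) z =
      (extDeriv A z.1).compContinuousLinearMap (ContinuousLinearMap.fst ℝ E ℝ) := by
  have := extDeriv_pullback (f := (Prod.fst : E × ℝ → E)) (x := z) (r := ∞) hA
    contDiffAt_fst two_le_infty
  simpa only [fderiv_fst] using this

lemma contDiffAt_comp_fst {p : ℕ} {A : E → E [⋀^Fin p]→L[ℝ] ℂ} {z : E × ℝ}
    (hA : ContDiffAt ℝ ∞ A z.1) : ContDiffAt ℝ ∞ (fun w : E × ℝ =>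
      (A w.1).compContinuousLinearMap (ContinuousLinearMap.fst ℝ E ℝ)) z :=
  (ContinuousAlternatingMap.compContinuousLinearMapCLM (F := ℂ) (ι := Fin p)
    (ContinuousLinearMap.fst ℝ E ℝ)).contDiff.contDiffAt.comp z (hA.comp z contDiffAt_fst)

/-- Differentiating `d(r η) = dr ∧ η + r dη` once more gives `0 = d(dr ∧ η) + dr ∧ dη`. -/
lemma extDeriv_wedge_snd {p : ℕ} {η : E × ℝ → (E × ℝ) [⋀^Fin p]→L[ℝ] ℂ} {z : E × ℝ}
    (hη : ContDiffAt ℝ ∞ η z) :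
    extDeriv (fun w : E × ℝ => wedge (ContinuousLinearMap.snd ℝ E ℝ) (η w)) z =
      -wedge (ContinuousLinearMap.snd ℝ E ℝ) (extDeriv η z) := by
  have hof : ∀ s : ℝ, HasDerivAt (fun s : ℝ => (s : ℂ)) 1 s := fun s => Complex.ofRealCLM.hasDerivAt
  have hc : ContDiffAt ℝ ∞ (fun w : E × ℝ => (w.2 : ℂ)) z :=
    (Complex.ofRealCLM.contDiff.comp contDiff_snd).contDiffAt
  have hd : ContDiffAt ℝ ∞ (extDeriv η) z :=
    (ContinuousAlternatingMap.alternatizeUncurryFinCLM ℝ (E × ℝ) ℂ).contDiff.contDiffAt.comp z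
      (hη.fderiv_right (by simp))
  have h0 := extDeriv_extDeriv_apply (r := ∞) (hc.smul hη) two_le_infty
  have h1 : extDeriv (fun w : E × ℝ => (w.2 : ℂ) • η w) =ᶠ[𝓝 z] fun w =>
      wedge (ContinuousLinearMap.snd ℝ E ℝ) (η w) + (w.2 : ℂ) • extDeriv η w := by
    filter_upwards [(hη.of_le (m := 1) (by exact_mod_cast le_top)).eventually (by simp)] with w hw
    rw [extDeriv_smul_snd (hw.differentiableAt (by simp)) (hof w.2), one_smul]
  have h2 : extDeriv (extDeriv (fun w : E × ℝ => (w.2 : ℂ) • η w)) z = 0 := h0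
  have h3 : DifferentiableAt ℝ (fun w : E × ℝ => (w.2 : ℂ) • extDeriv η w) z :=
    (hc.smul hd).differentiableAt (by simp)
  rw [h1.extDeriv_eq, extDeriv_fun_add
    ((contDiffAt_wedge _ hη).differentiableAt (by simp)) h3,
    extDeriv_smul_snd (hd.differentiableAt (by simp)) (hof z.2),
    extDeriv_extDeriv_apply hη two_le_infty, smul_zero, add_zero, one_smul] at h2
  exact eq_neg_of_add_eq_zero_left h2

lemma extDeriv_smul_wedge_snd {p : ℕ} {η : E × ℝ → (E × ℝ) [⋀^Fin p]→L[ℝ] ℂ} {z : E × ℝ}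
    (hη : ContDiffAt ℝ ∞ η z) {f : ℝ → ℂ} {f' : ℂ} (hf : HasDerivAt f f' z.2) :
    extDeriv (fun w : E × ℝ => f w.2 • wedge (ContinuousLinearMap.snd ℝ E ℝ) (η w)) z =
      -(f z.2 • wedge (ContinuousLinearMap.snd ℝ E ℝ) (extDeriv η z)) := by
  rw [extDeriv_smul_snd ((contDiffAt_wedge _ hη).differentiableAt (by simp)) hf,
    wedge_wedge_self, smul_zero, zero_add, extDeriv_wedge_snd hη, smul_neg]

end ModelProduct

/-! ### Forms `f(r) π^*α` and `f(r) dr ∧ π^*α` in product charts. -/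

section ProductForms

set_option linter.unusedSectionVars false

variable {n : ℕ} {M : Type*} [TopologicalSpace M] [ChartedSpace (EuclideanSpace ℝ (Fin n)) M]
  [IsManifold (𝓡 n) ∞ M]

lemma dπ_eq (z : M × ℝ) : dπ (n := n) z = ContinuousLinearMap.fst ℝ (EuclideanSpace ℝ (Fin n)) ℝ :=
  mfderiv_fst

lemma dr_eq (z : M × ℝ) : dr (n := n) z = ContinuousLinearMap.snd ℝ (EuclideanSpace ℝ (Fin n)) ℝ :=
  mfderiv_snd

lemma symmDeriv_prod (x : M) (r : ℝ) {w : EuclideanSpace ℝ (Fin n) × ℝ}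
    (hw : w.1 ∈ (extChartAt (𝓡 n) x).target) :
    symmDeriv (modelX n) (x, r) w =
      (symmDeriv (𝓡 n) x w.1).prodMap (ContinuousLinearMap.id ℝ ℝ) := by
  have h1 := (mdifferentiableAt_extChartAt_symm (I := 𝓡 n) x hw).hasMFDerivAt
  have h2 := (hasFDerivAt_fst (𝕜 := ℝ) (E := EuclideanSpace ℝ (Fin n)) (F := ℝ)
    (p := w)).hasMFDerivAt
  have h3 := (hasFDerivAt_snd (𝕜 := ℝ) (E := EuclideanSpace ℝ (Fin n)) (F := ℝ)
    (p := w)).hasMFDerivAt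
  exact ((h1.comp w h2).prodMk h3).mfderiv

/-- The form `dr ∧ π^* η`. -/
def drPull {p : ℕ} (η : DForm (𝓡 n) M ℂ p) : DForm (modelX n) (M × ℝ) ℂ (p + 1) :=
  fun z => wedge (dr z) (pull η z)

lemma inChart_pull {p : ℕ} (α : DForm (𝓡 n) M ℂ p) (f : ℝ → ℂ) (x : M) (r : ℝ)
    {w : EuclideanSpace ℝ (Fin n) × ℝ} (hw : w.1 ∈ (extChartAt (𝓡 n) x).target) :
    inChart (x, r) (fun z : M × ℝ => f z.2 • pull α z) w =
      f w.2 • (inChart x α w.1).compContinuousLinearMap (ContinuousLinearMap.fst ℝ _ ℝ) := by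
  ext v
  have h := symmDeriv_prod (n := n) x r hw
  refine congrArg (f w.2 * ·) (congrArg (DForm.toFun α _) (funext fun i => ?_))
  change dπ (n := n) ((extChartAt (modelX n) (x, r)).symm w) (symmDeriv (modelX n) (x, r) w (v i)) = _
  rw [h, dπ_eq]
  rfl

lemma inChart_drPull {p : ℕ} (α : DForm (𝓡 n) M ℂ p) (f : ℝ → ℂ) (x : M) (r : ℝ)
    {w : EuclideanSpace ℝ (Fin n) × ℝ} (hw : w.1 ∈ (extChartAt (𝓡 n) x).target) :
    inChart (x, r) (fun z : M × ℝ => f z.2 • drPull α z) w =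
      f w.2 • wedge (ContinuousLinearMap.snd ℝ _ ℝ)
        ((inChart x α w.1).compContinuousLinearMap (ContinuousLinearMap.fst ℝ _ ℝ)) := by
  ext v
  have h := symmDeriv_prod (n := n) x r hw
  refine congrArg (f w.2 * ·) ?_
  refine (wedge_apply _ _ _).trans ((Finset.sum_congr rfl fun i _ => ?_).trans (wedge_apply _ _ _).symm)
  have h1 : dr (n := n) ((extChartAt (modelX n) (x, r)).symm w)
      (symmDeriv (modelX n) (x, r) w (v i)) = (v i).2 := by
    rw [h, dr_eq]
    rfl
  refine congrArg _ (congrArg₂ (fun (a : ℝ) (b : ℂ) => a • b) h1 ?_)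
  refine congrArg (DForm.toFun α _) (funext fun j => ?_)
  change dπ (n := n) ((extChartAt (modelX n) (x, r)).symm w)
    (symmDeriv (modelX n) (x, r) w (v (i.succAbove j))) = _
  rw [h, dπ_eq]
  rfl

lemma eventually_mem_target (x : M) (r : ℝ) :
    ∀ᶠ w : EuclideanSpace ℝ (Fin n) × ℝ in 𝓝 (extChartAt (modelX n) (x, r) (x, r)),
      w.1 ∈ (extChartAt (𝓡 n) x).target := by
  have h : ContinuousAt (Prod.fst : EuclideanSpace ℝ (Fin n) × ℝ → _)
    (extChartAt (𝓡 n) x x, r) := continuousAt_fst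
  exact h.eventually (extChartAt_target_mem_nhds (I := 𝓡 n) x)

end ProductForms

/-! ### Derivatives of forms at a point -/

section Pointwise

set_option linter.unusedSectionVars false

variable {E : Type*} [NormedAddCommGroup E] [NormedSpace ℝ E]
variable {H : Type*} [TopologicalSpace H] {I : ModelWithCorners ℝ E H}
variable {M : Type*} [TopologicalSpace M] [ChartedSpace H M] [I.Boundaryless] [IsManifold I ∞ M]

/-- `Ω` is differentiable at `z` with exterior derivative `Θ`. -/
def HasExtD {p : ℕ} (Ω : DForm I M ℂ p) (z : M) (Θ : (TangentSpace I z) [⋀^Fin (p + 1)]→L[ℝ] ℂ) :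
    Prop :=
  DifferentiableAt ℝ (inChart z Ω) (extChartAt I z z) ∧ extD Ω z = Θ

lemma inChart_congr {p : ℕ} {Ω Ω' : DForm I M ℂ p} {z : M} (h : ∀ᶠ w in 𝓝 z, Ω w = Ω' w) :
    inChart z Ω =ᶠ[𝓝 (extChartAt I z z)] inChart z Ω' := by
  have hc : ContinuousAt (extChartAt I z).symm (extChartAt I z z) :=
    continuousAt_extChartAt_symm z
  rw [ContinuousAt, extChartAt_to_inv] at hc
  filter_upwards [hc.eventually h] with y hy
  rw [inChart, inChart, hy]

lemma HasExtD.congr {p : ℕ} {Ω Ω' : DForm I M ℂ p} {z : M}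
    {Θ : (TangentSpace I z) [⋀^Fin (p + 1)]→L[ℝ] ℂ} (h : HasExtD Ω z Θ)
    (h' : ∀ᶠ w in 𝓝 z, Ω' w = Ω w) : HasExtD Ω' z Θ := by
  have := inChart_congr h'
  refine ⟨h.1.congr_of_eventuallyEq this, ?_⟩
  rw [← h.2, extD, extD, this.extDeriv_eq]

lemma HasExtD.add {p : ℕ} {Ω Ω' : DForm I M ℂ p} {z : M}
    {Θ Θ' : (TangentSpace I z) [⋀^Fin (p + 1)]→L[ℝ] ℂ} (h : HasExtD Ω z Θ) (h' : HasExtD Ω' z Θ') :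
    HasExtD (Ω + Ω') z (Θ + Θ') := by
  rw [HasExtD, inChart_add]
  refine ⟨h.1.add h'.1, ?_⟩
  rw [← h.2, ← h'.2, extD_eq, extD_eq, extD_eq, inChart_add]
  exact extDeriv_add h.1 h'.1

lemma hasExtD_zero {p : ℕ} (z : M) : HasExtD (0 : DForm I M ℂ p) z 0 := by
  rw [HasExtD, inChart_zero, extD_zero]
  exact ⟨differentiableAt_const _, rfl⟩

variable {N : ℕ} (g : ∀ x : M, TangentSpace I x → TangentSpace I x → ℝ) (vol : DForm I M ℝ N)

/-- `⋆Ω` is differentiable at `z`, and `Ω` has the codifferential `Θ` there. -/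
def HasCodiff {p q : ℕ} (hpq : p + 1 + q = N) (Ω : DForm I M ℂ (p + 1)) (z : M)
    (Θ : (TangentSpace I z) [⋀^Fin p]→L[ℝ] ℂ) : Prop :=
  DifferentiableAt ℝ (inChart z fun w => hodgeStar hpq (g w) (vol w) (Ω w)) (extChartAt I z z) ∧
    codiffSucc g vol Ω z = Θ

variable {g vol}

lemma hasCodiff_of_hasExtD {p q : ℕ} {hpq : p + 1 + q = N} (hqp : q + 1 + p = N)
    {Ω : DForm I M ℂ (p + 1)} {z : M}
    {Θ : (TangentSpace I z) [⋀^Fin (q + 1)]→L[ℝ] ℂ}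
    (h : HasExtD (fun w => hodgeStar hpq (g w) (vol w) (Ω w)) z Θ) :
    HasCodiff g vol hpq Ω z (((-1 : ℂ) ^ (p + 1 + p * (q + 1))) • hodgeStar hqp (g z) (vol z) Θ) := by
  refine ⟨h.1, ?_⟩
  rw [codiffSucc_apply g vol hpq, h.2]

lemma HasCodiff.hasExtD {p q : ℕ} {hpq : p + 1 + q = N} {Ω : DForm I M ℂ (p + 1)} {z : M}
    {Θ : (TangentSpace I z) [⋀^Fin p]→L[ℝ] ℂ} (h : HasCodiff g vol hpq Ω z Θ) :
    HasExtD (fun w => hodgeStar hpq (g w) (vol w) (Ω w)) z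
      (extD (fun w => hodgeStar hpq (g w) (vol w) (Ω w)) z) := ⟨h.1, rfl⟩

lemma HasCodiff.congr {p q : ℕ} {hpq : p + 1 + q = N} {Ω Ω' : DForm I M ℂ (p + 1)} {z : M}
    {Θ : (TangentSpace I z) [⋀^Fin p]→L[ℝ] ℂ} (h : HasCodiff g vol hpq Ω z Θ)
    (h' : ∀ᶠ w in 𝓝 z, Ω' w = Ω w) : HasCodiff g vol hpq Ω' z Θ := by
  have h1 := hasCodiff_of_hasExtD (hpq := hpq) (by omega) (h.hasExtD.congr
    (Ω' := fun w => hodgeStar hpq (g w) (vol w) (Ω' w))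
    (h'.mono fun w hw => congrArg (hodgeStar hpq (g w) (vol w)) hw))
  have h2 := hasCodiff_of_hasExtD (hpq := hpq) (by omega) h.hasExtD
  rwa [← h2.2, h.2] at h1

lemma HasCodiff.add {p q : ℕ} {hpq : p + 1 + q = N} {Ω Ω' : DForm I M ℂ (p + 1)} {z : M}
    {Θ Θ' : (TangentSpace I z) [⋀^Fin p]→L[ℝ] ℂ} (h : HasCodiff g vol hpq Ω z Θ)
    (h' : HasCodiff g vol hpq Ω' z Θ') : HasCodiff g vol hpq (Ω + Ω') z (Θ + Θ') := by
  have h1 := hasCodiff_of_hasExtD (hpq := hpq) (Ω := Ω + Ω') (by omega) ((h.hasExtD.add h'.hasExtD).congr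
    (Eventually.of_forall fun w => hodgeStar_add hpq _ _ _))
  have h2 := hasCodiff_of_hasExtD (hpq := hpq) (by omega) h.hasExtD
  have h3 := hasCodiff_of_hasExtD (hpq := hpq) (by omega) h'.hasExtD
  rwa [hodgeStar_add, smul_add, ← h2.2, ← h3.2, h.2, h'.2] at h1

lemma hasCodiff_zero {p q : ℕ} (hpq : p + 1 + q = N) (z : M) :
    HasCodiff g vol hpq (0 : DForm I M ℂ (p + 1)) z 0 := by
  have h1 := hasCodiff_of_hasExtD (hpq := hpq) (g := g) (vol := vol) (by omega)
    ((hasExtD_zero (p := q) z).congr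
      (Ω' := fun w => hodgeStar hpq (g w) (vol w) ((0 : DForm I M ℂ (p + 1)) w))
      (Eventually.of_forall fun w => hodgeStar_zero hpq _))
  rw [hodgeStar_zero] at h1
  exact ⟨h1.1, h1.2.trans (smul_zero _)⟩

/-- The component `dδ` of the form Laplacian, computed from differentiable forms. -/
def HasLowerLaplacian (g : ∀ x : M, TangentSpace I x → TangentSpace I x → ℝ) (vol : DForm I M ℝ N) :
    ∀ {p : ℕ} (_ : DForm I M ℂ p) (z : M) (_ : (TangentSpace I z) [⋀^Fin p]→L[ℝ] ℂ), Prop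
  | 0, _, _, Θ => Θ = 0
  | k + 1, Ω, z, Θ => ∃ (q : ℕ) (hkq : k + 1 + q = N) (Ψ : DForm I M ℂ k),
      (∀ᶠ w in 𝓝 z, HasCodiff g vol hkq Ω w (Ψ w)) ∧ HasExtD Ψ z Θ

/-- The component `δd` of the form Laplacian, computed from differentiable forms. -/
def HasUpperLaplacian (g : ∀ x : M, TangentSpace I x → TangentSpace I x → ℝ) (vol : DForm I M ℝ N)
    {p : ℕ} (Ω : DForm I M ℂ p) (z : M) (Θ : (TangentSpace I z) [⋀^Fin p]→L[ℝ] ℂ) : Prop :=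
  ∃ (q : ℕ) (hpq : p + 1 + q = N) (Ψ : DForm I M ℂ (p + 1)),
    (∀ᶠ w in 𝓝 z, HasExtD Ω w (Ψ w)) ∧ HasCodiff g vol hpq Ψ z Θ

/-- The form Laplacian, computed from differentiable forms. -/
def HasLaplacian (g : ∀ x : M, TangentSpace I x → TangentSpace I x → ℝ) (vol : DForm I M ℝ N)
    {p : ℕ} (Ω : DForm I M ℂ p) (z : M) (Θ : (TangentSpace I z) [⋀^Fin p]→L[ℝ] ℂ) : Prop :=
  ∃ Θ₁ Θ₂, HasLowerLaplacian g vol Ω z Θ₁ ∧ HasUpperLaplacian g vol Ω z Θ₂ ∧ Θ = Θ₁ + Θ₂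

/-- The intermediate forms agree with `δΩ` and `dΩ` near `z` only, which suffices since the outer
operators depend on germs. -/
lemma HasLaplacian.eq {p : ℕ} {Ω : DForm I M ℂ p} {z : M}
    {Θ : (TangentSpace I z) [⋀^Fin p]→L[ℝ] ℂ} (h : HasLaplacian g vol Ω z Θ) :
    formLaplacian g vol Ω z = Θ := by
  obtain ⟨Θ₁, Θ₂, h1, ⟨q, hpq, Ψ, h2, h3⟩, rfl⟩ := h
  rw [formLaplacian, Pi.add_apply]
  congr 1
  · rcases p with _ | k
    · exact h1.symm
    · obtain ⟨q, hkq, Ψ, h4, h5⟩ := h1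
      exact (h5.congr (h4.mono fun w hw => hw.2)).2
  · exact (h3.congr (h2.mono fun w hw => hw.2)).2

/-- The forms to be added are known to be differentiable only near points with `r > 0`, so linearity
on globally smooth forms is not available. The predicate carries the differentiability of the
intermediate forms along. -/
lemma HasLaplacian.add {p : ℕ} {Ω Ω' : DForm I M ℂ p} {z : M}
    {Θ Θ' : (TangentSpace I z) [⋀^Fin p]→L[ℝ] ℂ} (h : HasLaplacian g vol Ω z Θ)
    (h' : HasLaplacian g vol Ω' z Θ') : HasLaplacian g vol (Ω + Ω') z (Θ + Θ') := by
  obtain ⟨Θ₁, Θ₂, h1, ⟨q, hpq, Ψ, h2, h3⟩, rfl⟩ := h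
  obtain ⟨Θ₁', Θ₂', h1', ⟨q', hpq', Ψ', h2', h3'⟩, rfl⟩ := h'
  obtain rfl : q = q' := by omega
  refine ⟨Θ₁ + Θ₁', Θ₂ + Θ₂', ?_, ⟨q, hpq, Ψ + Ψ', ?_, h3.add h3'⟩, by abel⟩
  · rcases p with _ | k
    · rw [show Θ₁ = 0 from h1, show Θ₁' = 0 from h1']
      exact add_zero _
    · obtain ⟨q, hkq, Ψ, h4, h5⟩ := h1
      obtain ⟨q', hkq', Ψ', h4', h5'⟩ := h1'
      obtain rfl : q = q' := by omega
      exact ⟨q, hkq, Ψ + Ψ', h4.mp (h4'.mono fun w hw' hw => hw.add hw'), h5.add h5'⟩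
  · exact h2.mp (h2'.mono fun w hw' hw => hw.add hw')

end Pointwise

/-! ### Hodge theory of the Poincaré–Einstein metric -/

section PoincareHodge

set_option linter.unusedSectionVars false

variable {n : ℕ} {M : Type*} [TopologicalSpace M] [ChartedSpace (EuclideanSpace ℝ (Fin n)) M]
  [IsManifold (𝓡 n) ∞ M]

lemma hasExtD_pull {p : ℕ} {α : DForm (𝓡 n) M ℂ p} (hα : IsSmoothForm α) {f : ℝ → ℂ} {f' : ℂ}
    (x : M) {r : ℝ} (hf : HasDerivAt f f' r) :
    HasExtD (fun z : M × ℝ => f z.2 • pull α z) (x, r)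
      (f' • drPull α (x, r) + f r • pull (extD α) (x, r)) := by
  have hx : extChartAt (𝓡 n) x x ∈ (extChartAt (𝓡 n) x).target := mem_extChartAt_target x
  have h1 : inChart (x, r) (fun z : M × ℝ => f z.2 • pull α z) =ᶠ[𝓝 (extChartAt (modelX n) (x, r) (x, r))]
      fun w => f w.2 • (inChart x α w.1).compContinuousLinearMap (ContinuousLinearMap.fst ℝ _ ℝ) :=
    (eventually_mem_target x r).mono fun w hw => inChart_pull α f x r hw
  have h2 : DifferentiableAt ℝ (fun w : EuclideanSpace ℝ (Fin n) × ℝ =>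
      (inChart x α w.1).compContinuousLinearMap (ContinuousLinearMap.fst ℝ _ ℝ))
      (extChartAt (𝓡 n) x x, r) :=
    (contDiffAt_comp_fst (hα.contDiffAt x hx)).differentiableAt (by simp)
  have h3 : DifferentiableAt ℝ (fun w : EuclideanSpace ℝ (Fin n) × ℝ => f w.2)
      (extChartAt (𝓡 n) x x, r) :=
    DifferentiableAt.comp (g := f) (extChartAt (𝓡 n) x x, r) hf.differentiableAt differentiableAt_snd
  refine ⟨(h3.smul h2).congr_of_eventuallyEq h1, ?_⟩
  rw [extD_eq, h1.extDeriv_eq]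
  refine (extDeriv_smul_snd (z := (extChartAt (𝓡 n) x x, r)) h2 hf).trans ?_
  rw [extDeriv_comp_fst (hα.differentiableAt x hx), inChart_self, ← extD_eq, drPull, dr_eq]
  simp only [pull, dπ_eq]
  rfl

lemma hasExtD_drPull {p : ℕ} {α : DForm (𝓡 n) M ℂ p} (hα : IsSmoothForm α) {f : ℝ → ℂ} {f' : ℂ}
    (x : M) {r : ℝ} (hf : HasDerivAt f f' r) :
    HasExtD (fun z : M × ℝ => f z.2 • drPull α z) (x, r) (-(f r • drPull (extD α) (x, r))) := by
  have hx : extChartAt (𝓡 n) x x ∈ (extChartAt (𝓡 n) x).target := mem_extChartAt_target x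
  have h1 : inChart (x, r) (fun z : M × ℝ => f z.2 • drPull α z) =ᶠ[𝓝 (extChartAt (modelX n) (x, r) (x, r))]
      fun w => f w.2 • wedge (ContinuousLinearMap.snd ℝ _ ℝ)
        ((inChart x α w.1).compContinuousLinearMap (ContinuousLinearMap.fst ℝ _ ℝ)) :=
    (eventually_mem_target x r).mono fun w hw => inChart_drPull α f x r hw
  have h2 : ContDiffAt ℝ ∞ (fun w : EuclideanSpace ℝ (Fin n) × ℝ =>
      (inChart x α w.1).compContinuousLinearMap (ContinuousLinearMap.fst ℝ _ ℝ))
      (extChartAt (𝓡 n) x x, r) := contDiffAt_comp_fst (hα.contDiffAt x hx)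
  have h3 : DifferentiableAt ℝ (fun w : EuclideanSpace ℝ (Fin n) × ℝ => f w.2)
      (extChartAt (𝓡 n) x x, r) :=
    DifferentiableAt.comp (g := f) (extChartAt (𝓡 n) x x, r) hf.differentiableAt differentiableAt_snd
  refine ⟨(h3.smul ((contDiffAt_wedge _ h2).differentiableAt (by simp))).congr_of_eventuallyEq h1, ?_⟩
  rw [extD_eq, h1.extDeriv_eq]
  refine (extDeriv_smul_wedge_snd (z := (extChartAt (𝓡 n) x x, r)) h2 hf).trans ?_
  rw [extDeriv_comp_fst (hα.differentiableAt x hx), ← extD_eq, drPull, dr_eq]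
  simp only [pull, dπ_eq]
  rfl

/-- The metric `g₊` at a point as a bilinear form. -/
def bilinPlus (h : RMetric n M) (J : ℝ) (z : M × ℝ) :
    TangentSpace (modelX n) z →ₗ[ℝ] TangentSpace (modelX n) z →ₗ[ℝ] ℝ :=
  LinearMap.mk₂ ℝ (gPlus h J z)
    (fun _ _ _ => by simp only [gPlus, map_add, RMetric.toFun_eq_bilin, LinearMap.add_apply]; ring)
    (fun _ _ _ => by
      simp only [gPlus, map_smul, RMetric.toFun_eq_bilin, LinearMap.smul_apply, smul_eq_mul]; ring)
    (fun _ _ _ => by simp only [gPlus, map_add, RMetric.toFun_eq_bilin]; ring)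
    (fun _ _ _ => by simp only [gPlus, map_smul, RMetric.toFun_eq_bilin, smul_eq_mul]; ring)

/-- The lift of a tangent vector of `M` to `M × ℝ`. -/
def liftVector (z : M × ℝ) (v : TangentSpace (𝓡 n) z.1) : TangentSpace (modelX n) z :=
  ((v, 0) : EuclideanSpace ℝ (Fin n) × ℝ)

/-- The vector field `∂_r`. -/
def radialVector (z : M × ℝ) : TangentSpace (modelX n) z := ((0, 1) : EuclideanSpace ℝ (Fin n) × ℝ)

lemma dπ_liftVector (z : M × ℝ) (v : TangentSpace (𝓡 n) z.1) : dπ z (liftVector z v) = v := by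
  rw [dπ_eq]; rfl

lemma dr_liftVector (z : M × ℝ) (v : TangentSpace (𝓡 n) z.1) : dr z (liftVector z v) = 0 := by
  rw [dr_eq]; rfl

lemma dπ_radialVector (z : M × ℝ) : dπ (n := n) z (radialVector z) = 0 := by
  rw [dπ_eq]; rfl

lemma dr_radialVector (z : M × ℝ) : dr (n := n) z (radialVector z) = 1 := by
  rw [dr_eq]; rfl

lemma finrank_tangentSpace_prod (z : M × ℝ) :
    Module.finrank ℝ (TangentSpace (modelX n) z) = n + 1 := by
  have : Module.finrank ℝ (EuclideanSpace ℝ (Fin n) × ℝ) = n + 1 := by simp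
  exact this

lemma isOrthonormalFrame_warpedFrame (h : RMetric n M) {J : ℝ} {z : M × ℝ} (hr : z.2 ≠ 0)
    (hJ : Jfun n J z.2 ≠ 0) {e : Fin n → TangentSpace (𝓡 n) z.1}
    (he : IsOrthonormalFrame (h.toFun z.1) e) :
    IsOrthonormalFrame (gPlus h J z)
      (warpedFrame (liftVector z) (radialVector z) z.2 (z.2 / Jfun n J z.2) e) := by
  intro i j
  refine Fin.cases ?_ (fun i => ?_) i <;> refine Fin.cases ?_ (fun j => ?_) j <;>
  simp only [warpedFrame, Fin.cons_zero, Fin.cons_succ, gPlus, map_smul, dπ_liftVector,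
    dr_liftVector, dπ_radialVector, dr_radialVector, RMetric.toFun_eq_bilin, smul_zero, map_zero,
    LinearMap.zero_apply, LinearMap.smul_apply, smul_eq_mul]
  · simp; field_simp
  · simp [(Fin.succ_ne_zero j).symm]
  · simp [Fin.succ_ne_zero]
  · rw [← RMetric.toFun_eq_bilin, he i j]
    simp only [Fin.succ_inj]
    split_ifs <;> simp
    field_simp

/-- The factor in `⋆(dr ∧ γ)` for a `p`-form `γ`. -/
def starFactor (n : ℕ) (J : ℝ) (p : ℕ) (r : ℝ) : ℝ :=
  (r ^ (n + 1))⁻¹ * Jfun n J r ^ n * (r / Jfun n J r) ^ (2 * p) * r ^ 2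

/-- The Hodge star of `g₊`. -/
abbrev starPlus (h : RMetric n M) (vol : DForm (𝓡 n) M ℝ n) (J : ℝ) {p q : ℕ}
    (hpq : p + q = n + 1) (Ω : DForm (modelX n) (M × ℝ) ℂ p) : DForm (modelX n) (M × ℝ) ℂ q :=
  fun z => hodgeStar hpq (gPlus h J z) (volPlus vol J z) (Ω z)

lemma starPlus_pull (hn : n ≠ 0) (h : RMetric n M) (vol : DForm (𝓡 n) M ℝ n) {J : ℝ} {z : M × ℝ}
    (hr : z.2 ≠ 0) (hJ : Jfun n J z.2 ≠ 0) {p q : ℕ} (hpq : p + (q + 1) = n + 1) (hpq' : p + q = n)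
    (α : DForm (𝓡 n) M ℂ p) :
    starPlus h vol J hpq (pull α) z =
      ((-1 : ℂ) ^ p * (starFactor n J p z.2 / z.2 ^ 2 : ℝ)) • drPull (starForm h vol hpq' α) z := by
  obtain ⟨e, he⟩ := exists_frame h z.1
  have := hodgeStar_warped_pull (π := dπ z) (ρ := dr z) (ι := liftVector z) (t := radialVector z)
    (dπ_liftVector z) (dr_liftVector z) (dπ_radialVector z) (h.toFun_eq_bilin z.1) hn
    (finrank_tangentSpace z.1) (g' := gPlus h J z) (B' := bilinPlus h J z) (fun _ _ => rfl)
    (finrank_tangentSpace_prod z) he (isOrthonormalFrame_warpedFrame h hr hJ he) hpq hpq' (vol z.1)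
    ((z.2 ^ (n + 1))⁻¹ * Jfun n J z.2 ^ n) (α z.1)
  have e : starFactor n J p z.2 / z.2 ^ 2 =
      (z.2 ^ (n + 1))⁻¹ * Jfun n J z.2 ^ n * (z.2 / Jfun n J z.2) ^ (2 * p) := by
    rw [starFactor, mul_div_cancel_right₀ _ (pow_ne_zero 2 hr)]
  rw [e]
  exact this

lemma starPlus_drPull (hn : n ≠ 0) (h : RMetric n M) (vol : DForm (𝓡 n) M ℝ n) {J : ℝ} {z : M × ℝ}
    (hr : z.2 ≠ 0) (hJ : Jfun n J z.2 ≠ 0) {p q : ℕ} (hpq : p + 1 + q = n + 1) (hpq' : p + q = n)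
    (α : DForm (𝓡 n) M ℂ p) :
    starPlus h vol J hpq (drPull α) z =
      (starFactor n J p z.2 : ℂ) • pull (starForm h vol hpq' α) z := by
  obtain ⟨e, he⟩ := exists_frame h z.1
  exact hodgeStar_warped_wedge (π := dπ z) (ρ := dr z) (ι := liftVector z) (t := radialVector z)
    (dπ_liftVector z) (dr_liftVector z) (dπ_radialVector z) (dr_radialVector z)
    (h.toFun_eq_bilin z.1) hn
    (finrank_tangentSpace z.1) (g' := gPlus h J z) (B' := bilinPlus h J z) (fun _ _ => rfl)
    (finrank_tangentSpace_prod z) he (isOrthonormalFrame_warpedFrame h hr hJ he) hpq hpq' (vol z.1)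
    ((z.2 ^ (n + 1))⁻¹ * Jfun n J z.2 ^ n) (α z.1)

/-- `starFactor n J p r = r^(2p+1-n) J(r)^(n-2p)`, so for complementary degrees the powers of `J(r)`
cancel. -/
lemma starFactor_mul {J r : ℝ} (hr : r ≠ 0) (hJ : Jfun n J r ≠ 0) {p q : ℕ} (hpq : p + q = n) :
    starFactor n J p r * starFactor n J q r = r ^ 2 := by
  subst hpq
  simp only [starFactor, div_pow]
  field_simp
  ring

lemma starFactor_mul_succ {J r : ℝ} (hr : r ≠ 0) (hJ : Jfun n J r ≠ 0) {p q : ℕ}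
    (hpq : p + q + 1 = n) :
    starFactor n J (p + 1) r * starFactor n J (q + 1) r / r ^ 2 = (r / Jfun n J r) ^ 2 := by
  subst hpq
  simp only [starFactor, div_pow]
  field_simp
  ring

/-- `θ(r) = (1 + (J/2n) r²) / (1 - (J/2n) r²)`. -/
def thetaFun (n : ℕ) (J r : ℝ) : ℝ := (1 + J / (2 * n) * r ^ 2) / Jfun n J r

lemma hasDerivAt_Jfun (n : ℕ) (J r : ℝ) : HasDerivAt (Jfun n J) (-(J / (2 * n) * (2 * r))) r := by
  have h1 := ((hasDerivAt_pow 2 r).const_mul (J / (2 * n))).const_sub 1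
  refine HasDerivAt.congr_deriv (f := Jfun n J) h1 ?_
  simp

/-- Derivatives are kept in the logarithmic form `f' = f l`; powers, products and inverses then act
on `l` by scaling, adding and negating. -/
lemma hasDerivAt_pow_of_log {f : ℝ → ℝ} {l r : ℝ} (hf : HasDerivAt f (f r * l) r) (k : ℕ) :
    HasDerivAt (fun s => f s ^ k) (f r ^ k * (k * l)) r := by
  refine (hf.fun_pow k).congr_deriv ?_
  rcases k with _ | k
  · simp
  · rw [Nat.add_sub_cancel]
    push_cast
    ring

lemma hasDerivAt_mul_of_log {f g : ℝ → ℝ} {l l' r : ℝ} (hf : HasDerivAt f (f r * l) r)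
    (hg : HasDerivAt g (g r * l') r) :
    HasDerivAt (fun s => f s * g s) (f r * g r * (l + l')) r :=
  (hf.fun_mul hg).congr_deriv (by ring)

lemma hasDerivAt_inv_of_log {f : ℝ → ℝ} {l r : ℝ} (hf : HasDerivAt f (f r * l) r) (h0 : f r ≠ 0) :
    HasDerivAt (fun s => (f s)⁻¹) ((f r)⁻¹ * (-l)) r :=
  (hf.fun_inv h0).congr_deriv (by field_simp)

/-- `r` times the logarithmic derivative of `r^(2p+1-n) J^(n-2p)` is `1 - (n-2p)(1 - rJ'/J)`, and `1
- rJ'/J = θ`. -/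
lemma hasDerivAt_starFactor {J r : ℝ} (hr : r ≠ 0) (hJ : Jfun n J r ≠ 0) (p : ℕ) :
    HasDerivAt (starFactor n J p)
      (starFactor n J p r * (1 - (n - 2 * p) * thetaFun n J r) / r) r := by
  have hJ' : HasDerivAt (Jfun n J) (Jfun n J r * (-(J / (2 * n) * (2 * r)) / Jfun n J r)) r :=
    (hasDerivAt_Jfun n J r).congr_deriv (by field_simp)
  have hid : HasDerivAt (fun s : ℝ => s) (r * (1 / r)) r :=
    (hasDerivAt_id' r).congr_deriv (by field_simp)
  have h1 := hasDerivAt_mul_of_log (hasDerivAt_mul_of_log (hasDerivAt_mul_of_log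
    (hasDerivAt_inv_of_log (hasDerivAt_pow_of_log hid (n + 1)) (pow_ne_zero _ hr))
    (hasDerivAt_pow_of_log hJ' n))
    (hasDerivAt_pow_of_log (hasDerivAt_mul_of_log hid (hasDerivAt_inv_of_log hJ' hJ)) (2 * p)))
    (hasDerivAt_pow_of_log hid 2)
  refine HasDerivAt.congr_deriv (f := starFactor n J p) h1 ?_
  simp only [starFactor, thetaFun, ← div_eq_mul_inv]
  rw [mul_div_assoc]
  congr 1
  push_cast
  have e : Jfun n J r = 1 - J / (2 * n) * r ^ 2 := rfl
  generalize J / (2 * (n : ℝ)) = κ at *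
  field_simp
  rw [e]
  ring

lemma alternating_eq_zero {V F : Type*} [AddCommGroup V] [Module ℝ V] [TopologicalSpace V]
    [NormedAddCommGroup F] [NormedSpace ℝ F] {p : ℕ} (hdim : Module.finrank ℝ V = n) (hn : n ≠ 0)
    (hp : n < p) (η : V [⋀^Fin p]→L[ℝ] F) : η = 0 := by
  have : Module.Finite ℝ V := Module.finite_of_finrank_pos (by omega)
  ext v
  refine η.toAlternatingMap.map_linearDependent v fun hv => ?_
  have := hv.fintype_card_le_finrank
  simp at this
  omega

lemma form_eq_zero (hn : n ≠ 0) {p : ℕ} (hp : n < p) (η : DForm (𝓡 n) M ℂ p) : η = 0 :=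
  funext fun x => alternating_eq_zero (finrank_tangentSpace x) hn hp (η x)

lemma pull_zero {p : ℕ} (z : M × ℝ) : pull (0 : DForm (𝓡 n) M ℂ p) z = 0 := rfl

lemma pull_add {p : ℕ} (α β : DForm (𝓡 n) M ℂ p) (z : M × ℝ) :
    pull (α + β) z = pull α z + pull β z := rfl

lemma pull_smul {p : ℕ} (a : ℂ) (α : DForm (𝓡 n) M ℂ p) (z : M × ℝ) :
    pull (a • α) z = a • pull α z := rfl

lemma drPull_smul {p : ℕ} (a : ℂ) (α : DForm (𝓡 n) M ℂ p) (z : M × ℝ) :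
    drPull (a • α) z = a • drPull α z := by
  rw [drPull, drPull, pull_smul, wedge_smul]

lemma drPull_add {p : ℕ} (α β : DForm (𝓡 n) M ℂ p) (z : M × ℝ) :
    drPull (α + β) z = drPull α z + drPull β z := by
  rw [drPull, drPull, drPull, pull_add, wedge_add]

lemma drPull_zero {p : ℕ} (z : M × ℝ) : drPull (0 : DForm (𝓡 n) M ℂ p) z = 0 := by
  rw [drPull, pull_zero, wedge_zero]

lemma eventually_regular (x : M) {J r : ℝ} (hr : r ≠ 0) (hJ : Jfun n J r ≠ 0) :
    ∀ᶠ z : M × ℝ in 𝓝 (x, r), z.2 ≠ 0 ∧ Jfun n J z.2 ≠ 0 := by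
  have h1 : ∀ᶠ s : ℝ in 𝓝 r, s ≠ 0 ∧ Jfun n J s ≠ 0 :=
    (continuousAt_id.eventually_ne hr).and ((hasDerivAt_Jfun n J r).continuousAt.eventually_ne hJ)
  exact (continuousAt_snd (p := (x, r))).eventually h1

lemma hasDerivAt_ofReal_comp {f : ℝ → ℝ} {f' r : ℝ} (hf : HasDerivAt f f' r) :
    HasDerivAt (fun s => (f s : ℂ)) (f' : ℂ) r := hf.ofReal_comp

variable {h : RMetric n M} {vol : DForm (𝓡 n) M ℝ n}

/-- `⋆(f π^*α)` is a multiple of `dr ∧ π^*(⋆α)`, so the derivative of the radial factor is wedged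
away and `f'` does not occur. -/
lemma hasCodiff_pull (hn : n ≠ 0) (hvol : IsSmoothForm vol) {J : ℝ} {p q : ℕ}
    (hpq : p + 1 + q = n + 1) {α : DForm (𝓡 n) M ℂ (p + 1)}
    (hα : IsSmoothForm α) {f : ℝ → ℂ} {f' : ℂ} (x : M) {r : ℝ} (hr : r ≠ 0) (hJ : Jfun n J r ≠ 0)
    (hf : HasDerivAt f f' r) :
    HasCodiff (gPlus h J) (volPlus vol J) hpq (fun z : M × ℝ => f z.2 • pull α z) (x, r)
      ((f r * ((r / Jfun n J r) ^ 2 : ℝ)) • pull (codiffSucc h.toFun vol α) (x, r)) := by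
  rcases q with _ | q
  -- For `q = 0` the form `α` would have degree `n + 1`.
  · have h0 : α = 0 := form_eq_zero hn (by omega) α
    rw [codiffSucc_of_lt _ _ (by omega), pull_zero, smul_zero]
    refine (hasCodiff_zero hpq (x, r)).congr (Eventually.of_forall fun w => ?_)
    rw [h0, pull_zero, smul_zero]
    rfl
  · have hpq' : p + 1 + q = n := by omega
    have hqp' : q + 1 + p = n := by omega
    have hqp : q + 1 + 1 + p = n + 1 := by omega
    have hs := IsSmoothForm.starForm (h := h) hvol hpq' hα
    set F : ℝ → ℂ := fun s =>
      f s * ((-1 : ℂ) ^ (p + 1) * (starFactor n J (p + 1) s / s ^ 2 : ℝ)) with hF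
    have hF' : ∃ F', HasDerivAt F F' r := ⟨_, hf.mul ((hasDerivAt_ofReal_comp
      ((hasDerivAt_starFactor hr hJ (p + 1)).div ((hasDerivAt_pow 2 r)) (pow_ne_zero 2 hr))).const_mul _)⟩
    obtain ⟨F', hF'⟩ := hF'
    have h1 := (hasExtD_drPull hs x hF').congr (Ω' := starPlus h vol J hpq
      (fun z : M × ℝ => f z.2 • pull α z)) (by
        filter_upwards [eventually_regular x hr hJ] with w hw
        refine (hodgeStar_smul _ _ _ _).trans ?_
        refine (congrArg (f w.2 • ·) (starPlus_pull hn h vol hw.1 hw.2 hpq hpq' α)).trans ?_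
        exact smul_smul _ _ _)
    have h2 := hasCodiff_of_hasExtD hqp h1
    refine ⟨h2.1, h2.2.trans ?_⟩
    have h3 := starPlus_drPull hn h vol (z := (x, r)) hr hJ hqp hqp' (extD (starForm h vol hpq' α))
    rw [← neg_smul, hodgeStar_smul]
    refine (congrArg (fun y => (-1 : ℂ) ^ (p + 1 + p * (q + 1 + 1)) • (-F r) • y) h3).trans ?_
    rw [codiffSucc_eq_starForm hpq' hqp', pull_smul, smul_smul, smul_smul, smul_smul]
    congr 1
    rw [← starFactor_mul_succ (n := n) (p := p) (q := q) hr hJ (by omega), hF]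
    push_cast
    have e1 : ((-1 : ℂ) ^ (p + 1)) = - (-1) ^ p := by ring
    have e2 : ((-1 : ℂ) ^ p) * (-1) ^ p = 1 := by rw [← mul_pow]; simp
    have e3 : ((-1 : ℂ) ^ (p + 1 + p * (q + 1 + 1))) = (-1 : ℂ) ^ (p + 1 + p * (q + 1)) * (-1) ^ p := by
      ring
    rw [e3, e1]
    linear_combination (f r * (starFactor n J (p + 1) r * starFactor n J (q + 1) r / r ^ 2) *
      (-1 : ℂ) ^ (p + 1 + p * (q + 1))) * e2

/-- `r (1 - β θ(r))`. -/
def driftFun (n : ℕ) (J β r : ℝ) : ℝ := r * (1 - β * thetaFun n J r)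

lemma drWedge_add {p : ℕ} (γ γ' : LowForm (𝓡 n) M p) (z : M × ℝ) :
    drWedge (γ + γ') z = drWedge γ z + drWedge γ' z := by
  rcases p with _ | k
  · exact (add_zero _).symm
  · exact drPull_add (n := n) (p := k) γ γ' z

lemma drWedge_smul {p : ℕ} (a : ℂ) (γ : LowForm (𝓡 n) M p) (z : M × ℝ) :
    drWedge (a • γ) z = a • drWedge γ z := by
  rcases p with _ | k
  · exact (smul_zero _).symm
  · exact drPull_smul (n := n) (p := k) a γ z

/-- With `F` the star factor, `⋆(f dr ∧ π^*γ) = fF π^*(⋆γ)`. Its differential has the part `(fF)' dr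
∧ π^*(⋆γ)`, which `⋆⋆ = ±1` returns to a multiple of `π^*γ`, and the part `fF π^*(d⋆γ)`, which
yields `dr ∧ π^*(δγ)`. -/
lemma hasCodiff_drPull (hn : n ≠ 0) (hvol : IsVolumeForm h.toFun vol) {J : ℝ} {p q : ℕ}
    (hpq : p + 1 + q = n + 1) {γ : DForm (𝓡 n) M ℂ p}
    (hγ : IsSmoothForm γ) {f : ℝ → ℂ} {f' : ℂ} (x : M) {r : ℝ} (hr : r ≠ 0) (hJ : Jfun n J r ≠ 0)
    (hf : HasDerivAt f f' r) :
    HasCodiff (gPlus h J) (volPlus vol J) hpq (fun z : M × ℝ => f z.2 • drPull γ z) (x, r)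
      (-(r ^ 2 * f' + driftFun n J (n - 2 * p) r * f r) • pull γ (x, r) +
        (-(f r * ((r / Jfun n J r) ^ 2 : ℝ))) • drWedge (codiff h.toFun vol γ) (x, r)) := by
  have hpq' : p + q = n := by omega
  have hqp' : q + p = n := by omega
  have hqp : q + 1 + p = n + 1 := by omega
  have hs := IsSmoothForm.starForm (h := h) hvol.1 hpq' hγ
  set F : ℝ → ℂ := fun s => f s * starFactor n J p s with hF
  set m : ℝ := 1 - (n - 2 * p) * thetaFun n J r with hm
  have hF' : HasDerivAt F (f' * starFactor n J p r + f r * (starFactor n J p r * m / r : ℝ)) r :=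
    hf.fun_mul (hasDerivAt_ofReal_comp (hasDerivAt_starFactor hr hJ p))
  have h1 := (hasExtD_pull hs x hF').congr (Ω' := starPlus h vol J hpq
    (fun z : M × ℝ => f z.2 • drPull γ z)) (by
      filter_upwards [eventually_regular x hr hJ] with w hw
      refine (hodgeStar_smul _ _ _ _).trans ?_
      refine (congrArg (f w.2 • ·) (starPlus_drPull hn h vol hw.1 hw.2 hpq hpq' γ)).trans ?_
      exact smul_smul _ _ _)
  have h2 := hasCodiff_of_hasExtD hqp h1
  refine ⟨h2.1, h2.2.trans ?_⟩
  have h3 := starPlus_drPull hn h vol (z := (x, r)) hr hJ hqp hqp' (starForm h vol hpq' γ)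
  rw [starForm_starForm hn hvol hpq' hqp', pull_smul] at h3
  rw [hodgeStar_add, hodgeStar_smul, hodgeStar_smul, smul_add]
  have e0 : ((-1 : ℂ) ^ (p + 1 + p * (q + 1))) * (-1) ^ (p * q) = -1 := by
    rw [← pow_add, show p + 1 + p * (q + 1) + p * q = 2 * (p + p * q) + 1 by ring, pow_succ, pow_mul]
    simp
  have hrc : (r : ℂ) ≠ 0 := by exact_mod_cast hr
  refine congrArg₂ (· + ·) ?_ ?_
  · refine (congrArg (fun y => (-1 : ℂ) ^ (p + 1 + p * (q + 1)) •
      (f' * starFactor n J p r + f r * (starFactor n J p r * m / r : ℝ)) • y) h3).trans ?_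
    rw [smul_smul, smul_smul, smul_smul]
    congr 1
    have e1 : (starFactor n J p r : ℂ) * starFactor n J q r = r ^ 2 := by
      exact_mod_cast starFactor_mul hr hJ hpq'
    rw [driftFun, ← hm]
    push_cast
    calc _ = ((-1 : ℂ) ^ (p + 1 + p * (q + 1)) * (-1) ^ (p * q)) *
          (starFactor n J p r * starFactor n J q r) * (f' + f r * m / r) := by ring
      _ = _ := by
        rw [e0, e1]
        field_simp
  · rcases p with _ | k
    -- For a function `γ` the form `d⋆γ` has degree `n + 1`.
    · have h0 : extD (starForm h vol hpq' γ) = 0 := form_eq_zero hn (by omega) _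
      rw [h0, pull_zero, hodgeStar_zero]
      ext v
      change (-1 : ℂ) ^ (0 + 1 + 0 * (q + 1)) * (F r * 0) = -(f r * ((r / Jfun n J r) ^ 2 : ℝ)) * 0
      ring
    · have hqk : q + 1 + k = n := by omega
      have h4 := starPlus_pull hn h vol (z := (x, r)) hr hJ (p := q + 1) (q := k) hqp hqk
        (extD (starForm h vol hpq' γ))
      refine (congrArg (fun y => (-1 : ℂ) ^ (k + 1 + 1 + (k + 1) * (q + 1)) • F r • y) h4).trans ?_
      have h5 : drWedge (p := k + 1) (codiff h.toFun vol γ) (x, r) =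
        drPull (codiffSucc h.toFun vol γ) (x, r) := rfl
      rw [h5, codiffSucc_eq_starForm hpq' hqk, drPull_smul, smul_smul, smul_smul, smul_smul]
      congr 1
      rw [← starFactor_mul_succ (n := n) (p := k) (q := q) hr hJ (by omega), hF]
      push_cast
      have e1 : ((-1 : ℂ) ^ (k + 1 + 1 + (k + 1) * (q + 1))) * (-1) ^ (q + 1) =
          -(-1) ^ (k + 1 + k * (q + 1)) := by
        rw [← pow_add, show k + 1 + 1 + (k + 1) * (q + 1) + (q + 1) =
          2 * (q + 1) + (k + 1 + k * (q + 1)) + 1 by ring, pow_succ, pow_add, pow_mul]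
        simp
      linear_combination (f r * (starFactor n J (k + 1) r * starFactor n J (q + 1) r / r ^ 2)) * e1

end PoincareHodge

/-! ### The Laplacian of the Poincaré–Einstein metric on separated forms -/

section PoincareLaplacian

set_option linter.unusedSectionVars false

variable {n : ℕ} {M : Type*} [TopologicalSpace M] [ChartedSpace (EuclideanSpace ℝ (Fin n)) M]
  [IsManifold (𝓡 n) ∞ M] {h : RMetric n M} {vol : DForm (𝓡 n) M ℝ n}

lemma eventually_snd {P : ℝ → Prop} (x : M) {r : ℝ} (hP : ∀ᶠ s in 𝓝 r, P s) :
    ∀ᶠ z : M × ℝ in 𝓝 (x, r), P z.2 :=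
  (continuousAt_snd (p := (x, r))).eventually hP

lemma hasDerivAt_sq_div_Jfun {J r : ℝ} (hJ : Jfun n J r ≠ 0) :
    HasDerivAt (fun s => (s / Jfun n J s) ^ 2)
      (2 * r * (1 + J / (2 * n) * r ^ 2) / Jfun n J r ^ 3) r := by
  have h1 := ((hasDerivAt_id' r).fun_div (hasDerivAt_Jfun n J r) hJ).fun_pow 2
  refine h1.congr_deriv ?_
  have e : Jfun n J r = 1 - J / (2 * n) * r ^ 2 := rfl
  generalize J / (2 * (n : ℝ)) = κ at *
  rw [div_pow]
  field_simp
  rw [e]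
  push_cast
  ring

lemma hasDerivAt_thetaFun {J r : ℝ} (hJ : Jfun n J r ≠ 0) :
    HasDerivAt (thetaFun n J) (4 * (J / (2 * n)) * r / Jfun n J r ^ 2) r := by
  have h1 := (((hasDerivAt_pow 2 r).const_mul (J / (2 * n))).const_add 1).fun_div
    (hasDerivAt_Jfun n J r) hJ
  refine HasDerivAt.congr_deriv (f := thetaFun n J) h1 ?_
  have e : Jfun n J r = 1 - J / (2 * n) * r ^ 2 := rfl
  generalize J / (2 * (n : ℝ)) = κ at *
  field_simp
  rw [e]
  ring

lemma hasDerivAt_driftFun {J r : ℝ} (β : ℝ) (hJ : Jfun n J r ≠ 0) :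
    HasDerivAt (driftFun n J β)
      (1 - β * thetaFun n J r - β * r * (4 * (J / (2 * n)) * r / Jfun n J r ^ 2)) r := by
  have h1 := (hasDerivAt_id' r).fun_mul (((hasDerivAt_thetaFun (n := n) hJ).const_mul β).const_sub 1)
  refine HasDerivAt.congr_deriv (f := driftFun n J β) h1 ?_
  ring

/-- In front of `dr ∧ π^*(δα)` the terms with `f'` from `δd` and from `dδ` cancel; only `f` times
the derivative of `(r/J)²` is left. -/
lemma hasLaplacian_pull (hn : n ≠ 0) (hvol : IsVolumeForm h.toFun vol) {J : ℝ} {p : ℕ} (hp : p ≤ n)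
    {α : DForm (𝓡 n) M ℂ p} (hα : IsSmoothForm α) {f f' : ℝ → ℂ} {f'' : ℂ} (x : M) {r : ℝ}
    (hr : r ≠ 0) (hJ : Jfun n J r ≠ 0) (hf : ∀ᶠ s in 𝓝 r, HasDerivAt f (f' s) s)
    (hf' : HasDerivAt f' f'' r) :
    HasLaplacian (gPlus h J) (volPlus vol J) (fun z : M × ℝ => f z.2 • pull α z) (x, r)
      ((f r * ((r / Jfun n J r) ^ 2 : ℝ)) • pull (formLaplacian h.toFun vol α) (x, r) +
        (-(r ^ 2 * f'' + driftFun n J (n - 2 * p) r * f' r)) • pull α (x, r) +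
        (f r * (2 * r * (1 + J / (2 * n) * r ^ 2) / Jfun n J r ^ 3 : ℝ)) •
          drWedge (codiff h.toFun vol α) (x, r)) := by
  obtain ⟨q, hq⟩ := Nat.exists_eq_add_of_le hp
  have hpq : p + 1 + q = n + 1 := by omega
  have hup : HasUpperLaplacian (gPlus h J) (volPlus vol J) (fun z : M × ℝ => f z.2 • pull α z) (x, r)
      ((-(r ^ 2 * f'' + driftFun n J (n - 2 * p) r * f' r) • pull α (x, r) +
        (-(f' r * ((r / Jfun n J r) ^ 2 : ℝ))) • drWedge (codiff h.toFun vol α) (x, r)) +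
        (f r * ((r / Jfun n J r) ^ 2 : ℝ)) • pull (codiffSucc h.toFun vol (extD α)) (x, r)) := by
    refine ⟨q, hpq, (fun z : M × ℝ => f' z.2 • drPull α z) + fun z : M × ℝ => f z.2 • pull (extD α) z,
      ?_, (hasCodiff_drPull hn hvol hpq hα x hr hJ hf').add
        (hasCodiff_pull hn hvol.1 hpq hα.extD x hr hJ hf.self_of_nhds)⟩
    filter_upwards [eventually_snd x hf] with w hw
    exact hasExtD_pull hα w.1 hw
  have hlow : HasLowerLaplacian (gPlus h J) (volPlus vol J) (fun z : M × ℝ => f z.2 • pull α z) (x, r)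
      ((f' r * ((r / Jfun n J r) ^ 2 : ℝ) +
          f r * (2 * r * (1 + J / (2 * n) * r ^ 2) / Jfun n J r ^ 3 : ℝ)) •
          drWedge (codiff h.toFun vol α) (x, r) +
        (f r * ((r / Jfun n J r) ^ 2 : ℝ)) • pull (extDLow (codiff h.toFun vol α)) (x, r)) := by
    rcases p with _ | k
    · ext v
      exact (congrArg₂ (· + ·) (mul_zero _) (mul_zero _)).trans (add_zero (0 : ℂ))
    · refine ⟨q + 1, by omega, fun z => (f z.2 * ((z.2 / Jfun n J z.2) ^ 2 : ℝ)) •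
        pull (codiffSucc h.toFun vol α) z, ?_, ?_⟩
      · filter_upwards [eventually_snd x hf, eventually_regular x hr hJ] with w hw hw'
        exact hasCodiff_pull hn hvol.1 _ hα w.1 hw'.1 hw'.2 hw
      · exact hasExtD_pull (IsSmoothForm.codiffSucc hvol.1 hα) x
          (f := fun s => f s * ((s / Jfun n J s) ^ 2 : ℝ))
          (hf.self_of_nhds.fun_mul (hasDerivAt_ofReal_comp (hasDerivAt_sq_div_Jfun hJ)))
  refine ⟨_, _, hlow, hup, ?_⟩
  rw [formLaplacian, pull_add]
  module

lemma drWedge_formLaplacianLow {k : ℕ} (γ : DForm (𝓡 n) M ℂ k) (z : M × ℝ) :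
    drWedge (p := k + 1) (formLaplacianLow h.toFun vol γ) z =
      drPull (formLaplacian h.toFun vol γ) z := rfl

/-- The coefficient of `π^*(dγ)` is the difference of the drift terms for the degrees `p` and `p -
1`: with `β = n - 2p`, `r(1 - βθ) - r(1 - (β+2)θ) = 2rθ`. For `p = 0` everything vanishes. -/
lemma hasLaplacian_drWedge (hn : n ≠ 0) (hvol : IsVolumeForm h.toFun vol) {J : ℝ} {p : ℕ}
    (hp : p ≤ n) {γ : LowForm (𝓡 n) M p} (hγ : IsSmoothLow γ) {f f' : ℝ → ℂ} {f'' : ℂ} (x : M)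
    {r : ℝ} (hr : r ≠ 0) (hJ : Jfun n J r ≠ 0) (hf : ∀ᶠ s in 𝓝 r, HasDerivAt f (f' s) s)
    (hf' : HasDerivAt f' f'' r) :
    HasLaplacian (gPlus h J) (volPlus vol J) (fun z : M × ℝ => f z.2 • drWedge γ z) (x, r)
      ((f r * (2 * r * thetaFun n J r : ℝ)) • pull (extDLow γ) (x, r) +
        (f r * ((r / Jfun n J r) ^ 2 : ℝ)) • drWedge (formLaplacianLow h.toFun vol γ) (x, r) +
        (-(2 * r * f' r + r ^ 2 * f'' + driftFun n J (n - 2 * p + 2) r * f' r +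
          (1 - (n - 2 * p + 2) * thetaFun n J r - (n - 2 * p + 2) * r *
            (4 * (J / (2 * n)) * r / Jfun n J r ^ 2) : ℝ) * f r)) • drWedge γ (x, r)) := by
  obtain ⟨q, hq⟩ := Nat.exists_eq_add_of_le hp
  have hpq : p + 1 + q = n + 1 := by omega
  rcases p with _ | k
  · refine ⟨0, 0, rfl, ⟨q, hpq, 0, ?_, hasCodiff_zero _ _⟩, ?_⟩
    · refine Eventually.of_forall fun w => (hasExtD_zero w).congr (Eventually.of_forall fun w => ?_)
      exact smul_zero _
    · ext v
      exact congrArg₂ (fun a b : ℂ => a + b)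
        ((congrArg₂ (fun a b : ℂ => a + b) (mul_zero _) (mul_zero _)).trans (add_zero 0)) (mul_zero _)
  change DForm (𝓡 n) M ℂ k at γ
  have hγ' : IsSmoothForm γ := hγ
  have hup : HasUpperLaplacian (gPlus h J) (volPlus vol J) (fun z : M × ℝ => f z.2 • drPull γ z) (x, r)
      (-(r ^ 2 * -f' r + driftFun n J (n - 2 * (k + 1 : ℕ)) r * -f r) • pull (extD γ) (x, r) +
        (-(-f r * ((r / Jfun n J r) ^ 2 : ℝ))) • drPull (codiffSucc h.toFun vol (extD γ)) (x, r)) := by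
    refine ⟨q, hpq, fun z => (-f z.2) • drPull (extD γ) z, ?_,
      hasCodiff_drPull hn hvol hpq hγ'.extD x hr hJ (f := fun s => -f s) hf.self_of_nhds.neg⟩
    filter_upwards [eventually_snd x hf] with w hw
    rw [neg_smul]
    exact hasExtD_drPull hγ' w.1 hw
  set F : ℝ → ℂ := fun s => -(s ^ 2 * f' s + driftFun n J (n - 2 * k) s * f s) with hF
  have hF' : HasDerivAt F (-(2 * r * f' r + r ^ 2 * f'' + ((1 - (n - 2 * k) * thetaFun n J r -
      (n - 2 * k) * r * (4 * (J / (2 * n)) * r / Jfun n J r ^ 2) : ℝ) * f r +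
      driftFun n J (n - 2 * k) r * f' r))) r := by
    have h1 : HasDerivAt (fun s : ℝ => (s : ℂ) ^ 2) (2 * r) r := by
      have := hasDerivAt_ofReal_comp (hasDerivAt_pow 2 r)
      simpa using this
    exact ((h1.fun_mul hf').add ((hasDerivAt_ofReal_comp (hasDerivAt_driftFun _ hJ)).fun_mul
      hf.self_of_nhds)).neg
  set G : ℝ → ℂ := fun s => -(f s * ((s / Jfun n J s) ^ 2 : ℝ)) with hG
  have hG' : ∃ G', HasDerivAt G G' r :=
    ⟨_, (hf.self_of_nhds.fun_mul (hasDerivAt_ofReal_comp (hasDerivAt_sq_div_Jfun hJ))).neg⟩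
  obtain ⟨G', hG'⟩ := hG'
  have hlow : HasLowerLaplacian (gPlus h J) (volPlus vol J) (fun z : M × ℝ => f z.2 • drPull γ z) (x, r)
      (((-(2 * r * f' r + r ^ 2 * f'' + ((1 - (n - 2 * k) * thetaFun n J r -
        (n - 2 * k) * r * (4 * (J / (2 * n)) * r / Jfun n J r ^ 2) : ℝ) * f r +
        driftFun n J (n - 2 * k) r * f' r))) • drPull γ (x, r) + F r • pull (extD γ) (x, r)) +
        (-G r) • drPull (extDLow (codiff h.toFun vol γ)) (x, r)) := by
    refine ⟨q + 1, by omega, (fun z => F z.2 • pull γ z) + fun z => G z.2 •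
        drWedge (codiff h.toFun vol γ) z, ?_, (hasExtD_pull hγ' x hF').add ?_⟩
    · filter_upwards [eventually_snd x hf, eventually_regular x hr hJ] with w hw hw'
      exact hasCodiff_drPull hn hvol _ hγ' w.1 hw'.1 hw'.2 hw
    · rcases k with _ | l
      · have e0 : (-G r) • drPull (extDLow (codiff h.toFun vol γ)) (x, r) = 0 := by
          rw [show extDLow (codiff h.toFun vol γ) = 0 from rfl, drPull_zero, smul_zero]
        rw [e0]
        refine ((hasExtD_zero (x, r)).congr (Eventually.of_forall fun w => ?_))
        ext v
        exact mul_zero _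
      · have := hasExtD_drPull (IsSmoothForm.codiffSucc (h := h) hvol.1 hγ') x hG'
        rw [← neg_smul] at this
        exact this
  refine ⟨_, _, hlow, hup, ?_⟩
  have e1 : drWedge (p := k + 1) γ (x, r) = drPull γ (x, r) := rfl
  have e2 : pull (extDLow (p := k + 1) γ) (x, r) = pull (extD γ) (x, r) := rfl
  rw [drWedge_formLaplacianLow, e1, e2, formLaplacian, drPull_add, hF, hG]
  simp only [driftFun]
  push_cast
  module

end PoincareLaplacian

/-! ### Asymptotic expansions -/

section Expansion

/-- The function `r^λ (1 - κ r²)⁻³ Q(r)`. -/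
def expansionFun (lam : ℂ) (κ : ℝ) (Q : ℂ[X]) (r : ℝ) : ℂ :=
  (r : ℂ) ^ lam * ((((1 - κ * r ^ 2 : ℝ) : ℂ) ^ 3)⁻¹ * Q.eval (r : ℂ))

/-- Here `Q = X^m Q₁` with `Q₁(0)` the coefficient in question, and `(1 - κr²)⁻³ → 1`. -/
lemma tendsto_expansionFun (lam : ℂ) (κ : ℝ) {Q : ℂ[X]} {m : ℕ} (hQ : ∀ i < m, Q.coeff i = 0) :
    Tendsto (fun r : ℝ => ‖expansionFun lam κ Q r‖ / r ^ (lam.re + m)) (𝓝[>] 0)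
      (𝓝 ‖Q.coeff m‖) := by
  obtain ⟨Q₁, rfl⟩ := X_pow_dvd_iff.2 hQ
  have hc : (X ^ m * Q₁).coeff m = Q₁.eval 0 := by
    have := coeff_X_pow_mul Q₁ m 0
    rw [zero_add] at this
    rw [this, coeff_zero_eq_eval_zero]
  have h1 : Tendsto (fun r : ℝ => ‖(((1 - κ * r ^ 2 : ℝ) : ℂ) ^ 3)⁻¹ * Q₁.eval (r : ℂ)‖) (𝓝[>] 0)
      (𝓝 ‖(((1 - κ * 0 ^ 2 : ℝ) : ℂ) ^ 3)⁻¹ * Q₁.eval ((0 : ℝ) : ℂ)‖) := by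
    refine Tendsto.mono_left ?_ nhdsWithin_le_nhds
    refine (ContinuousAt.norm (ContinuousAt.mul (ContinuousAt.inv₀ ?_ ?_) ?_)).tendsto
    · exact (Complex.continuous_ofReal.comp (by fun_prop)).continuousAt.pow 3
    · simp
    · exact (Q₁.continuous.comp Complex.continuous_ofReal).continuousAt
  rw [hc]
  simp only [Complex.ofReal_zero] at h1
  have e : (((1 - κ * 0 ^ 2 : ℝ) : ℂ) ^ 3)⁻¹ * Q₁.eval 0 = Q₁.eval 0 := by simp
  rw [e] at h1
  refine h1.congr' ?_
  filter_upwards [self_mem_nhdsWithin] with r (hr : 0 < r)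
  have h2 : 0 < r ^ lam.re := Real.rpow_pos_of_pos hr _
  have h3 : ‖expansionFun lam κ (X ^ m * Q₁) r‖ =
      r ^ lam.re * (r ^ m * ‖(((1 - κ * r ^ 2 : ℝ) : ℂ) ^ 3)⁻¹ * Q₁.eval (r : ℂ)‖) := by
    rw [expansionFun, norm_mul ((r : ℂ) ^ lam), Complex.norm_cpow_eq_rpow_re_of_pos hr, eval_mul,
      eval_pow, eval_X, mul_left_comm _ ((r : ℂ) ^ m), norm_mul ((r : ℂ) ^ m), norm_pow,
      Complex.norm_real, Real.norm_of_nonneg hr.le]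
  rw [h3, Real.rpow_add hr, Real.rpow_natCast]
  field_simp

/-- Once the lower coefficients are known to vanish, the next one is, up to modulus, a limit of
quotients that also tend to zero. -/
lemma expansionFun_isLittleO_iff (lam : ℂ) (κ : ℝ) (Q : ℂ[X]) (K : ℕ) :
    (expansionFun lam κ Q =o[𝓝[>] 0] fun r : ℝ => r ^ (lam.re + K)) ↔
      ∀ m ≤ K, Q.coeff m = 0 := by
  have hpos : ∀ m : ℕ, ∀ᶠ r : ℝ in 𝓝[>] 0, 0 < r ^ (lam.re + m) := by
    intro m
    filter_upwards [self_mem_nhdsWithin] with r (hr : 0 < r)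
    exact Real.rpow_pos_of_pos hr _
  have key : ∀ m : ℕ, (expansionFun lam κ Q =o[𝓝[>] 0] fun r : ℝ => r ^ (lam.re + m)) ↔
      Tendsto (fun r : ℝ => ‖expansionFun lam κ Q r‖ / r ^ (lam.re + m)) (𝓝[>] 0) (𝓝 0) := by
    intro m
    rw [← Asymptotics.isLittleO_norm_left, Asymptotics.isLittleO_iff_tendsto']
    filter_upwards [hpos m] with r hr h0
    exact absurd h0 hr.ne'
  constructor
  · intro h m
    induction m using Nat.strong_induction_on with
    | _ m ih =>
      intro hm
      have h1 := tendsto_expansionFun lam κ (Q := Q) (m := m) fun i hi => ih i hi (by omega)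
      have h2 : (fun r : ℝ => r ^ (lam.re + K)) =O[𝓝[>] 0] fun r : ℝ => r ^ (lam.re + m) := by
        refine Asymptotics.IsBigO.of_bound 1 ?_
        filter_upwards [Ioo_mem_nhdsGT (show (0 : ℝ) < 1 by norm_num)] with r hr
        rw [one_mul, Real.norm_of_nonneg (Real.rpow_nonneg hr.1.le _),
          Real.norm_of_nonneg (Real.rpow_nonneg hr.1.le _)]
        refine Real.rpow_le_rpow_of_exponent_ge hr.1 hr.2.le ?_
        have : (m : ℝ) ≤ K := by exact_mod_cast hm
        linarith
      have h3 := (key m).1 (h.trans_isBigO h2)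
      exact norm_eq_zero.1 (tendsto_nhds_unique h1 h3)
  · intro h
    rw [key]
    have := tendsto_expansionFun lam κ (Q := Q) (m := K) fun i hi => h i hi.le
    rwa [h K le_rfl, norm_zero] at this

/-- The polynomial `∑_{j ≤ K} f(j) X^{j+i}`. -/
def shiftPoly (K : ℕ) (f : ℕ → ℂ) (i : ℕ) : ℂ[X] :=
  ∑ j ∈ Finset.range (K + 1), C (f j) * X ^ (j + i)

/-- In degrees at most `K` the truncation of the sum is invisible. -/
lemma coeff_shiftPoly {K m : ℕ} (hm : m ≤ K) (f : ℕ → ℂ) (i : ℕ) :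
    (shiftPoly K f i).coeff m = prev f m i := by
  simp only [shiftPoly, finsetSum_coeff, coeff_C_mul_X_pow, prev]
  split_ifs with hi
  · rw [Finset.sum_eq_single (m - i)]
    · rw [if_pos (by omega)]
    · intro j _ hj
      rw [if_neg (by omega)]
    · intro hj
      simp at hj
      omega
  · refine Finset.sum_eq_zero fun j _ => ?_
    rw [if_neg (by omega)]

lemma eval_shiftPoly (K : ℕ) (f : ℕ → ℂ) (i : ℕ) (z : ℂ) :
    (shiftPoly K f i).eval z = ∑ j ∈ Finset.range (K + 1), z ^ j * (f j * z ^ i) := by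
  rw [shiftPoly, eval_finsetSum]
  refine Finset.sum_congr rfl fun j _ => ?_
  simp only [eval_mul, eval_C, eval_pow, eval_X]
  ring

/-- A term `j` shifted by `i` lands in degree `m = j + i`; this lets the coefficients of (2) be
evaluated at the new index. -/
lemma prev_mul_cast (g : ℂ → ℂ) (f : ℕ → ℂ) (m i : ℕ) :
    prev (fun j => g (j + i) * f j) m i = g m * prev f m i := by
  simp only [prev]
  split_ifs with h
  · rw [Nat.cast_sub h, sub_add_cancel]
  · simp

lemma map_prev {V W : Type*} [Zero V] [Zero W] (φ : V → W) (h0 : φ 0 = 0) (w : ℕ → V) (m i : ℕ) :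
    prev (fun j => φ (w j)) m i = φ (prev w m i) := by
  simp only [prev]
  split_ifs
  · rfl
  · exact h0.symm

lemma hasDerivAt_cpow_mul_inv_pow (a : ℂ) (k : ℕ) {s : ℝ} (hs : 0 < s) :
    HasDerivAt (fun s : ℝ => (s : ℂ) ^ a * ((s : ℂ)⁻¹) ^ k)
      ((a - k) * ((s : ℂ) ^ a * ((s : ℂ)⁻¹) ^ (k + 1))) s := by
  have hs0 : (s : ℂ) ≠ 0 := by exact_mod_cast hs.ne'
  have h1 : HasDerivAt (fun s : ℝ => (s : ℂ) ^ a) (a * (s : ℂ) ^ (a - 1) * 1) s :=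
    ((hasDerivAt_id (s : ℂ)).cpow_const (c := a) (by simp [hs])).comp_ofReal
  have h2 : HasDerivAt (fun s : ℝ => ((s : ℂ)⁻¹) ^ k) _ s :=
    ((hasDerivAt_inv hs0).fun_pow k).comp_ofReal
  refine (h1.fun_mul h2).congr_deriv ?_
  rw [Complex.cpow_sub _ _ hs0, Complex.cpow_one]
  rcases k with _ | k
  · simp only [Nat.cast_zero]
    rw [pow_zero, pow_one]
    field_simp
    ring
  · rw [Nat.add_sub_cancel]
    push_cast
    simp only [inv_pow]
    field_simp
    ring

end Expansion

/-! ### Residues of the recurrence and the Laplacian of a single term of the expansion. -/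

section AsymptoticSolution

set_option linter.unusedSectionVars false

variable {n : ℕ} {M : Type*} [TopologicalSpace M] [ChartedSpace (EuclideanSpace ℝ (Fin n)) M]
  [IsManifold (𝓡 n) ∞ M] {h : RMetric n M} {vol : DForm (𝓡 n) M ℝ n}

lemma dr_bVector (x : M) (r : ℝ) (u : TangentSpace (𝓡 n) x × ℝ) :
    dr (x, r) (bVector x r u) = r * u.2 := by
  rw [dr_eq]; rfl

lemma dπ_bVector (x : M) (r : ℝ) (u : TangentSpace (𝓡 n) x × ℝ) :
    dπ (x, r) (bVector x r u) = u.1 := by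
  rw [dπ_eq]; rfl

/-- The evaluation of `π^* η` on the vectors `v_i + c_i r∂_r`. -/
def evalPull {p : ℕ} (x : M) (u : Fin p → TangentSpace (𝓡 n) x × ℝ) :
    DForm (𝓡 n) M ℂ p →ₗ[ℂ] ℂ where
  toFun η := η x fun i => (u i).1
  map_add' _ _ := rfl
  map_smul' _ _ := rfl

/-- The evaluation of `dr/r ∧ π^* γ` on the vectors `v_i + c_i r∂_r`. -/
def evalWedge {p : ℕ} (x : M) (u : Fin p → TangentSpace (𝓡 n) x × ℝ) :
    LowForm (𝓡 n) M p →ₗ[ℂ] ℂ where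
  toFun γ := drWedge γ (x, 1) fun i => bVector x 1 (u i)
  map_add' γ γ' := by rw [drWedge_add]; rfl
  map_smul' a γ := by rw [drWedge_smul]; rfl

lemma pull_bVector {p : ℕ} (x : M) (r : ℝ) (u : Fin p → TangentSpace (𝓡 n) x × ℝ)
    (η : DForm (𝓡 n) M ℂ p) : pull η (x, r) (fun i => bVector x r (u i)) = evalPull x u η :=
  congrArg (η x) (funext fun i => dπ_bVector x r (u i))

/-- Only `dr` sees the radial components, so the value is linear in `r`; with `dr/r` in place of
`dr` it does not depend on `r`. -/
lemma drWedge_bVector {p : ℕ} (x : M) (r : ℝ) (u : Fin p → TangentSpace (𝓡 n) x × ℝ)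
    (γ : LowForm (𝓡 n) M p) :
    drWedge γ (x, r) (fun i => bVector x r (u i)) = r * evalWedge x u γ := by
  rcases p with _ | k
  · exact (mul_zero _).symm
  · have key : ∀ s : ℝ, drWedge (p := k + 1) γ (x, s) (fun i => bVector x s (u i)) =
        s * ∑ i : Fin (k + 1), (-1 : ℤ) ^ (i : ℕ) • (u i).2 •
          DForm.toFun (p := k) (F := ℂ) γ x (fun j => (u (i.succAbove j)).1) := by
      intro s
      refine (wedge_apply _ _ _).trans ?_
      rw [Finset.mul_sum]
      refine Finset.sum_congr rfl fun i _ => ?_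
      have h1 : pull (p := k) γ (x, s) (i.removeNth fun i => bVector x s (u i)) =
          DForm.toFun (p := k) (F := ℂ) γ x (fun j => (u (i.succAbove j)).1) :=
        pull_bVector x s (fun j => u (i.succAbove j)) γ
      rw [h1, dr_bVector]
      simp only [zsmul_eq_mul, Complex.real_smul]
      push_cast
      ring
    have h1 : evalWedge (p := k + 1) x u γ = _ := key 1
    rw [key r, h1]
    simp

lemma evalPull_ext {p : ℕ} {η : DForm (𝓡 n) M ℂ p}
    (hη : ∀ x (v : Fin p → TangentSpace (𝓡 n) x), evalPull x (fun i => (v i, 0)) η = 0) : η = 0 := by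
  funext x
  ext v
  exact hη x v

lemma evalWedge_tangential {p : ℕ} (x : M) (v : Fin p → TangentSpace (𝓡 n) x)
    (γ : LowForm (𝓡 n) M p) : evalWedge x (fun i => (v i, 0)) γ = 0 := by
  rcases p with _ | k
  · rfl
  · refine (wedge_apply _ _ _).trans (Finset.sum_eq_zero fun i _ => ?_)
    rw [dr_bVector]
    simp

/-- A radial first vector followed by tangential ones recovers the values of `γ`. -/
lemma evalWedge_ext {p : ℕ} {γ : LowForm (𝓡 n) M p} (hγ : ∀ x u, evalWedge x u γ = 0) : γ = 0 := by
  rcases p with _ | k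
  · rfl
  · funext x
    ext v
    have h1 := hγ x (Fin.cons (0, 1) fun i => (v i, 0))
    have h2 : (fun i => bVector x 1 ((Fin.cons (0, 1) fun i => (v i, 0) :
        Fin (k + 1) → TangentSpace (𝓡 n) x × ℝ) i)) =
        Fin.cons (bVector x 1 (0, 1)) fun i => bVector x 1 (v i, 0) := by
      funext i
      refine Fin.cases ?_ (fun i => ?_) i <;> rfl
    have h3 := wedge_cons_of_eq_zero (π := dπ (x, (1 : ℝ))) (ρ := dr (x, (1 : ℝ)))
      (t := bVector x 1 (0, 1)) (dπ_bVector x 1 (0, 1)) (DForm.toFun (p := k) (F := ℂ) γ x)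
      (fun i => bVector x 1 (v i, 0))
    have h4 : drWedge (p := k + 1) γ (x, 1) (Fin.cons (bVector x 1 (0, 1)) fun i =>
      bVector x 1 (v i, 0)) = _ := h3
    change drWedge (p := k + 1) γ (x, 1) _ = 0 at h1
    rw [h2, h4, dr_bVector] at h1
    simp only [mul_one, one_smul] at h1
    exact (congrArg (DForm.toFun (p := k) (F := ℂ) γ x)
      (funext fun i => (dπ_bVector x 1 (v i, 0)).symm)).trans h1

/-- The residue of the recurrence relation for `ω_j^(+)`. -/
def residuePlus {p : ℕ} (h : RMetric n M) (vol : DForm (𝓡 n) M ℝ n) (c β lam : ℂ)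
    (wp : ℕ → DForm (𝓡 n) M ℂ p) (wm : ℕ → LowForm (𝓡 n) M p) (j : ℕ) : DForm (𝓡 n) M ℂ p :=
  (coeffb β lam j * c) • prev wp j 2 + (coeffc β lam j * c ^ 2) • prev wp j 4 +
    formLaplacian h.toFun vol (prev wp j 2) +
    (2 : ℂ) • extDLow (wm j) - (2 * c ^ 2) • extDLow (prev wm j 4) - coeffa β lam j • wp j

/-- The residue of the recurrence relation for `ω_j^(-)`. -/
def residueMinus {p : ℕ} (h : RMetric n M) (vol : DForm (𝓡 n) M ℝ n) (c β lam : ℂ)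
    (wp : ℕ → DForm (𝓡 n) M ℂ p) (wm : ℕ → LowForm (𝓡 n) M p) (j : ℕ) : LowForm (𝓡 n) M p :=
  (coeffB β lam j * c) • prev wm j 2 + (coeffC β lam j * c ^ 2) • prev wm j 4 +
    (coeffD β lam j * c ^ 3) • prev wm j 6 +
    formLaplacianLow h.toFun vol (prev wm j 2) -
    c • formLaplacianLow h.toFun vol (prev wm j 4) +
    (2 : ℂ) • codiff h.toFun vol (prev wp j 2) +
    (2 * c) • codiff h.toFun vol (prev wp j 4) - coeffA β lam j • wm j

lemma solvesRecurrence_iff {p : ℕ} {J : ℝ} {lam : ℂ} {wp : ℕ → DForm (𝓡 n) M ℂ p}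
    {wm : ℕ → LowForm (𝓡 n) M p} {K : ℕ} :
    SolvesRecurrence h vol J lam wp wm K ↔ ∀ j : ℕ, 1 ≤ j → j ≤ K →
      residueMinus h vol (J / (2 * n)) (n - 2 * p) lam wp wm j = 0 ∧
      residuePlus h vol (J / (2 * n)) (n - 2 * p) lam wp wm j = 0 := by
  simp only [SolvesRecurrence, residueMinus, residuePlus, sub_eq_zero (b := coeffa _ _ _ • _),
    sub_eq_zero (b := coeffA _ _ _ • _)]
  refine forall_congr' fun j => forall_congr' fun _ => forall_congr' fun _ => ?_
  exact and_congr eq_comm eq_comm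

lemma codiff_zero {p : ℕ} : codiff h.toFun vol (0 : DForm (𝓡 n) M ℂ p) = 0 := by
  rcases p with _ | k
  · rfl
  · exact codiffSucc_zero

lemma extDLow_zero {p : ℕ} : extDLow (0 : LowForm (𝓡 n) M p) = 0 := by
  rcases p with _ | k
  · rfl
  · exact extD_zero

lemma formLaplacian_zero {p : ℕ} : formLaplacian h.toFun vol (0 : DForm (𝓡 n) M ℂ p) = 0 := by
  rw [formLaplacian, codiff_zero, extDLow_zero, extD_zero, codiffSucc_zero, add_zero]

lemma formLaplacianLow_zero {p : ℕ} :
    formLaplacianLow h.toFun vol (0 : LowForm (𝓡 n) M p) = 0 := by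
  rcases p with _ | k
  · rfl
  · exact formLaplacian_zero

/-- The tangential coefficients of `J(r)² (Δ - λ(β-λ))` on a partial sum. -/
def polyPlus {p : ℕ} (h : RMetric n M) (vol : DForm (𝓡 n) M ℝ n) (c β lam : ℂ)
    (wp : ℕ → DForm (𝓡 n) M ℂ p) (wm : ℕ → LowForm (𝓡 n) M p) (K : ℕ) (x : M)
    (u : Fin p → TangentSpace (𝓡 n) x × ℝ) : ℂ[X] :=
  shiftPoly K (fun j => coeffb β lam (j + (2 : ℕ)) * c * evalPull x u (wp j)) 2 +
    shiftPoly K (fun j => coeffc β lam (j + (4 : ℕ)) * c ^ 2 * evalPull x u (wp j)) 4 +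
    shiftPoly K (fun j => evalPull x u (formLaplacian h.toFun vol (wp j))) 2 +
    C 2 * shiftPoly K (fun j => evalPull x u (extDLow (wm j))) 0 -
    C (2 * c ^ 2) * shiftPoly K (fun j => evalPull x u (extDLow (wm j))) 4 -
    shiftPoly K (fun j => coeffa β lam (j + (0 : ℕ)) * evalPull x u (wp j)) 0

/-- The radial coefficients of `J(r)³ (Δ - λ(β-λ))` on a partial sum. -/
def polyMinus {p : ℕ} (h : RMetric n M) (vol : DForm (𝓡 n) M ℝ n) (c β lam : ℂ)
    (wp : ℕ → DForm (𝓡 n) M ℂ p) (wm : ℕ → LowForm (𝓡 n) M p) (K : ℕ) (x : M)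
    (u : Fin p → TangentSpace (𝓡 n) x × ℝ) : ℂ[X] :=
  shiftPoly K (fun j => coeffB β lam (j + (2 : ℕ)) * c * evalWedge x u (wm j)) 2 +
    shiftPoly K (fun j => coeffC β lam (j + (4 : ℕ)) * c ^ 2 * evalWedge x u (wm j)) 4 +
    shiftPoly K (fun j => coeffD β lam (j + (6 : ℕ)) * c ^ 3 * evalWedge x u (wm j)) 6 +
    shiftPoly K (fun j => evalWedge x u (formLaplacianLow h.toFun vol (wm j))) 2 -
    C c * shiftPoly K (fun j => evalWedge x u (formLaplacianLow h.toFun vol (wm j))) 4 +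
    C 2 * shiftPoly K (fun j => evalWedge x u (codiff h.toFun vol (wp j))) 2 +
    C (2 * c) * shiftPoly K (fun j => evalWedge x u (codiff h.toFun vol (wp j))) 4 -
    shiftPoly K (fun j => coeffA β lam (j + (0 : ℕ)) * evalWedge x u (wm j)) 0

lemma prev_zero {V : Type*} [Zero V] (w : ℕ → V) (j : ℕ) : prev w j 0 = w j := by
  simp [prev]

lemma coeff_polyPlus {p : ℕ} {c β lam : ℂ} {wp : ℕ → DForm (𝓡 n) M ℂ p}
    {wm : ℕ → LowForm (𝓡 n) M p} {K m : ℕ} (hm : m ≤ K) (x : M)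
    (u : Fin p → TangentSpace (𝓡 n) x × ℝ) :
    (polyPlus h vol c β lam wp wm K x u).coeff m =
      evalPull x u (residuePlus h vol c β lam wp wm m) := by
  have h1 := map_prev (fun η => evalPull x u (formLaplacian h.toFun vol η))
    (by rw [formLaplacian_zero, map_zero]) wp m
  have h2 := map_prev (fun η => evalPull x u (extDLow η)) (by rw [extDLow_zero, map_zero]) wm m
  have h3 := map_prev (evalPull x u) (map_zero _) wp m
  simp only [polyPlus, coeff_sub, coeff_add, coeff_C_mul, coeff_shiftPoly hm]
  rw [prev_mul_cast (fun y => coeffb β lam y * c), prev_mul_cast (fun y => coeffc β lam y * c ^ 2),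
    prev_mul_cast (fun y => coeffa β lam y)]
  simp only [h1, h2, h3, prev_zero]
  simp only [residuePlus, map_add, map_sub, map_smul, smul_eq_mul]

lemma coeff_polyMinus {p : ℕ} {c β lam : ℂ} {wp : ℕ → DForm (𝓡 n) M ℂ p}
    {wm : ℕ → LowForm (𝓡 n) M p} {K m : ℕ} (hm : m ≤ K) (x : M)
    (u : Fin p → TangentSpace (𝓡 n) x × ℝ) :
    (polyMinus h vol c β lam wp wm K x u).coeff m =
      evalWedge x u (residueMinus h vol c β lam wp wm m) := by
  have h1 := map_prev (fun η => evalWedge x u (formLaplacianLow h.toFun vol η))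
    (by rw [formLaplacianLow_zero, map_zero]) wm m
  have h2 := map_prev (fun η => evalWedge x u (codiff h.toFun vol η))
    (by rw [codiff_zero, map_zero]) wp m
  have h3 := map_prev (evalWedge x u) (map_zero _) wm m
  simp only [polyMinus, coeff_sub, coeff_add, coeff_C_mul, coeff_shiftPoly hm]
  rw [prev_mul_cast (fun y => coeffB β lam y * c), prev_mul_cast (fun y => coeffC β lam y * c ^ 2),
    prev_mul_cast (fun y => coeffD β lam y * c ^ 3), prev_mul_cast (fun y => coeffA β lam y)]
  simp only [h1, h2, h3, prev_zero]
  simp only [residueMinus, map_add, map_sub, map_smul, smul_eq_mul]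

/-- A term of the expansion of an eigenform. -/
def expansionTerm {p : ℕ} (a : ℂ) (wp : DForm (𝓡 n) M ℂ p) (wm : LowForm (𝓡 n) M p) :
    DForm (modelX n) (M × ℝ) ℂ p :=
  fun z => ((z.2 : ℂ) ^ a) • (pull wp z + ((z.2 : ℂ)⁻¹) • drWedge wm z)

/-- The tangential part has the denominator `J(r)²` and the radial part `J(r)³`; over the common
denominator the former acquires the factor `1 - cr²`. Once the powers of `r` and the values of the
forms are made opaque, a rational identity remains. -/
lemma exists_hasLaplacian_expansionTerm (hn : n ≠ 0) (hvol : IsVolumeForm h.toFun vol) {J : ℝ}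
    {p : ℕ} (hp : p ≤ n) {wp : DForm (𝓡 n) M ℂ p} (hwp : IsSmoothForm wp)
    {wm : LowForm (𝓡 n) M p} (hwm : IsSmoothLow wm) (lam : ℂ) (j : ℕ) (x : M) {r : ℝ} (hr : 0 < r)
    (hJ : Jfun n J r ≠ 0) (c β : ℂ) (hc : c = J / (2 * n)) (hβ : β = n - 2 * p) :
    ∃ Θ, HasLaplacian (gPlus h J) (volPlus vol J) (expansionTerm (lam + j) wp wm) (x, r) Θ ∧
      ∀ u : Fin p → TangentSpace (𝓡 n) x × ℝ,
      Θ (fun i => bVector x r (u i)) - lam * (β - lam) *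
        expansionTerm (lam + j) wp wm (x, r) (fun i => bVector x r (u i)) =
      (r : ℂ) ^ lam * (((Jfun n J r : ℝ) : ℂ) ^ 3)⁻¹ * (r ^ j *
      ((1 - c * r ^ 2) * (coeffb β lam (j + (2 : ℕ)) * c * evalPull x u wp * r ^ 2 +
        coeffc β lam (j + (4 : ℕ)) * c ^ 2 * evalPull x u wp * r ^ 4 +
        evalPull x u (formLaplacian h.toFun vol wp) * r ^ 2 +
        2 * evalPull x u (extDLow wm) -
        2 * c ^ 2 * evalPull x u (extDLow wm) * r ^ 4 -
        coeffa β lam (j + (0 : ℕ)) * evalPull x u wp) +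
      (coeffB β lam (j + (2 : ℕ)) * c * evalWedge x u wm * r ^ 2 +
        coeffC β lam (j + (4 : ℕ)) * c ^ 2 * evalWedge x u wm * r ^ 4 +
        coeffD β lam (j + (6 : ℕ)) * c ^ 3 * evalWedge x u wm * r ^ 6 +
        evalWedge x u (formLaplacianLow h.toFun vol wm) * r ^ 2 -
        c * evalWedge x u (formLaplacianLow h.toFun vol wm) * r ^ 4 +
        2 * evalWedge x u (codiff h.toFun vol wp) * r ^ 2 +
        2 * c * evalWedge x u (codiff h.toFun vol wp) * r ^ 4 -
        coeffA β lam (j + (0 : ℕ)) * evalWedge x u wm))) := by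
  have hr0 : (r : ℂ) ≠ 0 := by exact_mod_cast hr.ne'
  have hJ0 : ((Jfun n J r : ℝ) : ℂ) ≠ 0 := by exact_mod_cast hJ
  set a : ℂ := lam + j with ha
  have hd : ∀ k : ℕ, ∀ᶠ s : ℝ in 𝓝 r, HasDerivAt (fun s : ℝ => (s : ℂ) ^ a * ((s : ℂ)⁻¹) ^ k)
      ((a - k) * ((s : ℂ) ^ a * ((s : ℂ)⁻¹) ^ (k + 1))) s := fun k =>
    (lt_mem_nhds hr).mono fun s hs => hasDerivAt_cpow_mul_inv_pow a k hs
  have h1 := hasLaplacian_pull hn hvol hp hwp x hr.ne' hJ (hd 0)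
    ((hd 1).self_of_nhds.const_mul (a - (0 : ℕ)))
  have h2 := hasLaplacian_drWedge hn hvol hp hwm x hr.ne' hJ (hd 1)
    ((hd 2).self_of_nhds.const_mul (a - (1 : ℕ)))
  have h3 := h1.add h2
  have e : ((fun z : M × ℝ => ((z.2 : ℂ) ^ a * ((z.2 : ℂ)⁻¹) ^ 0) • pull wp z) +
      fun z : M × ℝ => ((z.2 : ℂ) ^ a * ((z.2 : ℂ)⁻¹) ^ 1) • drWedge wm z) =
      expansionTerm a wp wm := by
    funext z
    simp only [Pi.add_apply, expansionTerm, pow_zero, mul_one, pow_one, smul_add, smul_smul]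
  rw [e] at h3
  refine ⟨_, h3, fun u => ?_⟩
  have e1 : expansionTerm a wp wm (x, r) (fun i => bVector x r (u i)) =
      (r : ℂ) ^ a * (evalPull x u wp + evalWedge x u wm) := by
    rw [expansionTerm, ContinuousAlternatingMap.smul_apply, ContinuousAlternatingMap.add_apply,
      ContinuousAlternatingMap.smul_apply, pull_bVector, drWedge_bVector]
    simp only [smul_eq_mul]
    field_simp
  rw [e1]
  simp only [ContinuousAlternatingMap.smul_apply, ContinuousAlternatingMap.add_apply,
    pull_bVector, drWedge_bVector, smul_eq_mul]
  have e2 : (r : ℂ) ^ a = (r : ℂ) ^ lam * r ^ j := by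
    rw [ha, Complex.cpow_add _ _ hr0, Complex.cpow_natCast]
  have e3 : ((Jfun n J r : ℝ) : ℂ) = 1 - c * r ^ 2 := by
    rw [hc, Jfun]; push_cast; ring
  simp only [driftFun, thetaFun]
  push_cast
  rw [← hc, ← hβ, e2]
  rw [e3] at hJ0 ⊢
  rw [ha]
  simp only [coeffA, coeffB, coeffC, coeffD, coeffa, coeffb, coeffc]
  generalize evalPull x u wp = P
  generalize evalPull x u (formLaplacian h.toFun vol wp) = LP
  generalize evalPull x u (extDLow wm) = DM
  generalize evalWedge x u wm = W
  generalize evalWedge x u (formLaplacianLow h.toFun vol wm) = LW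
  generalize evalWedge x u (codiff h.toFun vol wp) = DP
  generalize (r : ℂ) ^ lam = L
  generalize (r : ℂ) ^ j = R
  generalize (j : ℂ) = j'
  clear h1 h2 h3 hd e e1 e2 e3 hc hβ ha
  generalize (r : ℂ) = ρ at *
  -- The denominator is kept opaque until all fractions are cleared.
  obtain ⟨D, hD⟩ : ∃ D, D = 1 - c * ρ ^ 2 := ⟨_, rfl⟩
  rw [← hD] at hJ0 ⊢
  field_simp
  rw [hD]
  ring

end AsymptoticSolution

/-! ### Equivalence of the eigenequation up to order `K` and the recurrence. -/

section AsymptoticSolutionIff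

set_option linter.unusedSectionVars false

variable {n : ℕ} {M : Type*} [TopologicalSpace M] [ChartedSpace (EuclideanSpace ℝ (Fin n)) M]
  [IsManifold (𝓡 n) ∞ M] {h : RMetric n M} {vol : DForm (𝓡 n) M ℝ n}

lemma laplacianPlus_partialSum (hn : n ≠ 0) (hvol : IsVolumeForm h.toFun vol) {J : ℝ}
    {p : ℕ} (hp : p ≤ n) {wp : ℕ → DForm (𝓡 n) M ℂ p} (hwp : ∀ j, IsSmoothForm (wp j))
    {wm : ℕ → LowForm (𝓡 n) M p} (hwm : ∀ j, IsSmoothLow (wm j)) (lam : ℂ) (K : ℕ) (x : M) {r : ℝ}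
    (hr : 0 < r) (hJ : Jfun n J r ≠ 0) (u : Fin p → TangentSpace (𝓡 n) x × ℝ) :
    (laplacianPlus h vol J (partialSum lam wp wm K) (x, r) -
        (lam * (n - 2 * p - lam)) • partialSum lam wp wm K (x, r)) (fun i => bVector x r (u i)) =
      expansionFun lam (J / (2 * n))
        ((1 - C (J / (2 * n) : ℂ) * X ^ 2) * polyPlus h vol (J / (2 * n)) (n - 2 * p) lam wp wm K x u +
          polyMinus h vol (J / (2 * n)) (n - 2 * p) lam wp wm K x u) r := by
  choose Θ hΘ hΘ' using fun j => exists_hasLaplacian_expansionTerm hn hvol hp (hwp j) (hwm j) lam j x hr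
    hJ (J / (2 * n)) (n - 2 * p) rfl rfl
  have hsum : ∀ K, HasLaplacian (gPlus h J) (volPlus vol J) (partialSum lam wp wm K) (x, r)
      (∑ j ∈ Finset.range (K + 1), Θ j) := by
    intro K
    induction K with
    | zero =>
      have e : partialSum lam wp wm 0 = expansionTerm (lam + (0 : ℕ)) (wp 0) (wm 0) := by
        funext z
        simp only [partialSum, zero_add, Finset.sum_range_one, expansionTerm]
      rw [e, zero_add, Finset.sum_range_one]
      exact hΘ 0
    | succ K ih =>
      have e : partialSum lam wp wm (K + 1) = partialSum lam wp wm K +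
          expansionTerm (lam + (K + 1 : ℕ)) (wp (K + 1)) (wm (K + 1)) := by
        funext z
        simp only [partialSum, Pi.add_apply, Finset.sum_range_succ _ (K + 1), expansionTerm]
      rw [e, Finset.sum_range_succ]
      exact ih.add (hΘ (K + 1))
  have e1 : partialSum lam wp wm K (x, r) =
      ∑ j ∈ Finset.range (K + 1), expansionTerm (lam + j) (wp j) (wm j) (x, r) := rfl
  rw [laplacianPlus, (hsum K).eq, e1, ContinuousAlternatingMap.sub_apply,
    ContinuousAlternatingMap.smul_apply, ContinuousAlternatingMap.sum_apply,
    ContinuousAlternatingMap.sum_apply, smul_eq_mul, Finset.mul_sum, ← Finset.sum_sub_distrib,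
    Finset.sum_congr rfl fun j _ => hΘ' j u]
  rw [expansionFun, ← Finset.mul_sum, mul_assoc]
  refine congrArg _ (congrArg₂ (· * ·) rfl ?_)
  simp only [polyPlus, polyMinus, eval_add, eval_sub, eval_mul, eval_C, eval_pow, eval_X, eval_one,
    eval_shiftPoly, Finset.mul_sum, ← Finset.sum_add_distrib, ← Finset.sum_sub_distrib]
  refine Finset.sum_congr rfl fun j _ => ?_
  ring

/-- Purely tangential vectors see only `polyPlus`, and `1 - cX²` can be cancelled modulo `X^(K+1)`;
this isolates the relation for `ω^(+)`. General vectors then give the relation for `ω^(-)`. -/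
theorem isAsymptoticSolution_iff (hn : n ≠ 0) (hvol : IsVolumeForm h.toFun vol) {J : ℝ}
    {p : ℕ} (hp : p ≤ n) {wp : ℕ → DForm (𝓡 n) M ℂ p} (hwp : ∀ j, IsSmoothForm (wp j))
    {wm : ℕ → LowForm (𝓡 n) M p} (hwm : ∀ j, IsSmoothLow (wm j)) (h0 : wm 0 = 0) (lam : ℂ) (K : ℕ) :
    IsAsymptoticSolution h vol J lam wp wm K ↔ SolvesRecurrence h vol J lam wp wm K := by
  have hreg : ∀ᶠ r : ℝ in 𝓝[>] 0, 0 < r ∧ Jfun n J r ≠ 0 := by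
    refine Eventually.and self_mem_nhdsWithin (Eventually.filter_mono nhdsWithin_le_nhds ?_)
    exact (hasDerivAt_Jfun n J 0).continuousAt.eventually_ne (by simp [Jfun])
  have h1 : IsAsymptoticSolution h vol J lam wp wm K ↔
      ∀ (x : M) (u : Fin p → TangentSpace (𝓡 n) x × ℝ), ∀ m ≤ K,
        ((1 - C (J / (2 * n) : ℂ) * X ^ 2) *
          polyPlus h vol (J / (2 * n)) (n - 2 * p) lam wp wm K x u +
          polyMinus h vol (J / (2 * n)) (n - 2 * p) lam wp wm K x u).coeff m = 0 := by
    refine forall_congr' fun x => forall_congr' fun u => ?_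
    rw [← expansionFun_isLittleO_iff lam (J / (2 * n))]
    refine Asymptotics.isLittleO_congr ?_ EventuallyEq.rfl
    filter_upwards [hreg] with r hr
    exact laplacianPlus_partialSum hn hvol hp hwp hwm lam K x hr.1 hr.2 u
  have hmul : ∀ Q : ℂ[X], (∀ m ≤ K, Q.coeff m = 0) → ∀ m ≤ K,
      ((1 - C (J / (2 * n) : ℂ) * X ^ 2) * Q).coeff m = 0 := by
    intro Q hQ m hm
    rw [sub_mul, one_mul, coeff_sub, hQ m hm, mul_assoc, coeff_C_mul, coeff_X_pow_mul']
    split_ifs with h2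
    · rw [hQ _ (by omega)]; simp
    · simp
  have hcancel : ∀ Q : ℂ[X], (∀ m ≤ K, ((1 - C (J / (2 * n) : ℂ) * X ^ 2) * Q).coeff m = 0) →
      ∀ m ≤ K, Q.coeff m = 0 := by
    intro Q hQ m
    induction m using Nat.strong_induction_on with
    | _ m ih =>
      intro hm
      have := hQ m hm
      rw [sub_mul, one_mul, coeff_sub, mul_assoc, coeff_C_mul, coeff_X_pow_mul'] at this
      split_ifs at this with h2
      · rw [ih (m - 2) (by omega) (by omega)] at this
        simpa using this
      · simpa using this
  rw [h1, solvesRecurrence_iff]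
  constructor
  · intro H
    have hplus : ∀ m ≤ K, residuePlus h vol (J / (2 * n)) (n - 2 * p) lam wp wm m = 0 := by
      intro m hm
      refine evalPull_ext fun x v => ?_
      rw [← coeff_polyPlus hm]
      refine hcancel _ (fun m hm => ?_) m hm
      have h2 := H x (fun i => (v i, 0)) m hm
      rwa [coeff_add, coeff_polyMinus hm, evalWedge_tangential, add_zero] at h2
    intro j _ hj
    refine ⟨evalWedge_ext fun x u => ?_, hplus j hj⟩
    have h2 := H x u j hj
    rwa [coeff_add, hmul _ (fun m hm => by rw [coeff_polyPlus hm, hplus m hm, map_zero]) j hj,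
      zero_add, coeff_polyMinus hj] at h2
  · intro H x u m hm
    have hz : ∀ m ≤ K, residueMinus h vol (J / (2 * n)) (n - 2 * p) lam wp wm m = 0 ∧
        residuePlus h vol (J / (2 * n)) (n - 2 * p) lam wp wm m = 0 := by
      intro m hm
      -- The index `0` is not part of the recurrence; its residues vanish because `a_0 = 0` and
      -- `ω_0^(-) = 0`.
      rcases Nat.eq_zero_or_pos m with rfl | hpos
      · constructor
        · simp [residueMinus, prev, h0, formLaplacianLow_zero, codiff_zero]
        · simp [residuePlus, prev, h0, formLaplacian_zero, extDLow_zero, coeffa]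
      · exact H m hpos hm
    rw [coeff_add, hmul _ (fun m hm => by rw [coeff_polyPlus hm, (hz m hm).2, map_zero]) m hm,
      coeff_polyMinus hm, (hz m hm).1, map_zero, add_zero]

end AsymptoticSolutionIff

/-! ### The solution operators -/

section SmoothSpaces

set_option linter.unusedSectionVars false

variable {n : ℕ} {M : Type*} [TopologicalSpace M] [ChartedSpace (EuclideanSpace ℝ (Fin n)) M]
  [IsManifold (𝓡 n) ∞ M] {h : RMetric n M} {vol : DForm (𝓡 n) M ℝ n}

/-- The space of smooth `p`-forms. -/
def smoothForms (n : ℕ) (M : Type*) [TopologicalSpace M] [ChartedSpace (EuclideanSpace ℝ (Fin n)) M]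
    [IsManifold (𝓡 n) ∞ M] (p : ℕ) : Submodule ℂ (DForm (𝓡 n) M ℂ p) where
  carrier := {α | IsSmoothForm α}
  add_mem' := IsSmoothForm.add
  zero_mem' := isSmoothForm_zero
  smul_mem' a _ hα := IsSmoothForm.smul hα a

/-- The space of smooth `(p-1)`-forms. -/
def smoothLow (n : ℕ) (M : Type*) [TopologicalSpace M] [ChartedSpace (EuclideanSpace ℝ (Fin n)) M]
    [IsManifold (𝓡 n) ∞ M] (p : ℕ) : Submodule ℂ (LowForm (𝓡 n) M p) where
  carrier := {α | IsSmoothLow α}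
  add_mem' {a b} ha hb := by
    rcases p with _ | k
    · trivial
    · exact IsSmoothForm.add (p := k) ha hb
  zero_mem' := by
    rcases p with _ | k
    · trivial
    · exact isSmoothForm_zero (p := k)
  smul_mem' a b hb := by
    rcases p with _ | k
    · trivial
    · exact IsSmoothForm.smul (p := k) hb a

lemma IsSmoothForm.codiff (hvol : IsSmoothForm vol) {p : ℕ} {α : DForm (𝓡 n) M ℂ p}
    (hα : IsSmoothForm α) : IsSmoothLow (codiff h.toFun vol α) := by
  rcases p with _ | k
  · trivial
  · exact IsSmoothForm.codiffSucc hvol hα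

lemma IsSmoothLow.extDLow {p : ℕ} {γ : LowForm (𝓡 n) M p} (hγ : IsSmoothLow γ) :
    IsSmoothForm (extDLow γ) := by
  rcases p with _ | k
  · exact isSmoothForm_zero
  · exact IsSmoothForm.extD (p := k) hγ

lemma codiff_add (hvol : IsSmoothForm vol) {p : ℕ} {α β : DForm (𝓡 n) M ℂ p}
    (hα : IsSmoothForm α) (hβ : IsSmoothForm β) :
    codiff h.toFun vol (α + β) = codiff h.toFun vol α + codiff h.toFun vol β := by
  rcases p with _ | k
  · rfl
  · exact codiffSucc_add hvol hα hβ

lemma codiff_smul (hvol : IsSmoothForm vol) {p : ℕ} (a : ℂ) {α : DForm (𝓡 n) M ℂ p}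
    (hα : IsSmoothForm α) : codiff h.toFun vol (a • α) = a • codiff h.toFun vol α := by
  rcases p with _ | k
  · rfl
  · exact codiffSucc_smul hvol a hα

lemma extDLow_add {p : ℕ} {α β : LowForm (𝓡 n) M p} (hα : IsSmoothLow α) (hβ : IsSmoothLow β) :
    extDLow (α + β) = extDLow α + extDLow β := by
  rcases p with _ | k
  · exact (add_zero _).symm
  · exact extD_add (p := k) hα hβ

lemma extDLow_smul {p : ℕ} (a : ℂ) {α : LowForm (𝓡 n) M p} (hα : IsSmoothLow α) :
    extDLow (a • α) = a • extDLow α := by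
  rcases p with _ | k
  · exact (smul_zero _).symm
  · exact extD_smul (p := k) a hα

/-- The operator `dδ` on `(p-1)`-forms. -/
def lowerLow (h : RMetric n M) (vol : DForm (𝓡 n) M ℝ n) :
    ∀ {p : ℕ}, LowForm (𝓡 n) M p → LowForm (𝓡 n) M p
  | 0, _ => PUnit.unit
  | k + 1, γ => extDLow (p := k) (codiff (p := k) h.toFun vol γ)

lemma formLaplacianLow_eq {p : ℕ} (γ : LowForm (𝓡 n) M p) :
    formLaplacianLow h.toFun vol γ = lowerLow h vol γ + codiff h.toFun vol (extDLow γ) := by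
  rcases p with _ | k <;> rfl

/-- `d : Ω^{p-1} → Ω^p` on smooth forms. -/
def dLin (n : ℕ) (M : Type*) [TopologicalSpace M] [ChartedSpace (EuclideanSpace ℝ (Fin n)) M]
    [IsManifold (𝓡 n) ∞ M] (p : ℕ) : smoothLow n M p →ₗ[ℂ] smoothForms n M p where
  toFun γ := ⟨extDLow γ.1, IsSmoothLow.extDLow γ.2⟩
  map_add' γ γ' := Subtype.ext (extDLow_add γ.2 γ'.2)
  map_smul' a γ := Subtype.ext (extDLow_smul a γ.2)

/-- `δ : Ω^p → Ω^{p-1}` on smooth forms. -/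
def deltaLin (h : RMetric n M) (hvol : IsSmoothForm vol) (p : ℕ) :
    smoothForms n M p →ₗ[ℂ] smoothLow n M p where
  toFun α := ⟨codiff h.toFun vol α.1, IsSmoothForm.codiff hvol α.2⟩
  map_add' α β := Subtype.ext (codiff_add hvol α.2 β.2)
  map_smul' a α := Subtype.ext (codiff_smul hvol a α.2)

/-- `δd` on smooth `p`-forms. -/
def upperLin (h : RMetric n M) (hvol : IsSmoothForm vol) (p : ℕ) :
    Module.End ℂ (smoothForms n M p) where
  toFun α := ⟨codiffSucc h.toFun vol (extD α.1), IsSmoothForm.codiffSucc hvol (IsSmoothForm.extD α.2)⟩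
  map_add' α β := Subtype.ext (by
    change codiffSucc h.toFun vol (extD (α.1 + β.1)) = _
    rw [extD_add α.2 β.2, codiffSucc_add hvol (IsSmoothForm.extD α.2) (IsSmoothForm.extD β.2)]
    rfl)
  map_smul' a α := Subtype.ext (by
    change codiffSucc h.toFun vol (extD (a • α.1)) = _
    rw [extD_smul a α.2, codiffSucc_smul hvol a (IsSmoothForm.extD α.2)]
    rfl)

/-- `dδ` on smooth `(p-1)`-forms. -/
def lowerLin (h : RMetric n M) (hvol : IsSmoothForm vol) (p : ℕ) :
    Module.End ℂ (smoothLow n M p) where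
  toFun γ := ⟨lowerLow h vol γ.1, by
    obtain ⟨γ, hγ⟩ := γ
    rcases p with _ | k
    · trivial
    · exact IsSmoothLow.extDLow (IsSmoothForm.codiff (p := k) hvol hγ)⟩
  map_add' γ γ' := Subtype.ext (by
    obtain ⟨γ, hγ⟩ := γ
    obtain ⟨γ', hγ'⟩ := γ'
    rcases p with _ | k
    · rfl
    · exact (congrArg extDLow (codiff_add (p := k) hvol hγ hγ')).trans
        (extDLow_add (IsSmoothForm.codiff hvol hγ) (IsSmoothForm.codiff hvol hγ')))
  map_smul' a γ := Subtype.ext (by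
    obtain ⟨γ, hγ⟩ := γ
    rcases p with _ | k
    · rfl
    · exact (congrArg extDLow (codiff_smul (p := k) hvol a hγ)).trans
        (extDLow_smul a (IsSmoothForm.codiff hvol hγ)))

/-- This relation and the next two are all that the abstract recurrences require of the complex of
forms. -/
lemma deltaLin_upperLin (hn : n ≠ 0) (hvol : IsVolumeForm h.toFun vol) (p : ℕ)
    (α : smoothForms n M p) : deltaLin h hvol.1 p (upperLin h hvol.1 p α) = 0 := by
  refine Subtype.ext ?_
  rcases p with _ | k
  · rfl
  · exact codiffSucc_codiffSucc hn hvol (IsSmoothForm.extD α.2)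

lemma upperLin_dLin (hvol : IsVolumeForm h.toFun vol) (p : ℕ)
    (γ : smoothLow n M p) : upperLin h hvol.1 p (dLin n M p γ) = 0 := by
  refine Subtype.ext ?_
  obtain ⟨γ, hγ⟩ := γ
  change codiffSucc h.toFun vol (extD (extDLow γ)) = 0
  rcases p with _ | k
  · exact (congrArg (codiffSucc h.toFun vol) extD_zero).trans codiffSucc_zero
  · exact (congrArg (codiffSucc h.toFun vol) (extD_extD (p := k) hγ)).trans codiffSucc_zero

lemma lowerLin_deltaLin (hn : n ≠ 0) (hvol : IsVolumeForm h.toFun vol) (p : ℕ)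
    (α : smoothForms n M p) : lowerLin h hvol.1 p (deltaLin h hvol.1 p α) = 0 := by
  refine Subtype.ext ?_
  obtain ⟨α, hα⟩ := α
  rcases p with _ | _ | l
  · rfl
  · rfl
  · exact (congrArg extD (codiffSucc_codiffSucc hn hvol hα)).trans extD_zero

/-- The solution operators are defined on arbitrary forms, where `d` and `δ` need not be linear. On
the submodule of smooth forms the polynomial calculus of endomorphisms applies. -/
lemma coe_scaledEval {W : Type*} [AddCommGroup W] [Module ℂ W] {S : Submodule ℂ W} {D : W → W}
    {T : Module.End ℂ S} (hT : ∀ v : S, (T v : W) = D v) (N : ℕ) (κ c : ℂ) (s : ℂ[X]) (v : S) :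
    scaledEval N κ c s D (v : W) = (scaledEval N κ c s T v : S) := by
  have hi : ∀ i : ℕ, ((T^[i] v : S) : W) = D^[i] v := by
    intro i
    induction i with
    | zero => rfl
    | succ i ih => rw [Function.iterate_succ_apply', Function.iterate_succ_apply', hT, ih]
  simp only [scaledEval, Submodule.coe_sum, Submodule.coe_smul, hi]

variable {β lam c : ℂ} {m p : ℕ}

lemma TMinus_eq (hvol : IsVolumeForm h.toFun vol) {J : ℝ} (hβ : β = n - 2 * p)
    (hc : c = J / (2 * n)) (φ : smoothForms n M p) (k : ℕ) :
    TMinus h vol J lam k φ.1 =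
      (solMinus (dLin n M p) (deltaLin h hvol.1 p) β lam c k φ).1 := by
  rcases k with _ | k
  · rw [solMinus, pMinus_nonpos _ _ _ (by simp), map_zero]
    rfl
  · have e1 : (2 * J / n : ℂ) = 4 * c := by rw [hc]; ring
    rw [solMinus, Nat.cast_succ, pMinus_succ, aeval_C_mul_apply, hHyp, ← sMinus_eq,
      ← scaledEval_eq_aeval, ← e1, Submodule.coe_smul,
      ← coe_scaledEval (D := fun η => codiff h.toFun vol (extDLow η)) (fun _ => rfl), hβ]
    rfl

lemma TPlus_def {J : ℝ} (hβ : β = n - 2 * p) (κ : ℂ) (hκ : κ = 2 * J / n)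
    (φ : DForm (𝓡 n) M ℂ p) (k : ℕ) :
    TPlus h vol J lam k φ =
      ((lam - β) * ∏ i ∈ Finset.Icc 1 k, coeffa β lam (2 * i))⁻¹ •
        ((lam - β) • scaledEval k κ (β / 2 * (β / 2 - 1)) (sPlus β lam k)
          (fun η => codiffSucc h.toFun vol (extD η)) φ +
        scaledEval k κ (β / 2 * (β / 2 + 1)) (s1 β lam k)
          (fun η => extDLow (codiff h.toFun vol η)) φ) := by
  subst hβ hκ
  unfold TPlus
  dsimp only

-- The factor `λ - β` in front of `s^(+)` cancels against the normalisation and leaves `pPlus`; the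
-- `s^(1)`-term is `Q_k - Q_k(0)` by `homog_s1_eq`. The scale is `κ = 2J/n = 4c`.
set_option maxHeartbeats 1000000 in
lemma TPlus_eq (hvol : IsVolumeForm h.toFun vol) {J : ℝ} (hβ : β = n - 2 * p)
    (hc : c = J / (2 * n)) (hlam : lam ≠ β)
    (ha : ∀ i : ℕ, 1 ≤ i → i ≤ m → coeffa β lam (2 * i) ≠ 0) (φ : smoothForms n M p) {k : ℕ}
    (hk : k ≤ m) :
    TPlus h vol J lam k φ.1 =
      (solPlus (dLin n M p) (deltaLin h hvol.1 p) (upperLin h hvol.1 p) β lam c k φ).1 := by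
  have e1 : (2 * J / n : ℂ) = 4 * c := by rw [hc]; ring
  have hs : lam - β ≠ 0 := sub_ne_zero.2 hlam
  have h1 : aeval (dLin n M p ∘ₗ deltaLin h hvol.1 p : Module.End ℂ (smoothForms n M p))
      (pMixed β lam c k) φ - (pMixed β lam c k).eval 0 • φ =
      ((lam - β) * ∏ k ∈ Finset.Icc 1 k, coeffa β lam (2 * k))⁻¹ •
        scaledEval k (4 * c) (β / 2 * (β / 2 + 1)) (s1 β lam k)
          (dLin n M p ∘ₗ deltaLin h hvol.1 p : Module.End ℂ (smoothForms n M p)) φ := by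
    rw [scaledEval_eq_aeval, ← aeval_C_mul_apply, homog_s1_eq ha hk, map_sub, LinearMap.sub_apply,
      aeval_C, Module.algebraMap_end_apply]
  have h2 : aeval (upperLin h hvol.1 p) (pPlus β lam c k) φ =
      (∏ k ∈ Finset.Icc 1 k, coeffa β lam (2 * k))⁻¹ •
        scaledEval k (4 * c) (β / 2 * (β / 2 - 1)) (sPlus β lam k) (upperLin h hvol.1 p) φ := by
    rw [scaledEval_eq_aeval, pPlus_nat, aeval_C_mul_apply, hHyp, ← sPlus_eq]
  have h3 := coe_scaledEval (D := fun η => codiffSucc h.toFun vol (extD η))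
    (T := upperLin h hvol.1 p) (fun _ => rfl) k (4 * c) (β / 2 * (β / 2 - 1)) (sPlus β lam k) φ
  have h4 := coe_scaledEval (D := fun η => extDLow (codiff h.toFun vol η))
    (T := dLin n M p ∘ₗ deltaLin h hvol.1 p) (fun _ => rfl) k (4 * c) (β / 2 * (β / 2 + 1))
    (s1 β lam k) φ
  have h5 : (lam - β) * ((lam - β) * ∏ k ∈ Finset.Icc 1 k, coeffa β lam (2 * k))⁻¹ =
      (∏ k ∈ Finset.Icc 1 k, coeffa β lam (2 * k))⁻¹ := by
    rw [mul_inv, mul_inv_cancel_left₀ hs]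
  rw [TPlus_def hβ (4 * c) e1.symm, h3, h4, smul_add, smul_smul, mul_comm _ (lam - β), h5]
  have h7 := congrArg₂ (· + ·) h2 h1
  rw [← add_sub_assoc] at h7
  exact (congrArg Subtype.val h7).symm

end SmoothSpaces

/-! ### Existence and uniqueness of solutions of the recurrence. -/

section Main

set_option linter.unusedSectionVars false

variable {n : ℕ} {M : Type*} [TopologicalSpace M] [ChartedSpace (EuclideanSpace ℝ (Fin n)) M]
  [IsManifold (𝓡 n) ∞ M] {h : RMetric n M} {vol : DForm (𝓡 n) M ℝ n} {β lam c : ℂ} {m p : ℕ}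

/-- `a_{2i} = 4i(λ - (β/2 - i))`, and `λ = β/2 - N` with `N > m` excludes `N = i ≤ m`. -/
lemma coeffa_ne_zero (hm : (∀ N ∈ Finset.Icc 1 m, lam ≠ β / 2 - N) ∨
    (∃ N : ℕ, lam = β / 2 - N ∧ m < N)) (i : ℕ) (hi : 1 ≤ i) (him : i ≤ m) :
    coeffa β lam (2 * i) ≠ 0 := by
  have hi0 : (i : ℂ) ≠ 0 := by exact_mod_cast (by omega : i ≠ 0)
  have hne : lam ≠ β / 2 - i := by
    rcases hm with hm | ⟨N, rfl, hN⟩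
    · exact hm i (Finset.mem_Icc.2 ⟨hi, him⟩)
    · intro h
      have : (N : ℂ) = i := by linear_combination -h
      have : N = i := by exact_mod_cast this
      omega
  intro h0
  apply hne
  rw [coeffa] at h0
  have h1 : (i : ℂ) * (lam - (β / 2 - i)) = 0 := by linear_combination h0 / 4
  exact sub_eq_zero.1 ((mul_eq_zero.1 h1).resolve_left hi0)

lemma evenSeq_two_mul {V : Type*} [Zero V] (v : ℕ → V) (k : ℕ) : evenSeq v (2 * k) = v k := by
  simp [evenSeq]

lemma evenSeq_odd {V : Type*} [Zero V] (v : ℕ → V) {j : ℕ} (hj : ¬ Even j) : evenSeq v j = 0 := by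
  simp [evenSeq, hj]

lemma prev_evenSeq_odd {V : Type*} [Zero V] (v : ℕ → V) {j : ℕ} (hj : ¬ Even j) {i : ℕ}
    (hi : Even i) : prev (evenSeq v) j i = 0 := by
  unfold prev
  split_ifs with h
  · refine evenSeq_odd v fun h' => hj ?_
    have := h'.add hi
    rwa [Nat.sub_add_cancel h] at this
  · rfl

/-- Replaces the convention of `prev` for missing members by integer indices, with zero members at
negative index. -/
lemma prev_evenSeq_two_mul {V : Type*} [Zero V] {v : ℕ → V} {w : ℤ → V} {k : ℕ}
    (hv : ∀ i ≤ k, v i = w i) (hw : ∀ i < 0, w i = 0) (i : ℕ) :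
    prev (evenSeq v) (2 * k) (2 * i) = w (k - i) := by
  unfold prev
  split_ifs with h
  · rw [← Nat.mul_sub, evenSeq_two_mul, hv _ (by omega), Nat.cast_sub (by omega)]
  · rw [hw _ (by omega)]

lemma solMinus_of_nonpos {V L : Type*} [AddCommGroup V] [Module ℂ V] [AddCommGroup L] [Module ℂ L]
    (d : L →ₗ[ℂ] V) (δ : V →ₗ[ℂ] L) {k : ℤ} (hk : k ≤ 0) (φ : V) :
    solMinus d δ β lam c k φ = 0 := by
  rw [solMinus, pMinus_nonpos _ _ _ hk, map_zero]; rfl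

lemma solPlus_of_neg {V L : Type*} [AddCommGroup V] [Module ℂ V] [AddCommGroup L] [Module ℂ L]
    (d : L →ₗ[ℂ] V) (δ : V →ₗ[ℂ] L) (Dx : Module.End ℂ V) {k : ℤ} (hk : k < 0) (φ : V) :
    solPlus d δ Dx β lam c k φ = 0 := by
  rw [solPlus, pPlus_neg _ _ _ hk, pMixed_neg _ _ _ hk]; simp

lemma solPlus_zero {V L : Type*} [AddCommGroup V] [Module ℂ V] [AddCommGroup L] [Module ℂ L]
    (d : L →ₗ[ℂ] V) (δ : V →ₗ[ℂ] L) (Dx : Module.End ℂ V) (hlam : lam ≠ β) (φ : V) :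
    solPlus d δ Dx β lam c 0 φ = φ := by
  have hs : lam - β ≠ 0 := sub_ne_zero.2 hlam
  have h1 : pPlus β lam c 0 = 1 := by
    have := pPlus_nat β lam c 0
    rw [hHyp_zero] at this
    simpa using this
  have h2 : pMinus β lam c (0 + 1) = C ((lam - β)⁻¹) := by
    have := pMinus_succ β lam c 0
    rw [hHyp_zero] at this
    simpa using this
  have h3 : pMixed β lam c 0 = 1 := by
    rw [pMixed, h2, pMinus_nonpos _ _ _ le_rfl, pMinus_nonpos _ _ _ (by norm_num), ← C_mul]
    simp [hs]
  rw [solPlus, h1, h3]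
  simp

/-- All shifts in (2) are even. Hence the relations of odd index are trivial, and those of even
index are `solMinus_rec` and `solPlus_rec` for the complex of smooth forms. -/
theorem solvesRecurrence_solution (hn : n ≠ 0) (hvol : IsVolumeForm h.toFun vol) {J : ℝ}
    (hβ : β = n - 2 * p) (hlam : lam ≠ β)
    (ha : ∀ i : ℕ, 1 ≤ i → i ≤ m → coeffa β lam (2 * i) ≠ 0) (φ : smoothForms n M p) :
    SolvesRecurrence h vol J lam (evenSeq fun k => TPlus h vol J lam k φ.1)
      (evenSeq fun k => TMinus h vol J lam k φ.1) (2 * m) := by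
  obtain ⟨c, hc⟩ : ∃ c : ℂ, c = J / (2 * n) := ⟨_, rfl⟩
  simp only [SolvesRecurrence]
  rw [← hβ, ← hc]
  intro j _ hj
  by_cases hjo : Even j
  · obtain ⟨k, rfl⟩ := even_iff_two_dvd.1 hjo
    have hk : k ≤ m := by omega
    have hk' : (k : ℤ) ≤ m := by exact_mod_cast hk
    set ωp : ℤ → DForm (𝓡 n) M ℂ p := fun i =>
      (solPlus (dLin n M p) (deltaLin h hvol.1 p) (upperLin h hvol.1 p) β lam c i φ).1 with hωp
    set ωm : ℤ → LowForm (𝓡 n) M p := fun i =>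
      (solMinus (dLin n M p) (deltaLin h hvol.1 p) β lam c i φ).1 with hωm
    have ep : ∀ i ≤ k, TPlus h vol J lam i φ.1 = ωp i := fun i hi =>
      TPlus_eq hvol hβ hc hlam ha φ (hi.trans hk)
    have em : ∀ i ≤ k, TMinus h vol J lam i φ.1 = ωm i := fun i _ => TMinus_eq hvol hβ hc φ i
    have hp0 : ∀ i < 0, ωp i = 0 := fun i hi => by
      rw [hωp]; exact congrArg Subtype.val (solPlus_of_neg _ _ _ hi φ)
    have hm0 : ∀ i < 0, ωm i = 0 := fun i hi => by
      rw [hωm]; exact congrArg Subtype.val (solMinus_of_nonpos _ _ hi.le φ)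
    have qp := prev_evenSeq_two_mul ep hp0
    have qm := prev_evenSeq_two_mul em hm0
    have qp1 := qp 1
    have qp2 := qp 2
    have qm1 := qm 1
    have qm2 := qm 2
    have qm3 := qm 3
    simp only [Nat.reduceMul, Nat.cast_one, Nat.cast_ofNat] at qp1 qp2 qm1 qm2 qm3
    rw [qp1, qp2, qm1, qm2, qm3, evenSeq_two_mul, evenSeq_two_mul, ep k le_rfl, em k le_rfl,
      formLaplacianLow_eq, formLaplacianLow_eq, formLaplacian]
    have r1 := congrArg Subtype.val (solMinus_rec (c := c) (d := dLin n M p)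
      (E := lowerLin h hvol.1 p) hlam ha
      (deltaLin_upperLin hn hvol p) (lowerLin_deltaLin hn hvol p) hk' φ)
    have r2 := congrArg Subtype.val (solPlus_rec (c := c) hlam ha
      (deltaLin_upperLin hn hvol p) (upperLin_dLin hvol p) hk' φ)
    push_cast at r1 r2 ⊢
    exact ⟨r1, r2⟩
  · have e2 : Even 2 := by decide
    have e4 : Even 4 := by decide
    have e6 : Even 6 := by decide
    rw [evenSeq_odd _ hjo, evenSeq_odd _ hjo, prev_evenSeq_odd _ hjo e2, prev_evenSeq_odd _ hjo e4,
      prev_evenSeq_odd _ hjo e6, prev_evenSeq_odd _ hjo e2, prev_evenSeq_odd _ hjo e4,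
      formLaplacianLow_zero, codiff_zero, formLaplacian_zero, extDLow_zero]
    simp

lemma TPlus_mem_smoothForms (hvol : IsVolumeForm h.toFun vol) {J : ℝ} (φ : smoothForms n M p)
    (k : ℕ) : TPlus h vol J lam k φ.1 ∈ smoothForms n M p := by
  rw [TPlus_def rfl _ rfl, coe_scaledEval (T := upperLin h hvol.1 p) (fun _ => rfl),
    coe_scaledEval (D := fun η => extDLow (codiff h.toFun vol η))
      (T := dLin n M p ∘ₗ deltaLin h hvol.1 p) (fun _ => rfl)]
  exact Submodule.smul_mem _ _ (Submodule.add_mem _ (Submodule.smul_mem _ _ (Subtype.property _))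
    (Subtype.property _))

lemma TMinus_mem_smoothLow (hvol : IsVolumeForm h.toFun vol) {J : ℝ} (φ : smoothForms n M p)
    (k : ℕ) : TMinus h vol J lam k φ.1 ∈ smoothLow n M p := by
  rw [TMinus_eq hvol rfl rfl]
  exact Subtype.property _

lemma evenSeq_mem {V : Type*} [AddCommGroup V] [Module ℂ V] {S : Submodule ℂ V} {v : ℕ → V}
    (hv : ∀ k, v k ∈ S) (j : ℕ) : evenSeq v j ∈ S := by
  unfold evenSeq
  split_ifs
  exacts [hv _, S.zero_mem]

lemma prev_congr {V : Type*} [Zero V] {v w : ℕ → V} {k : ℕ}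
    (hvw : ∀ i < k, v (2 * i) = w (2 * i)) {i : ℕ} (hi : 1 ≤ i) :
    prev v (2 * k) (2 * i) = prev w (2 * k) (2 * i) := by
  unfold prev
  split_ifs with h
  · rw [← Nat.mul_sub, hvw _ (by omega)]
  · rfl

/-- Two solutions of the recurrence relations with the same leading coefficients have the same
coefficients of even index as long as the recurrence relations determine them. -/
theorem SolvesRecurrence.unique {J : ℝ} (hβ : β = n - 2 * p)
    (ha : ∀ i : ℕ, 1 ≤ i → i ≤ m → coeffa β lam (2 * i) ≠ 0)
    {wp vp : ℕ → DForm (𝓡 n) M ℂ p} {wm vm : ℕ → LowForm (𝓡 n) M p}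
    (hw : SolvesRecurrence h vol J lam wp wm (2 * m))
    (hv : SolvesRecurrence h vol J lam vp vm (2 * m)) (h0p : wp 0 = vp 0) (h0m : wm 0 = vm 0)
    (k : ℕ) (hk : k ≤ m)
    (hA : p ≠ 0 → ∀ i ∈ Finset.Icc 1 k, coeffA β lam (2 * i) ≠ 0) :
    wp (2 * k) = vp (2 * k) ∧ wm (2 * k) = vm (2 * k) := by
  induction k using Nat.strong_induction_on with
  | _ k ih =>
    rcases Nat.eq_zero_or_pos k with rfl | hk0
    · exact ⟨h0p, h0m⟩
    have ih' : ∀ i < k, wp (2 * i) = vp (2 * i) ∧ wm (2 * i) = vm (2 * i) := fun i hi =>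
      ih i hi (hi.le.trans hk) fun hp l hl => hA hp l
        (Finset.mem_Icc.2 ⟨(Finset.mem_Icc.1 hl).1, (Finset.mem_Icc.1 hl).2.trans hi.le⟩)
    have qp {i : ℕ} (hi : 1 ≤ i) := prev_congr (fun i hi => (ih' i hi).1) hi
    have qm {i : ℕ} (hi : 1 ≤ i) := prev_congr (fun i hi => (ih' i hi).2) hi
    have qp1 := qp (i := 1) le_rfl
    have qp2 := qp (i := 2) (by norm_num)
    have qm1 := qm (i := 1) le_rfl
    have qm2 := qm (i := 2) (by norm_num)
    have qm3 := qm (i := 3) (by norm_num)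
    simp only [Nat.reduceMul] at qp1 qp2 qm1 qm2 qm3
    obtain ⟨w1, w2⟩ := hw (2 * k) (by omega) (by omega)
    obtain ⟨v1, v2⟩ := hv (2 * k) (by omega) (by omega)
    rw [← hβ] at w1 w2 v1 v2
    rw [qp1, qp2, qm1, qm2, qm3, ← v1] at w1
    -- `ω^(-)_{2k}` comes first, because the relation for `ω^(+)_{2k}` contains its differential.
    -- For `p = 0` it lives in a one-point space and needs no condition on `A_{2k}`.
    have hm' : wm (2 * k) = vm (2 * k) := by
      rcases Nat.eq_zero_or_pos p with rfl | hp
      · rfl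
      · refine smul_right_injective _ (hA hp.ne' k (Finset.mem_Icc.2 ⟨hk0, le_rfl⟩)) ?_
        push_cast at w1
        exact w1
    rw [qp1, qp2, qm2, hm', ← v2] at w2
    refine ⟨smul_right_injective _ (ha k hk0 hk) ?_, hm'⟩
    push_cast at w2
    exact w2

end Main

end PoincareEinstein

end

open PoincareEinstein in
theorem theorem3p3 {n : ℕ} (hn : 3 ≤ n) {M : Type*} [TopologicalSpace M]
    [ChartedSpace (EuclideanSpace ℝ (Fin n)) M] [IsManifold (𝓡 n) ∞ M]
    (h : RMetric n M) (vol : DForm (𝓡 n) M ℝ n) (hvol : IsVolumeForm h.toFun vol)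
    (J : ℝ) (hJ : IsEinstein h J)
    (p : ℕ) (hp : p ≤ n) (φ : DForm (𝓡 n) M ℂ p) (hφ : IsSmoothForm φ)
    (β : ℂ) (hβ : β = n - 2 * p) (lam : ℂ) (hlam : lam ≠ β) (m : ℕ)
    (hm : (∀ N ∈ Finset.Icc 1 m, lam ≠ β / 2 - N) ∨ (∃ N : ℕ, lam = β / 2 - N ∧ m < N)) :
    -- the operators map smooth forms to smooth forms
    (∀ k ≤ m, IsSmoothForm (TPlus h vol J lam k φ) ∧ IsSmoothLow (TMinus h vol J lam k φ)) ∧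
    -- they satisfy the boundary conditions
    TPlus h vol J lam 0 φ = φ ∧ TMinus h vol J lam 0 φ = 0 ∧
    -- they solve the recurrence relations and the eigenform equation
    SolvesRecurrence h vol J lam (evenSeq fun k => TPlus h vol J lam k φ)
      (evenSeq fun k => TMinus h vol J lam k φ) (2 * m) ∧
    IsAsymptoticSolution h vol J lam (evenSeq fun k => TPlus h vol J lam k φ)
      (evenSeq fun k => TMinus h vol J lam k φ) (2 * m) ∧
    -- every solution with these boundary data is given by them, as long as the recurrence
    -- determines the coefficients `ω_{2i}^(-)`
    (∀ (wp : ℕ → DForm (𝓡 n) M ℂ p) (wm : ℕ → LowForm (𝓡 n) M p),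
      (∀ j, IsSmoothForm (wp j)) → (∀ j, IsSmoothLow (wm j)) → wp 0 = φ → wm 0 = 0 →
      (SolvesRecurrence h vol J lam wp wm (2 * m) ∨
        IsAsymptoticSolution h vol J lam wp wm (2 * m)) →
      ∀ k ≤ m, (p ≠ 0 → ∀ i ∈ Finset.Icc 1 k, coeffA β lam (2 * i) ≠ 0) →
        wp (2 * k) = TPlus h vol J lam k φ ∧ wm (2 * k) = TMinus h vol J lam k φ) := by
  have hn0 : n ≠ 0 := by omega
  have ha := coeffa_ne_zero hm
  obtain ⟨φ, rfl⟩ : ∃ ψ : smoothForms n M p, ψ.1 = φ := ⟨⟨φ, hφ⟩, rfl⟩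
  have hsp := fun k => TPlus_mem_smoothForms (lam := lam) hvol (J := J) φ k
  have hsm := fun k => TMinus_mem_smoothLow (lam := lam) hvol (J := J) φ k
  have h0p : TPlus h vol J lam 0 φ.1 = φ.1 := by
    rw [TPlus_eq hvol hβ rfl hlam ha φ (Nat.zero_le _), Nat.cast_zero, solPlus_zero _ _ _ hlam]
  have h0m : TMinus h vol J lam 0 φ.1 = 0 := rfl
  have hsol := solvesRecurrence_solution hn0 hvol (J := J) hβ hlam ha φ
  refine ⟨fun k _ => ⟨hsp k, hsm k⟩, h0p, h0m, hsol, ?_, fun wp wm hwp hwm hp0 hm0 hw k hk hA => ?_⟩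
  · exact (isAsymptoticSolution_iff hn0 hvol hp (evenSeq_mem hsp) (evenSeq_mem hsm) h0m _ _).2 hsol
  · have hw' := hw.elim id (isAsymptoticSolution_iff hn0 hvol hp hwp hwm hm0 _ _).1
    have := hw'.unique hβ ha hsol (hp0.trans h0p.symm) (hm0.trans h0m.symm) k hk hA
    rwa [evenSeq_two_mul, evenSeq_two_mul] at this
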